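/- **Theorem 8.4.** Let $k$ be a field. *Setting.* Let $G=\mathrm{Aut}(\mathbf{R},<)$; for finite $A\subset\mathbf{R}$ let $G(A)$ be the subgroup fixing each element of $A$, and call a subgroup open if it contains some $G(A)$. A *finitary $G$-set* is a $G$-set with open stabilizers and finitely many orbits; an example is the set $\mathbf{R}^{(n)}$ of tuples $x_1<\dots<x_n$ of reals. For a finitary $G$-set $X$, the *Schwartz space* $\mathcal{C}(X)$ is the space of functions $\varphi\colon X\to k$ that are invariant under some open subgroup $G(A)$ and whose support is a finite union of $G(A)$-orbits. Integration $\int_X\colon\mathcal{C}(X)\to k$ is taken with respect to the principal (Euler characteristic) measure: $\int_X\varphi=\sum_O \varphi(O)\,\mathrm{vol}(O)$, the sum over the $G(A)$-orbits $O$ in the support of $\varphi$, for any finite $A$ such that $\varphi$ is $G(A)$-invariant; here $\mathrm{vol}(O)=(-1)^{n_0+\dots+n_r}$ if $O\cong I_0^{(n_0)}\times\dots\times I_r^{(n_r)}$, where $I_0,\dots,I_r$ are the components of $\mathbf{R}\setminus A$. * $\underline{\mathrm{Perm}}(G)$ is the category with objects $\mathrm{Vec}_X$, for $X$ a finitary $G$-set,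 with morphisms $\mathrm{Vec}_X\to\mathrm{Vec}_Y$ the $G$-invariant Schwartz functions on $Y\times X$, and with composition $(AB)(z,x)=\int_Y A(z,y)B(y,x)\,dy$. * $A(G)=\varprojlim_U\mathcal{C}(G/U)$ (limit over the open subgroups $U$, along push-forward, i.e. integration over fibres) is the completed group algebra, with the convolution product $(ab)_U(x)=\int_{G/V}a_V(g)\,b_U(g^{-1}x)\,dg$, where $V$ is an open subgroup such that $b_U$ is left $V$-invariant; it acts on each $\mathcal{C}(X)$ by the same formula. $\underline{\mathrm{Rep}}(G)$ is the category of *smooth* $A(G)$-modules $M$ (for each $x\in M$ there is an open $U$ such that the action on $x$ factors through $\mathcal{C}(G/U)$), and $\underline{\mathrm{Rep}}^{\mathrm f}(G)$ is its full subcategory of objects of finite length. There is a functor $\underline{\mathrm{Perm}}(G)\to\underline{\mathrm{Rep}}(G)$, $\mathrm{Vec}_X\mapsto\mathcal{C}(X)$, which sends a matrix $A$ to the operator $\varphi\mapsto\int_X A(\cdot,x)\varphi(x)\,dx$. *Paths.* For $a\in\mathbf{N}^s$ let $\Gamma(a)$ be the set of $a$-Delannoy paths, i.e. tuples $p=(p_1,\dots,p_\ell)$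 of non-zero 0-1 vectors in $\mathbf{R}^s$ with sum $a$; the length is $\ell(p)=\ell$. Projecting the steps to some of the coordinates and deleting the zero vectors gives the projection of a path. Given $p_1\in\Gamma(n,m)$, $p_2\in\Gamma(m,l)$, $p_3\in\Gamma(n,l)$, there is at most one $q\in\Gamma(n,m,l)$ whose projections to the coordinates $(1,2)$, $(2,3)$, $(1,3)$ are $p_1,p_2,p_3$; put $\epsilon(p_1,p_2,p_3)=(-1)^{\ell(q)+\ell(p_3)}$ if $q$ exists, and $0$ otherwise. Let $\mathcal{D}(n,m)$ be the $k$-vector space with basis $\{[p]: p\in\Gamma(n,m)\}$, and define a bilinear composition law $\mathcal{D}(n,m)\times\mathcal{D}(m,l)\to\mathcal{D}(n,l)$ by $$[p_1]\circ[p_2]=\sum_{p_3\in\Gamma(n,l)}\epsilon(p_1,p_2,p_3)\,[p_3].$$ Let $\mathcal{D}$ have objects $X_n$ ($n\in\mathbf{N}$) and $\mathrm{Hom}(X_m,X_n)=\mathcal{D}(n,m)$. For $p\in\Gamma(n,m)$ let $O_p\subset\mathbf{R}^{(n)}\times\mathbf{R}^{(m)}$ be the orbit of those $(x,y)$ for which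 there are reals $w_1<\dots<w_{\ell(p)}$ such that $\{x_i\}$ (resp. $\{y_j\}$) is the set of the $w_r$ for which the first (resp. second) coordinate of $p_r$ is $1$, and let $A_p\colon\mathcal{C}(\mathbf{R}^{(m)})\to\mathcal{C}(\mathbf{R}^{(n)})$ be the operator whose matrix is the characteristic function of $O_p$. *Claim.* (a) The composition law of $\mathcal{D}$ is associative and has identity elements, so $\mathcal{D}$ is a $k$-linear category. (b) There is a fully faithful $k$-linear functor $\Phi\colon\mathcal{D}\to\underline{\mathrm{Rep}}(G)$ with $\Phi(X_n)=\mathcal{C}(\mathbf{R}^{(n)})$ and $\Phi([p])=A_p$. (c) $\Phi$ is an equivalence from $\mathcal{D}$ to the full subcategory of $\underline{\mathrm{Rep}}(G)$ spanned by the objects $\mathcal{C}(\mathbf{R}^{(n)})$. (d) $\Phi$ identifies the additive envelope of $\mathcal{D}$ with $\underline{\mathrm{Perm}}(G)$: there is an additive equivalence from the additive envelope of $\mathcal{D}$ to $\underline{\mathrm{Perm}}(G)$ whose composite with $\underline{\mathrm{Perm}}(G)\to\underline{\mathrm{Rep}}(G)$ restricts on $\mathcal{D}$ to a functor isomorphic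 to $\Phi$. (e) $\Phi$ identifies the additive–Karoubian envelope of $\mathcal{D}$ with $\underline{\mathrm{Rep}}^{\mathrm f}(G)$: there is an additive equivalence from the additive–Karoubian envelope of $\mathcal{D}$ to $\underline{\mathrm{Rep}}^{\mathrm f}(G)$ whose composite with the inclusion into $\underline{\mathrm{Rep}}(G)$ restricts on $\mathcal{D}$ to a functor isomorphic to $\Phi$. -/

import Mathlib

/-!
# The Delannoy path category and representations of `Aut(ℝ, <)`

Main definitions, in order:
* `G`, `fix`, `IsOpenSubgroup`: the group `Aut(ℝ, <)` and its open subgroups;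
* `FinitaryGSet`, `IsSchwartz`, `orbitVol`, `integral`: finitary `G`-sets, Schwartz functions, and
  integration with respect to the principal measure (that is, the Euler characteristic measure);
* `Schwartz`: the Schwartz space `𝒞(X)`;
* `Perm`: the category of permutation modules, with composition the product of matrices;
* `CompletedGroupAlgebra`: the ring `A(G)`, the inverse limit of the `𝒞(G/U)` with convolution, and
  its action on `𝒞(X)`;
* `SmoothRep`, `RepFin`, `permToRep`: smooth `A(G)`-modules, those of finite length, and the functor
  from permutation modules to smooth modules;
* `DPath`, `IsLift`, `eps`, `pathComp`, `PathCat`: Delannoy paths and the path category;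
* `orbitOf`, `pathMat`, `pathOp`: the orbit of a path and the associated operator.

The lemmas are those needed for the ring, module and category structures.
-/

open CategoryTheory

set_option linter.unusedSectionVars false

universe u

namespace Delannoy

/-! ### The group of order automorphisms of the real line -/

/-- The group `G = Aut(ℝ, <)`. -/
abbrev G : Type := ℝ ≃o ℝ

/-- The subgroup `G(A)` of all `g ∈ G` fixing each element of the finite set `A`. -/
def fix (A : Finset ℝ) : Subgroup G where
  carrier := {g | ∀ a ∈ A, g a = a}
  one_mem' := fun _ _ => rfl
  mul_mem' := fun {g h} hg hh a ha => by
    change g (h a) = a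
    rw [hh a ha, hg a ha]
  inv_mem' := fun {g} hg a ha => by
    change g.symm a = a
    rw [OrderIso.symm_apply_eq, hg a ha]

/-- Open subgroups for the topology on `G` in which the `G(A)` form a neighbourhood basis
of the identity. -/
def IsOpenSubgroup (U : Subgroup G) : Prop := ∃ A : Finset ℝ, fix A ≤ U

theorem mem_fix {A : Finset ℝ} {g : G} : g ∈ fix A ↔ ∀ a ∈ A, g a = a := Iff.rfl

theorem fix_anti {A B : Finset ℝ} (h : A ⊆ B) : fix B ≤ fix A := fun _ hg a ha => hg a (h ha)

theorem fix_union (A B : Finset ℝ) : fix (A ∪ B) = fix A ⊓ fix B := by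
  ext g
  simp only [Subgroup.mem_inf, mem_fix, Finset.mem_union]
  exact ⟨fun h => ⟨fun a ha => h a (Or.inl ha), fun a ha => h a (Or.inr ha)⟩,
    fun h a ha => ha.elim (h.1 a) (h.2 a)⟩

theorem exists_scale (c s : ℝ) (hs : 0 < s) :
    ∃ h : G, (∀ t ≤ c, h t = t) ∧ ∀ t, c ≤ t → h t = c + s * (t - c) := by
  have mono : StrictMono (fun t : ℝ => if t ≤ c then t else c + s * (t - c)) := by
    intro a b hab
    dsimp only
    split_ifs with h1 h2 h2
    · exact hab
    · have : 0 < s * (b - c) := mul_pos hs (by linarith)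
      linarith
    · linarith
    · have : s * (a - c) < s * (b - c) := mul_lt_mul_of_pos_left (by linarith) hs
      linarith
  have inv : Function.RightInverse (fun t : ℝ => if t ≤ c then t else c + s⁻¹ * (t - c))
      (fun t : ℝ => if t ≤ c then t else c + s * (t - c)) := by
    intro t
    dsimp only
    by_cases h : t ≤ c
    · simp [h]
    · have : 0 < s⁻¹ * (t - c) := mul_pos (inv_pos.2 hs) (by linarith)
      rw [if_neg h, if_neg (by linarith)]
      field_simp
      ring
  refine ⟨StrictMono.orderIsoOfRightInverse _ mono _ inv, fun t ht => if_pos ht, fun t ht => ?_⟩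
  change (if t ≤ c then t else c + s * (t - c)) = _
  split_ifs with h
  · rw [le_antisymm h ht]; ring
  · rfl

/-- Every finite partial order isomorphism of the line extends to an element of `G`. -/
theorem exists_ext (F : Finset ℝ) (f : ℝ → ℝ) (hf : StrictMonoOn f F) :
    ∃ g : G, ∀ t ∈ F, g t = f t := by
  induction F using Finset.induction_on_max with
  | empty => exact ⟨1, by simp⟩
  | insert a s has ih =>
    obtain ⟨g, hg⟩ := ih (hf.mono (by simp))
    rcases s.eq_empty_or_nonempty with rfl | hs
    · refine ⟨OrderIso.addRight (f a - a), fun t ht => ?_⟩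
      have : t = a := by simpa using ht
      subst this
      simp
    · set m := s.max' hs
      have hm : m ∈ s := s.max'_mem hs
      have h1 : f m < f a := hf (by simp [hm]) (by simp) (has m hm)
      have h2 : f m < g a := by
        rw [← hg m hm]; exact g.strictMono (has m hm)
      obtain ⟨h, hh1, hh2⟩ := exists_scale (f m) ((f a - f m) / (g a - f m))
        (div_pos (by linarith) (by linarith))
      refine ⟨h * g, fun t ht => ?_⟩
      change h (g t) = f t
      rcases Finset.mem_insert.1 ht with rfl | ht
      · rw [hh2 _ h2.le, div_mul_cancel₀ _ (by linarith)]; ring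
      · rw [hg t ht]
        apply hh1
        rcases (s.le_max' t ht).eq_or_lt with h | h
        · rw [h]
        · exact (hf (Finset.mem_coe.2 (Finset.mem_insert_of_mem ht))
            (Finset.mem_coe.2 (Finset.mem_insert_of_mem hm)) h).le

/-- The orbits of `G(S)` on the line are the points of `S` and the components of its
complement. -/
theorem exists_move (S : Finset ℝ) (t t' : ℝ) (h : ∀ s ∈ S, (s < t ↔ s < t') ∧ (t < s ↔ t' < s)) :
    ∃ g ∈ fix S, g t = t' := by
  classical
  by_cases ht : t ∈ S
  · have h1 := h t ht
    have : t = t' := by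
      rcases lt_trichotomy t t' with h2 | h2 | h2
      · exact absurd (h1.1.2 h2) (lt_irrefl _)
      · exact h2
      · exact absurd (h1.2.2 h2) (lt_irrefl _)
    exact ⟨1, one_mem _, this⟩
  · obtain ⟨g, hg⟩ := exists_ext (insert t S) (fun x => if x = t then t' else x) (by
      intro x hx y hy hxy
      simp only [Finset.coe_insert, Set.mem_insert_iff, Finset.mem_coe] at hx hy
      dsimp only
      rcases hx with rfl | hx <;> rcases hy with rfl | hy
      · exact absurd hxy (lt_irrefl _)
      · rw [if_pos rfl, if_neg (ne_of_gt hxy)]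
        exact (h y hy).2.1 hxy
      · rw [if_pos rfl, if_neg (ne_of_lt hxy)]
        exact (h x hx).1.1 hxy
      · rw [if_neg (fun e : x = t => ht (e ▸ hx)), if_neg (fun e : y = t => ht (e ▸ hy))]
        exact hxy)
    refine ⟨g, fun s hs => ?_, ?_⟩
    · rw [hg s (by simp [hs]), if_neg (fun e : s = t => ht (e ▸ hs))]
    · rw [hg t (by simp), if_pos rfl]

theorem lt_iff_of_mem_fix {S : Finset ℝ} {g : G} (hg : g ∈ fix S) {s : ℝ} (hs : s ∈ S) (t : ℝ) :
    (s < g t ↔ s < t) ∧ (g t < s ↔ t < s) := by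
  have := hg s hs
  constructor
  · conv_lhs => rw [← this]
    exact g.lt_iff_lt
  · conv_lhs => rw [← this]
    exact g.lt_iff_lt

/-- A point which is fixed by all of `G(B)` lies in `B`. -/
theorem mem_of_fix {B : Finset ℝ} {t : ℝ} (h : ∀ g ∈ fix B, g t = t) : t ∈ B := by
  classical
  by_contra ht
  obtain ⟨t', h1, h2⟩ : ∃ t', t < t' ∧ ∀ s ∈ B, t < s → t' < s := by
    rcases (B.filter (t < ·)).eq_empty_or_nonempty with he | hne
    · refine ⟨t + 1, by linarith, fun s hs hts => ?_⟩
      have : s ∈ B.filter (t < ·) := by simp [hs, hts]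
      simp [he] at this
    · have hm := Finset.min'_mem _ hne
      rw [Finset.mem_filter] at hm
      obtain ⟨r, hr1, hr2⟩ := exists_between hm.2
      exact ⟨r, hr1, fun s hs hts => hr2.trans_le (Finset.min'_le _ _ (by simp [hs, hts]))⟩
  obtain ⟨g, hg, hgt⟩ := exists_move B t t' (fun s hs => by
    have hne : s ≠ t := fun e => ht (e ▸ hs)
    refine ⟨⟨fun h => h.trans h1, fun h => ?_⟩, ⟨h2 s hs, fun h => h1.trans h⟩⟩
    by_contra hc
    exact absurd (h2 s hs (lt_of_le_of_ne (not_lt.1 hc) hne.symm)) (not_lt.2 h.le))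
  have := h g hg
  linarith

theorem fix_le_fix {A B : Finset ℝ} : fix A ≤ fix B ↔ B ⊆ A :=
  ⟨fun h _ hb => mem_of_fix fun _ hg => h hg _ hb, fix_anti⟩

theorem fix_injective : Function.Injective fix := fun _ _ h =>
  Finset.Subset.antisymm (fix_le_fix.1 h.ge) (fix_le_fix.1 h.le)

/-- Every open subgroup of `G` is of the form `G(B)`. -/
theorem exists_eq_fix {U : Subgroup G} (hU : IsOpenSubgroup U) : ∃ B : Finset ℝ, U = fix B := by
  classical
  obtain ⟨A, hA⟩ := hU
  obtain ⟨B, hB, hmin⟩ : ∃ B : Finset ℝ, fix B ≤ U ∧ ∀ C : Finset ℝ, fix C ≤ U → B.card ≤ C.card := by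
    have hex : ∃ n, ∃ B : Finset ℝ, fix B ≤ U ∧ B.card = n := ⟨_, A, hA, rfl⟩
    obtain ⟨B, h1, h2⟩ := Nat.find_spec hex
    exact ⟨B, h1, fun C hC => h2 ▸ Nat.find_min' hex ⟨C, hC, rfl⟩⟩
  refine ⟨B, le_antisymm (fun g hg => ?_) hB⟩
  -- the translate of `B` by `g`
  set C := B.image g with hC
  have hCU : fix C ≤ U := by
    intro h hh
    have : g⁻¹ * h * g ∈ fix B := by
      intro b hb
      change g.symm (h (g b)) = b
      rw [OrderIso.symm_apply_eq]
      exact hh (g b) (Finset.mem_image_of_mem _ hb)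
    have h2 := U.mul_mem (U.mul_mem hg (hB this)) (U.inv_mem hg)
    simpa [mul_assoc] using h2
  by_cases hBC : B ⊆ C
  · -- then `g` permutes `B`, hence fixes it
    have hEq : B = C := Finset.eq_of_subset_of_card_le hBC Finset.card_image_le
    have hperm : ∀ b ∈ B, g b ∈ B := fun b hb => by
      rw [hEq]; exact Finset.mem_image_of_mem _ hb
    intro b hb
    by_contra hne
    have iter : ∀ n : ℕ, (g : ℝ → ℝ)^[n] b ∈ B := by
      intro n
      induction n with
      | zero => exact hb
      | succ n ih => rw [Function.iterate_succ_apply']; exact hperm _ ih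
    have inj : Function.Injective (fun n : ℕ => (g : ℝ → ℝ)^[n] b) := by
      rcases lt_or_gt_of_ne hne with h | h
      · exact (g.strictMono.strictAnti_iterate_of_map_lt h).injective
      · exact (g.strictMono.strictMono_iterate_of_lt_map h).injective
    exact Set.infinite_range_of_injective inj
      (B.finite_toSet.subset (by rintro _ ⟨n, rfl⟩; exact iter n))
  · exfalso
    obtain ⟨b, hb, hbC⟩ := Finset.not_subset.1 hBC
    set B' := B.erase b with hB'
    have hbB' : b ∉ B' := Finset.notMem_erase b B
    have hcard : B'.card < B.card := Finset.card_erase_lt_of_mem hb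
    refine absurd (hmin B' ?_) (not_le.2 hcard)
    -- elements of `U ∩ G(B')` moving `b` a little
    have small : ∀ t, (∀ s ∈ B' ∪ C, (s < b ↔ s < t) ∧ (b < s ↔ t < s)) →
        ∃ u ∈ U, u ∈ fix B' ∧ u b = t := by
      intro t ht
      obtain ⟨u, hu, hut⟩ := exists_move _ _ _ ht
      exact ⟨u, hCU (fix_anti Finset.subset_union_right hu),
        fix_anti Finset.subset_union_left hu, hut⟩
    have trans : ∀ t, (∀ s ∈ B', (s < b ↔ s < t) ∧ (b < s ↔ t < s)) →
        ∃ u ∈ U, u ∈ fix B' ∧ u b = t := by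
      intro t ht
      -- a point `r` between `b` and `t`, close to `b`
      have key : t ≠ b → ∃ r, (∀ s ∈ B' ∪ C, (s < b ↔ s < r) ∧ (b < s ↔ r < s)) ∧
          (b < r ↔ b < t) ∧ (r < b ↔ t < b) := by
        intro htb
        have hb' : b ∉ B' ∪ C := by simp [hbB', hbC]
        have hopen : {r : ℝ | ∀ s ∈ B' ∪ C, (s < b ↔ s < r) ∧ (b < s ↔ r < s)} ∈ nhds b := by
          have : ∀ s ∈ B' ∪ C, {r : ℝ | (s < b ↔ s < r) ∧ (b < s ↔ r < s)} ∈ nhds b := by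
            intro s hs
            have hsb : s ≠ b := fun e => hb' (e ▸ hs)
            rcases lt_or_gt_of_ne hsb with h | h
            · filter_upwards [Ioi_mem_nhds h] with r (hr : s < r)
              exact ⟨iff_of_true h hr, iff_of_false (not_lt.2 h.le) (not_lt.2 hr.le)⟩
            · filter_upwards [Iio_mem_nhds h] with r (hr : r < s)
              exact ⟨iff_of_false (not_lt.2 h.le) (not_lt.2 hr.le), iff_of_true h hr⟩
          have h3 := (Filter.biInter_finset_mem (B' ∪ C)).2 this
          filter_upwards [h3] with r hr s hs
          exact (Set.mem_iInter₂.1 hr) s hs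
        obtain ⟨ε, hε, hball⟩ := Metric.mem_nhds_iff.1 hopen
        rcases lt_or_gt_of_ne htb with h | h
        · refine ⟨b - ε / 2, hball ?_, ?_, ?_⟩
          · rw [Metric.mem_ball, Real.dist_eq, abs_lt]; constructor <;> linarith
          · constructor <;> intro <;> linarith
          · constructor <;> intro <;> linarith
        · refine ⟨b + ε / 2, hball ?_, ?_, ?_⟩
          · rw [Metric.mem_ball, Real.dist_eq, abs_lt]; constructor <;> linarith
          · constructor <;> intro <;> linarith
          · constructor <;> intro <;> linarith
      by_cases htb : t = b
      · exact ⟨1, one_mem _, one_mem _, htb.symm⟩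
      obtain ⟨r, hr1, hr2, hr3⟩ := key htb
      obtain ⟨u, huU, huB, hub⟩ := small r hr1
      obtain ⟨v, hv, hvr⟩ := exists_move B r t (fun s hs => by
        by_cases hsb : s = b
        · subst hsb; exact ⟨hr2, hr3⟩
        · have hs' : s ∈ B' := Finset.mem_erase.2 ⟨hsb, hs⟩
          have h1 := hr1 s (Finset.mem_union_left _ hs')
          have h2 := ht s hs'
          exact ⟨h1.1.symm.trans h2.1, h1.2.symm.trans h2.2⟩)
      refine ⟨v * u, U.mul_mem (hB hv) huU,
        (fix B').mul_mem (fix_anti (Finset.erase_subset _ _) hv) huB, ?_⟩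
      change v (u b) = t
      rw [hub, hvr]
    intro h hh
    obtain ⟨u, huU, huB, hub⟩ := trans (h b) (fun s hs => by
      have := lt_iff_of_mem_fix hh hs b
      exact ⟨this.1.symm, this.2.symm⟩)
    have : u⁻¹ * h ∈ fix B := by
      intro s hs
      change u.symm (h s) = s
      rw [OrderIso.symm_apply_eq]
      by_cases hsb : s = b
      · rw [hsb, hub]
      · have hs' : s ∈ B' := Finset.mem_erase.2 ⟨hsb, hs⟩
        rw [hh s hs', huB s hs']
    simpa using U.mul_mem huU (hB this)

/-! ### Finitary smooth `G`-sets and Schwartz functions -/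

/-- A finitary `G`-set: the action is smooth (all stabilizers are open) and there are finitely
many orbits. -/
class FinitaryGSet (X : Type) [MulAction G X] : Prop where
  smooth : ∀ x : X, IsOpenSubgroup (MulAction.stabilizer G x)
  finitary : Finite (MulAction.orbitRel.Quotient G X)

/-- The set of `G(A)`-orbits on `X`. -/
abbrev Orb (A : Finset ℝ) (X : Type) [MulAction G X] : Type :=
  MulAction.orbitRel.Quotient (fix A) X

/-- The `G(A)`-orbit of a point. -/
def orb (A : Finset ℝ) {X : Type} [MulAction G X] (x : X) : Orb A X := Quotient.mk _ x

open Classical in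
/-- The support of a point `x` of a smooth `G`-set: the unique finite set `B ⊂ ℝ` such that the
stabilizer of `x` is `G(B)`. -/
noncomputable def supp {X : Type} [MulAction G X] (x : X) : Finset ℝ :=
  if h : ∃ B : Finset ℝ, MulAction.stabilizer G x = fix B then h.choose else ∅

/-- The function `φ` is invariant under `G(A)`. -/
def FixInv (A : Finset ℝ) {X : Type} [MulAction G X] {k : Type u} (φ : X → k) : Prop :=
  ∀ g ∈ fix A, ∀ x, φ (g • x) = φ x

/-- A Schwartz function: it is invariant under some open subgroup `G(A)`, and its support consists
of finitely many orbits of that subgroup. -/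
def IsSchwartz {X : Type} [MulAction G X] {k : Type u} [Zero k] (φ : X → k) : Prop :=
  ∃ A : Finset ℝ, FixInv A φ ∧ {O : Orb A X | ∃ x, orb A x = O ∧ φ x ≠ 0}.Finite

/-- The volume, under the principal measure, of the `G(A)`-orbit of `x`. If `I_0, …, I_r` are the
components of the complement of `A` and `supp x` has `n_i` points in `I_i`, then this orbit is
isomorphic to the product of the `I_i^{(n_i)}`, and its volume is `(-1)^{n_0 + ⋯ + n_r}`. -/
noncomputable def orbitVol (A : Finset ℝ) {X : Type} [MulAction G X] (x : X) : ℤ :=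
  (-1) ^ (supp x \ A).card

/-- The integral of a function invariant under `G(A)`, as a sum over `G(A)`-orbits. -/
noncomputable def integralOver (A : Finset ℝ) {X : Type} [MulAction G X] {k : Type u} [CommRing k]
    (φ : X → k) : k :=
  ∑ᶠ O : Orb A X, (orbitVol A O.out : k) * φ O.out

open Classical in
/-- The integral of a Schwartz function with respect to the principal measure. It is the sum of
`φ(O) * vol(O)` over the orbits `O` of any open subgroup `G(A)` fixing `φ`; the result does not
depend on `A`, see `integral_eq`. -/
noncomputable def integral {X : Type} [MulAction G X] {k : Type u} [CommRing k] (φ : X → k) : k :=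
  if h : IsSchwartz φ then integralOver h.choose φ else 0

section Orbits

variable {X Y : Type} [MulAction G X] [MulAction G Y] {k : Type u}

theorem orb_eq_iff {A : Finset ℝ} {x y : X} : orb A x = orb A y ↔ ∃ g ∈ fix A, g • y = x := by
  unfold orb
  rw [Quotient.eq, MulAction.orbitRel_apply, MulAction.mem_orbit_iff]
  exact ⟨fun ⟨g, hg⟩ => ⟨g.1, g.2, hg⟩, fun ⟨g, hg, h⟩ => ⟨⟨g, hg⟩, h⟩⟩

theorem orb_smul {A : Finset ℝ} {g : G} (hg : g ∈ fix A) (x : X) : orb A (g • x) = orb A x :=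
  orb_eq_iff.2 ⟨g, hg, rfl⟩

theorem orb_out {A : Finset ℝ} (O : Orb A X) : orb A O.out = O := Quotient.out_eq O

theorem FixInv.eq_of_orb {A : Finset ℝ} {φ : X → k} (h : FixInv A φ) {x y : X} (hxy : orb A x = orb A y) :
    φ x = φ y := by
  obtain ⟨g, hg, rfl⟩ := orb_eq_iff.1 hxy
  exact h g hg y

theorem FixInv.mono {A B : Finset ℝ} {φ : X → k} (h : FixInv A φ) (hAB : A ⊆ B) : FixInv B φ :=
  fun g hg x => h g (fix_anti hAB hg) x

theorem stabilizer_eq [FinitaryGSet X] (x : X) : MulAction.stabilizer G x = fix (supp x) := by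
  have h := exists_eq_fix (FinitaryGSet.smooth x)
  unfold supp
  rw [dif_pos h]
  exact h.choose_spec

theorem mem_fix_supp [FinitaryGSet X] {x : X} {g : G} : g ∈ fix (supp x) ↔ g • x = x := by
  rw [← stabilizer_eq, MulAction.mem_stabilizer_iff]

theorem supp_eq_of [FinitaryGSet X] {x : X} {B : Finset ℝ}
    (h : ∀ g : G, g ∈ fix B ↔ g • x = x) : supp x = B := by
  apply fix_injective
  ext g
  rw [mem_fix_supp, h]

theorem mem_fix_image {B : Finset ℝ} {g h : G} : h ∈ fix (B.image g) ↔ g⁻¹ * h * g ∈ fix B := by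
  simp only [mem_fix, Finset.forall_mem_image]
  refine forall₂_congr fun b _ => ?_
  change _ ↔ g.symm (h (g b)) = b
  rw [OrderIso.symm_apply_eq]

theorem supp_smul [FinitaryGSet X] (g : G) (x : X) : supp (g • x) = (supp x).image g := by
  apply supp_eq_of
  intro h
  rw [mem_fix_image, mem_fix_supp, mul_smul, mul_smul, inv_smul_eq_iff]

theorem image_eq_self {A : Finset ℝ} {g : G} (hg : g ∈ fix A) : A.image g = A := by
  ext t
  simp only [Finset.mem_image]
  exact ⟨fun ⟨a, ha, h⟩ => by rw [← h, hg a ha]; exact ha, fun h => ⟨t, h, hg t h⟩⟩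

theorem card_image_sdiff (B A : Finset ℝ) (g : G) :
    (B.image g \ A.image g).card = (B \ A).card := by
  rw [← Finset.image_sdiff _ _ g.injective, Finset.card_image_of_injective _ g.injective]

theorem orbitVol_smul [FinitaryGSet X] (A : Finset ℝ) (g : G) (x : X) :
    orbitVol (A.image g) (g • x) = orbitVol A x := by
  unfold orbitVol
  rw [supp_smul, card_image_sdiff]

theorem orbitVol_inv [FinitaryGSet X] (A : Finset ℝ) : FixInv A (orbitVol A : X → ℤ) := by
  intro g hg x
  conv_lhs => rw [← image_eq_self hg]
  exact orbitVol_smul A g x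

instance finite_orb [FinitaryGSet X] (A : Finset ℝ) : Finite (Orb A X) := by
  classical
  have : Finite (MulAction.orbitRel.Quotient G X) := FinitaryGSet.finitary
  let top : Orb A X → MulAction.orbitRel.Quotient G X := fun Q => Quotient.mk _ Q.out
  have htop : ∀ Q, ∃ g : G, g • (top Q).out = Q.out := by
    intro Q
    have : (Quotient.mk _ (top Q).out : MulAction.orbitRel.Quotient G X) = Quotient.mk _ Q.out :=
      Quotient.out_eq _
    rw [Quotient.eq, MulAction.orbitRel_apply] at this
    have := MulAction.mem_orbit_symm.1 this
    exact this
  choose γ hγ using htop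
  let f : Orb A X → Σ O : MulAction.orbitRel.Quotient G X, (supp O.out → A → Prop × Prop) :=
    fun Q => ⟨top Q, fun b a => (a.1 < γ Q b, γ Q b < a.1)⟩
  refine Finite.of_injective f fun Q Q' h => ?_
  have main : ∀ (O : MulAction.orbitRel.Quotient G X) (g g' : G),
      (∀ b ∈ supp O.out, ∀ a ∈ A, (a < g b ↔ a < g' b) ∧ (g b < a ↔ g' b < a)) →
      orb A (g • O.out) = orb A (g' • O.out) := by
    intro O g g' hgg
    obtain ⟨h, hh⟩ := exists_ext (A ∪ (supp O.out).image g)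
      (fun t => if t ∈ A then t else g' (g.symm t)) (by
        have key : ∀ b ∈ supp O.out,
            (fun t => if t ∈ A then t else g' (g.symm t)) (g b) = g' b := by
          intro b hb
          dsimp only
          split_ifs with hA
          · have := hgg b hb _ hA
            rcases lt_trichotomy (g b) (g' b) with h | h | h
            · exact absurd (this.1.2 h) (lt_irrefl _)
            · exact h
            · exact absurd (this.2.2 h) (lt_irrefl _)
          · rw [OrderIso.symm_apply_apply]
        have key' : ∀ a ∈ A, (fun t => if t ∈ A then t else g' (g.symm t)) a = a := by
          intro a ha
          exact if_pos ha
        intro x hx y hy hxy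
        simp only [Finset.coe_union, Finset.coe_image, Set.mem_union, Finset.mem_coe,
          Set.mem_image] at hx hy
        rcases hx with hx | ⟨b, hb, rfl⟩ <;> rcases hy with hy | ⟨c, hc, rfl⟩
        · rw [key' _ hx, key' _ hy]; exact hxy
        · rw [key' _ hx, key _ hc]; exact (hgg c hc x hx).1.1 hxy
        · rw [key _ hb, key' _ hy]; exact (hgg b hb y hy).2.1 hxy
        · rw [key _ hb, key _ hc]; exact g'.strictMono (g.lt_iff_lt.1 hxy))
    refine (orb_eq_iff.2 ⟨h, fun a ha => ?_, ?_⟩).symm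
    · rw [hh a (by simp [ha]), if_pos ha]
    · rw [← inv_smul_eq_iff, ← mul_smul, ← mul_smul, ← mem_fix_supp]
      intro b hb
      change g'.symm (h (g b)) = b
      rw [OrderIso.symm_apply_eq, hh (g b) (by simp [hb])]
      split_ifs with hA
      · have := hgg b hb _ hA
        rcases lt_trichotomy (g b) (g' b) with h | h | h
        · exact absurd (this.1.2 h) (lt_irrefl _)
        · exact h
        · exact absurd (this.2.2 h) (lt_irrefl _)
      · rw [OrderIso.symm_apply_apply]
  have main' : ∀ p p' : Σ O : MulAction.orbitRel.Quotient G X, (supp O.out → A → Prop × Prop),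
      p = p' → ∀ g g' : G, (∀ b a, p.2 b a = (a.1 < g b, g b < a.1)) →
      (∀ b a, p'.2 b a = (a.1 < g' b, g' b < a.1)) →
      orb A (g • p.1.out) = orb A (g' • p'.1.out) := by
    rintro p _ rfl g g' h1 h2
    refine main _ _ _ fun b hb a ha => ?_
    have := (h1 ⟨b, hb⟩ ⟨a, ha⟩).symm.trans (h2 ⟨b, hb⟩ ⟨a, ha⟩)
    rw [Prod.mk.injEq] at this
    exact ⟨iff_of_eq this.1, iff_of_eq this.2⟩
  have := main' (f Q) (f Q') h (γ Q) (γ Q') (fun _ _ => rfl) (fun _ _ => rfl)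
  change orb A (γ Q • (top Q).out) = orb A (γ Q' • (top Q').out) at this
  rwa [hγ, hγ, orb_out, orb_out] at this

theorem FixInv.isSchwartz [FinitaryGSet X] [Zero k] {A : Finset ℝ} {φ : X → k} (h : FixInv A φ) :
    IsSchwartz φ := ⟨A, h, Set.toFinite _⟩

theorem IsSchwartz.exists_inv [Zero k] {φ : X → k} (h : IsSchwartz φ) : ∃ A, FixInv A φ :=
  ⟨h.choose, h.choose_spec.1⟩

end Orbits

section Fibration

variable {X Y : Type} [MulAction G X] [MulAction G Y] {k : Type u} [CommRing k]

/-- Summing over the orbits of `G(A)` on a product, one factor at a time. -/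
theorem sum_orb_prod [FinitaryGSet X] [FinitaryGSet Y] (A : Finset ℝ) (F : X → Y → k)
    (hF : ∀ g ∈ fix A, ∀ x y, F (g • x) (g • y) = F x y)
    (σ : Orb A X → X) (hσ : ∀ P, orb A (σ P) = P) :
    ∑ᶠ P : Orb A X, ∑ᶠ Q : Orb (A ∪ supp (σ P)) Y, F (σ P) Q.out =
      ∑ᶠ R : Orb A (X × Y), F R.out.1 R.out.2 := by
  classical
  have : Fintype (Orb A X) := Fintype.ofFinite _
  have : ∀ P : Orb A X, Fintype (Orb (A ∪ supp (σ P)) Y) := fun P => Fintype.ofFinite _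
  let e : (Σ P : Orb A X, Orb (A ∪ supp (σ P)) Y) → Orb A (X × Y) :=
    fun p => orb A (σ p.1, p.2.out)
  have he : Function.Bijective e := by
    constructor
    · rintro ⟨P, Q⟩ ⟨P', Q'⟩ h
      obtain ⟨g, hg, hgg⟩ := orb_eq_iff.1 h
      simp only [Prod.smul_mk, Prod.mk.injEq] at hgg
      have hP : P = P' := by
        rw [← hσ P, ← hσ P', ← hgg.1, orb_smul hg]
      subst hP
      have hQ : Q = Q' := by
        rw [← orb_out Q, ← orb_out Q', ← hgg.2, orb_smul]
        rw [fix_union]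
        exact ⟨hg, mem_fix_supp.2 hgg.1⟩
      rw [hQ]
    · intro R
      obtain ⟨h, hh, hx⟩ := orb_eq_iff.1 ((hσ (orb A R.out.1)).symm)
      obtain ⟨l, hl, hy⟩ := orb_eq_iff.1
        ((orb_out (orb (A ∪ supp (σ (orb A R.out.1))) (h⁻¹ • R.out.2))).symm)
      rw [fix_union] at hl
      refine ⟨⟨orb A R.out.1, orb _ (h⁻¹ • R.out.2)⟩, ?_⟩
      conv_rhs => rw [← orb_out R]
      refine (orb_eq_iff.2 ⟨h * l, mul_mem hh hl.1, ?_⟩).symm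
      refine Prod.ext ?_ ?_
      · change (h * l) • σ (orb A R.out.1) = R.out.1
        rw [mul_smul, mem_fix_supp.1 hl.2, hx]
      · change (h * l) • (orb _ (h⁻¹ • R.out.2)).out = R.out.2
        rw [mul_smul, hy, smul_inv_smul]
  have : Fintype (Orb A (X × Y)) := Fintype.ofBijective e he
  simp only [finsum_eq_sum_of_fintype]
  rw [← Fintype.sum_sigma' (fun (P : Orb A X) (Q : Orb (A ∪ supp (σ P)) Y) => F (σ P) Q.out)]
  refine Fintype.sum_bijective e he _ _ fun p => ?_
  obtain ⟨g, hg, hgg⟩ := orb_eq_iff.1 (orb_out (e p))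
  rw [← hgg]
  exact (hF g hg _ _).symm

theorem sum_orb_swap (A : Finset ℝ) (F : X → Y → k)
    (hF : ∀ g ∈ fix A, ∀ x y, F (g • x) (g • y) = F x y) :
    ∑ᶠ R : Orb A (X × Y), F R.out.1 R.out.2 = ∑ᶠ R : Orb A (Y × X), F R.out.2 R.out.1 := by
  have hs : ∀ R : Orb A (X × Y), ∀ R' : Orb A (Y × X),
      orb A (R.out.2, R.out.1) = R' → orb A (R'.out.2, R'.out.1) = R := by
    rintro R _ rfl
    obtain ⟨g, hg, hgg⟩ := orb_eq_iff.1 (orb_out (orb A (R.out.2, R.out.1)))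
    rw [← hgg]
    change orb A (g • R.out) = R
    rw [orb_smul hg, orb_out]
  have hs' : ∀ R : Orb A (Y × X), ∀ R' : Orb A (X × Y),
      orb A (R.out.2, R.out.1) = R' → orb A (R'.out.2, R'.out.1) = R := by
    rintro R _ rfl
    obtain ⟨g, hg, hgg⟩ := orb_eq_iff.1 (orb_out (orb A (R.out.2, R.out.1)))
    rw [← hgg]
    change orb A (g • R.out) = R
    rw [orb_smul hg, orb_out]
  refine finsum_eq_of_bijective (fun R => orb A (R.out.2, R.out.1)) ?_ fun R => ?_
  · refine Function.bijective_iff_has_inverse.2 ⟨fun R => orb A (R.out.2, R.out.1),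
      fun R => hs R _ rfl, fun R => hs' R _ rfl⟩
  · obtain ⟨g, hg, hgg⟩ := orb_eq_iff.1 (orb_out (orb A (R.out.2, R.out.1)))
    rw [← hgg]
    exact (hF g hg _ _).symm

theorem sign_union (A B C : Finset ℝ) :
    ((-1) ^ ((B ∪ C) \ A).card : ℤ) = (-1) ^ (B \ A).card * (-1) ^ (C \ (A ∪ B)).card := by
  rw [← pow_add]
  congr 1
  rw [← Finset.card_union_of_disjoint]
  · congr 1
    ext t
    simp only [Finset.mem_sdiff, Finset.mem_union]
    tauto
  · rw [Finset.disjoint_left]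
    intro t h1 h2
    simp only [Finset.mem_sdiff, Finset.mem_union] at h1 h2
    tauto

end Fibration

theorem card_image_sdiff_of_mem (B : Finset ℝ) {A : Finset ℝ} {g : G} (hg : g ∈ fix A) :
    (B.image g \ A).card = (B \ A).card := by
  conv_lhs => rw [← image_eq_self hg]
  exact card_image_sdiff B A g

theorem mul_finsum_finite {ι : Type*} [Finite ι] {k : Type u} [CommRing k] (c : k) (f : ι → k) :
    c * ∑ᶠ i, f i = ∑ᶠ i, c * f i := by
  have := Fintype.ofFinite ι
  rw [finsum_eq_sum_of_fintype, finsum_eq_sum_of_fintype, Finset.mul_sum]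

section Line

variable {k : Type u} [CommRing k]

instance finitaryGSet_line : FinitaryGSet ℝ where
  smooth t := ⟨{t}, fun _ hg => hg t (by simp)⟩
  finitary := by
    have : Subsingleton (MulAction.orbitRel.Quotient G ℝ) := by
      refine ⟨fun a b => ?_⟩
      induction a using Quotient.inductionOn with | _ x => ?_
      induction b using Quotient.inductionOn with | _ y => ?_
      rw [Quotient.eq, MulAction.orbitRel_apply]
      obtain ⟨g, -, hg⟩ := exists_move ∅ y x (by simp)
      exact ⟨g, hg⟩
    infer_instance

theorem supp_line (t : ℝ) : supp t = {t} :=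
  supp_eq_of fun g => by simp [mem_fix]

theorem orb_line_iff {S : Finset ℝ} {t t' : ℝ} :
    orb S t = orb S t' ↔ ∀ s ∈ S, (s < t ↔ s < t') ∧ (t < s ↔ t' < s) := by
  rw [orb_eq_iff]
  constructor
  · rintro ⟨g, hg, rfl⟩ s hs
    exact lt_iff_of_mem_fix hg hs t'
  · intro h
    exact exists_move S t' t fun s hs => ⟨(h s hs).1.symm, (h s hs).2.symm⟩

theorem orbitVol_line (S : Finset ℝ) (t : ℝ) : orbitVol S t = if t ∈ S then 1 else -1 := by
  unfold orbitVol
  rw [supp_line]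
  split_ifs with h
  · rw [Finset.sdiff_eq_empty_iff_subset.2 (by simpa using h)]; simp
  · rw [Finset.sdiff_eq_self_of_disjoint (by simpa using h)]; simp

/-- An orbit that contains a point `s` off `S` contains points on both sides of `s`. -/
theorem exists_both_sides {S : Finset ℝ} {s : ℝ} (hs : s ∉ S) :
    ∃ p q : ℝ, p < s ∧ s < q ∧ orb S p = orb S s ∧ orb S q = orb S s := by
  have hopen : {r : ℝ | ∀ a ∈ S, (a < r ↔ a < s) ∧ (r < a ↔ s < a)} ∈ nhds s := by
    have : ∀ a ∈ S, {r : ℝ | (a < r ↔ a < s) ∧ (r < a ↔ s < a)} ∈ nhds s := by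
      intro a ha
      have has : a ≠ s := fun e => hs (e ▸ ha)
      rcases lt_or_gt_of_ne has with h | h
      · filter_upwards [Ioi_mem_nhds h] with r (hr : a < r)
        exact ⟨iff_of_true hr h, iff_of_false (not_lt.2 hr.le) (not_lt.2 h.le)⟩
      · filter_upwards [Iio_mem_nhds h] with r (hr : r < a)
        exact ⟨iff_of_false (not_lt.2 hr.le) (not_lt.2 h.le), iff_of_true hr h⟩
    have h3 := (Filter.biInter_finset_mem S).2 this
    filter_upwards [h3] with r hr a ha
    exact (Set.mem_iInter₂.1 hr) a ha
  obtain ⟨ε, hε, hball⟩ := Metric.mem_nhds_iff.1 hopen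
  refine ⟨s - ε / 2, s + ε / 2, by linarith, by linarith, orb_line_iff.2 (hball ?_),
    orb_line_iff.2 (hball ?_)⟩ <;>
  · rw [Metric.mem_ball, Real.dist_eq, abs_lt]; constructor <;> linarith

theorem exists_section {X : Type} [MulAction G X] (A : Finset ℝ) (x : X) :
    ∃ σ : Orb A X → X, (∀ P, orb A (σ P) = P) ∧ σ (orb A x) = x := by
  classical
  refine ⟨fun P => if P = orb A x then x else P.out, fun P => ?_, if_pos rfl⟩
  dsimp only
  split_ifs with h
  · exact h.symm
  · exact orb_out P

theorem integralOver_eq_section {X : Type} [MulAction G X] [FinitaryGSet X] {A : Finset ℝ}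
    {φ : X → k} (h : FixInv A φ) (σ : Orb A X → X) (hσ : ∀ P, orb A (σ P) = P) :
    integralOver A φ = ∑ᶠ P : Orb A X, (orbitVol A (σ P) : k) * φ (σ P) := by
  refine finsum_congr fun P => ?_
  have : orb A P.out = orb A (σ P) := by rw [hσ, orb_out]
  rw [h.eq_of_orb this, (orbitVol_inv A).eq_of_orb this]

theorem integralOver_line_insert {S : Finset ℝ} {s : ℝ} (hs : s ∉ S) {f : ℝ → k} (hf : FixInv S f) :
    integralOver (insert s S) f = integralOver S f := by
  classical
  obtain ⟨p, q, hps, hsq, hp, hq⟩ := exists_both_sides hs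
  obtain ⟨σ, hσ, hσs⟩ := exists_section S s
  have hf' : FixInv (insert s S) f := hf.mono (Finset.subset_insert _ _)
  have : Fintype (Orb S ℝ) := Fintype.ofFinite _
  let e : Option (Option (Orb S ℝ)) → Orb (insert s S) ℝ := fun
    | none => orb _ p
    | some none => orb _ q
    | some (some P) => orb _ (σ P)
  have coarsen : ∀ {t t' : ℝ}, orb (insert s S) t = orb (insert s S) t' → orb S t = orb S t' := by
    intro t t' h
    rw [orb_line_iff] at h ⊢
    exact fun a ha => h a (Finset.mem_insert_of_mem ha)
  have atS : ∀ {t t' : ℝ}, orb (insert s S) t = orb (insert s S) t' →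
      (s < t ↔ s < t') ∧ (t < s ↔ t' < s) := by
    intro t t' h
    rw [orb_line_iff] at h
    exact h s (Finset.mem_insert_self _ _)
  have build : ∀ {t t' : ℝ}, orb S t = orb S t' → (s < t ↔ s < t') ∧ (t < s ↔ t' < s) →
      orb (insert s S) t = orb (insert s S) t' := by
    intro t t' h h'
    rw [orb_line_iff] at h ⊢
    intro a ha
    rcases Finset.mem_insert.1 ha with rfl | ha
    · exact h'
    · exact h a ha
  have hσ' : ∀ {t : ℝ} {P : Orb S ℝ}, orb S t = orb S s → orb S t = orb S (σ P) → σ P = s := by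
    intro t P h1 h2
    have : P = orb S s := by rw [← hσ P, ← h2, h1]
    rw [this, hσs]
  have he : Function.Bijective e := by
    constructor
    · rintro (_ | _ | P) (_ | _ | P') h
      · rfl
      · exact absurd ((atS h).2.1 hps) (not_lt.2 hsq.le)
      · have h1 := hσ' hp (coarsen h)
        have h2 := (atS h).2.1 hps
        rw [h1] at h2
        exact absurd h2 (lt_irrefl _)
      · exact absurd ((atS h).2.2 hps) (not_lt.2 hsq.le)
      · rfl
      · have h1 := hσ' hq (coarsen h)
        have h2 := (atS h).1.1 hsq
        rw [h1] at h2
        exact absurd h2 (lt_irrefl _)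
      · have h1 := hσ' hp (coarsen h.symm)
        have h2 := (atS h).2.2 hps
        rw [h1] at h2
        exact absurd h2 (lt_irrefl _)
      · have h1 := hσ' hq (coarsen h.symm)
        have h2 := (atS h).1.2 hsq
        rw [h1] at h2
        exact absurd h2 (lt_irrefl _)
      · have := coarsen h
        rw [hσ, hσ] at this
        rw [this]
    · intro R
      obtain ⟨t, rfl⟩ : ∃ t, orb _ t = R := ⟨R.out, orb_out R⟩
      by_cases hts : orb S t = orb S s
      · rcases lt_trichotomy t s with h | rfl | h
        · exact ⟨none, build (hp.trans hts.symm)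
            ⟨iff_of_false (not_lt.2 hps.le) (not_lt.2 h.le), iff_of_true hps h⟩⟩
        · exact ⟨some (some (orb S t)), by change orb _ (σ (orb S t)) = _; rw [hσs]⟩
        · exact ⟨some none, build (hq.trans hts.symm)
            ⟨iff_of_true hsq h, iff_of_false (not_lt.2 hsq.le) (not_lt.2 h.le)⟩⟩
      · refine ⟨some (some (orb S t)), build (hσ _) ?_⟩
        have h1 := orb_line_iff.1 (hσ (orb S t))
        have h2 : ∃ a ∈ S, ¬((a < t ↔ a < s) ∧ (t < a ↔ s < a)) := by
          by_contra hc
          push Not at hc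
          exact hts (orb_line_iff.2 hc)
        obtain ⟨a, ha, h2⟩ := h2
        have h3 := h1 a ha
        have has : a ≠ s := fun e => hs (e ▸ ha)
        set w := σ (orb S t)
        clear_value w
        rcases lt_or_gt_of_ne has with has | has
        · have hta : t ≤ a := by
            by_contra hc
            push Not at hc
            exact h2 ⟨iff_of_true hc has, iff_of_false (not_lt.2 hc.le) (not_lt.2 has.le)⟩
          have hwa : w ≤ a := not_lt.1 fun hc => absurd (h3.1.1 hc) (not_lt.2 hta)
          exact ⟨iff_of_false (by linarith) (by linarith), iff_of_true (by linarith) (by linarith)⟩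
        · have hta : a ≤ t := by
            by_contra hc
            push Not at hc
            exact h2 ⟨iff_of_false (not_lt.2 hc.le) (not_lt.2 has.le), iff_of_true hc has⟩
          have hwa : a ≤ w := not_lt.1 fun hc => absurd (h3.2.1 hc) (not_lt.2 hta)
          exact ⟨iff_of_true (by linarith) (by linarith), iff_of_false (by linarith) (by linarith)⟩
  have : Fintype (Orb (insert s S) ℝ) := Fintype.ofBijective e he
  let τ : Orb (insert s S) ℝ → ℝ := fun R => match (Equiv.ofBijective e he).symm R with
    | none => p
    | some none => q
    | some (some P) => σ P
  have hτe : ∀ x, τ (e x) = match x with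
    | none => p
    | some none => q
    | some (some P) => σ P := by
    intro x
    have : (Equiv.ofBijective e he).symm (e x) = x := (Equiv.ofBijective e he).symm_apply_apply x
    simp only [τ, this]
  have hτ : ∀ R, orb (insert s S) (τ R) = R := by
    intro R
    obtain ⟨x, rfl⟩ := he.2 R
    rw [hτe]
    rcases x with (_ | _ | P) <;> rfl
  rw [integralOver_eq_section hf' τ hτ, integralOver_eq_section hf σ hσ,
    finsum_eq_sum_of_fintype, finsum_eq_sum_of_fintype,
    ← Fintype.sum_bijective e he (fun x => (orbitVol (insert s S) (τ (e x)) : k) * f (τ (e x))) _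
      (fun _ => rfl), Fintype.sum_option, Fintype.sum_option]
  simp only [hτe]
  have hpS : p ∉ insert s S := by
    intro h
    rcases Finset.mem_insert.1 h with h | h
    · exact absurd h hps.ne
    · exact absurd ((orb_line_iff.1 hp p h).1.2 hps) (lt_irrefl _)
  have hqS : q ∉ insert s S := by
    intro h
    rcases Finset.mem_insert.1 h with h | h
    · exact absurd h hsq.ne'
    · exact absurd ((orb_line_iff.1 hq q h).2.2 hsq) (lt_irrefl _)
  have hterm : ∀ P : Orb S ℝ, (orbitVol (insert s S) (σ P) : k) * f (σ P) =
      (orbitVol S (σ P) : k) * f (σ P) + if P = orb S s then 2 * f s else 0 := by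
    intro P
    rw [orbitVol_line, orbitVol_line]
    by_cases hP : P = orb S s
    · subst hP
      rw [hσs, if_pos (Finset.mem_insert_self _ _), if_neg hs, if_pos rfl]
      push_cast
      ring
    · have hne : σ P ≠ s := fun h => hP (by rw [← hσ P, h])
      rw [if_neg hP, add_zero]
      simp only [Finset.mem_insert, hne, false_or]
  simp only [hterm]
  rw [Finset.sum_add_distrib, Finset.sum_ite_eq', if_pos (Finset.mem_univ _), orbitVol_line,
    orbitVol_line, if_neg hpS, if_neg hqS, hf.eq_of_orb hp, hf.eq_of_orb hq]
  push_cast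
  ring

theorem integralOver_line_mono {A S : Finset ℝ} (h : A ⊆ S) {f : ℝ → k} (hf : FixInv A f) :
    integralOver S f = integralOver A f := by
  classical
  obtain ⟨T, rfl⟩ : ∃ T, S = T ∪ A := ⟨S, (Finset.union_eq_left.2 h).symm⟩
  clear h
  induction T using Finset.induction_on with
  | empty => simp
  | insert a T ha ih =>
    rw [Finset.insert_union]
    by_cases haA : a ∈ T ∪ A
    · rw [Finset.insert_eq_of_mem haA, ih]
    · rw [integralOver_line_insert haA (hf.mono Finset.subset_union_right), ih]

end Line

section Independence

variable {X Y : Type} [MulAction G X] [MulAction G Y] {k : Type u} [CommRing k]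

theorem integralOver_insert [FinitaryGSet X] {A : Finset ℝ} {c : ℝ} (hc : c ∉ A) {φ : X → k}
    (hφ : FixInv A φ) : integralOver (insert c A) φ = integralOver A φ := by
  classical
  let ι : ℝ → k := fun t => if orb A t = orb A c then 1 else 0
  have hι : FixInv A ι := fun g hg t => by
    dsimp only [ι]
    rw [orb_smul hg]
  have hιint : ∀ S, A ⊆ S → integralOver S ι = -1 := by
    intro S hS
    rw [integralOver_line_mono hS hι]
    obtain ⟨σ, hσ, hσc⟩ := exists_section A c
    rw [integralOver_eq_section hι σ hσ, finsum_eq_single _ (orb A c)]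
    · simp [hσc, ι, orbitVol_line, hc]
    · intro P hP
      have : ι (σ P) = 0 := if_neg (by rwa [hσ])
      rw [this, mul_zero]
  let F : ℝ → X → k := fun t x =>
    ι t * ((((-1) ^ ((supp x ∪ supp t) \ A).card : ℤ) : k) * φ x)
  have hF : ∀ g ∈ fix A, ∀ t x, F (g • t) (g • x) = F t x := by
    intro g hg t x
    dsimp only [F]
    rw [hι g hg, hφ g hg, supp_smul, supp_smul, ← Finset.image_union]
    rw [card_image_sdiff_of_mem _ hg]
  have hcomm : ∑ᶠ R : Orb A (ℝ × X), F R.out.1 R.out.2 = ∑ᶠ R : Orb A (X × ℝ), F R.out.2 R.out.1 :=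
    sum_orb_swap A F hF
  obtain ⟨σ, hσ, hσc⟩ := exists_section A c
  rw [← sum_orb_prod A F hF σ hσ,
    ← sum_orb_prod A (fun x t => F t x) (fun g hg x t => hF g hg t x) Quotient.out orb_out,
    finsum_eq_single _ (orb A c)] at hcomm
  · have h1 : ∑ᶠ Q : Orb (A ∪ supp (σ (orb A c))) X, F (σ (orb A c)) Q.out =
        - integralOver (insert c A) φ := by
      have hA : A ∪ supp (σ (orb A c)) = insert c A := by
        rw [hσc, supp_line, Finset.union_comm]; rfl
      rw [hA, integralOver, ← finsum_neg_distrib]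
      refine finsum_congr fun Q => ?_
      dsimp only [F]
      rw [hσc, Finset.union_comm, sign_union, supp_line, orbitVol,
        show A ∪ {c} = insert c A by rw [Finset.union_comm]; rfl,
        Finset.sdiff_eq_self_of_disjoint (by simpa using hc)]
      simp [ι]
    have h2 : ∑ᶠ P : Orb A X, ∑ᶠ Q : Orb (A ∪ supp P.out) ℝ, F Q.out P.out =
        - integralOver A φ := by
      rw [integralOver, ← finsum_neg_distrib]
      refine finsum_congr fun P => ?_
      have h3 : ∀ Q : Orb (A ∪ supp P.out) ℝ, F Q.out P.out =
          ((orbitVol A P.out : k) * φ P.out) *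
            ((orbitVol (A ∪ supp P.out) Q.out : k) * ι Q.out) := by
        intro Q
        dsimp only [F]
        rw [sign_union]
        unfold orbitVol
        push_cast
        ring
      rw [finsum_congr h3, ← mul_finsum_finite]
      change _ * integralOver (A ∪ supp P.out) ι = _
      rw [hιint _ Finset.subset_union_left, mul_neg_one]
    rw [h1, h2] at hcomm
    exact neg_injective hcomm
  · intro P hP
    have : ι (σ P) = 0 := if_neg (by rwa [hσ])
    simp only [F, this, zero_mul, finsum_zero]

theorem integralOver_mono [FinitaryGSet X] {A S : Finset ℝ} (h : A ⊆ S) {φ : X → k}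
    (hφ : FixInv A φ) : integralOver S φ = integralOver A φ := by
  classical
  obtain ⟨T, rfl⟩ : ∃ T, S = T ∪ A := ⟨S, (Finset.union_eq_left.2 h).symm⟩
  clear h
  induction T using Finset.induction_on with
  | empty => simp
  | insert a T ha ih =>
    rw [Finset.insert_union]
    by_cases haA : a ∈ T ∪ A
    · rw [Finset.insert_eq_of_mem haA, ih]
    · rw [integralOver_insert haA (hφ.mono Finset.subset_union_right), ih]

/-- The integral can be computed with any open subgroup `G(A)` that fixes the function. -/
theorem integral_eq [FinitaryGSet X] {A : Finset ℝ} {φ : X → k} (hφ : FixInv A φ) :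
    integral φ = integralOver A φ := by
  have h : IsSchwartz φ := hφ.isSchwartz
  unfold integral
  rw [dif_pos h, ← integralOver_mono (Finset.subset_union_left (s₂ := A)) h.choose_spec.1,
    ← integralOver_mono (Finset.subset_union_right (s₁ := h.choose)) hφ]

theorem FixInv.add {A : Finset ℝ} {φ ψ : X → k} (h : FixInv A φ) (h' : FixInv A ψ) : FixInv A (φ + ψ) :=
  fun g hg x => by simp only [Pi.add_apply, h g hg, h' g hg]

theorem integral_add [FinitaryGSet X] {φ ψ : X → k} (hφ : IsSchwartz φ) (hψ : IsSchwartz ψ) :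
    integral (fun x => φ x + ψ x) = integral φ + integral ψ := by
  classical
  obtain ⟨A, hA⟩ := hφ.exists_inv
  obtain ⟨B, hB⟩ := hψ.exists_inv
  have hA' := hA.mono (Finset.subset_union_left (s₂ := B))
  have hB' := hB.mono (Finset.subset_union_right (s₁ := A))
  rw [integral_eq hA', integral_eq hB', integral_eq (φ := fun x => φ x + ψ x) (hA'.add hB'),
    integralOver, integralOver, integralOver,
    ← finsum_add_distrib (Set.toFinite _) (Set.toFinite _)]
  exact finsum_congr fun O => mul_add _ _ _

theorem integral_const_mul [FinitaryGSet X] (c : k) {φ : X → k} (hφ : IsSchwartz φ) :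
    integral (fun x => c * φ x) = c * integral φ := by
  obtain ⟨A, hA⟩ := hφ.exists_inv
  have hA' : FixInv A (fun x => c * φ x) := fun g hg x => by dsimp only; rw [hA g hg]
  rw [integral_eq hA, integral_eq hA', integralOver, integralOver, mul_finsum_finite]
  exact finsum_congr fun O => mul_left_comm _ _ _

theorem integral_mul_const [FinitaryGSet X] (c : k) {φ : X → k} (hφ : IsSchwartz φ) :
    integral (fun x => φ x * c) = integral φ * c := by
  rw [mul_comm, ← integral_const_mul c hφ]
  simp only [mul_comm]

theorem FixInv.translate {A : Finset ℝ} {φ : X → k} (h : FixInv A φ) (g : G) :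
    FixInv (A.image g) (fun x => φ (g⁻¹ • x)) := by
  intro l hl x
  rw [mem_fix_image] at hl
  dsimp only
  have := h _ hl (g⁻¹ • x)
  simpa [mul_smul] using this

theorem integral_translate [FinitaryGSet X] {φ : X → k} (hφ : IsSchwartz φ) (g : G) :
    integral (fun x => φ (g⁻¹ • x)) = integral φ := by
  obtain ⟨A, hA⟩ := hφ.exists_inv
  rw [integral_eq hA, integral_eq (hA.translate g), integralOver, integralOver]
  have key : ∀ x y : X, orb A x = orb A y → orb (A.image g) (g • x) = orb (A.image g) (g • y) := by
    intro x y h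
    obtain ⟨l, hl, rfl⟩ := orb_eq_iff.1 h
    refine orb_eq_iff.2 ⟨g * l * g⁻¹, ?_, ?_⟩
    · rw [mem_fix_image]; simpa [mul_assoc] using hl
    · simp [mul_smul]
  have key' : ∀ x y : X, orb (A.image g) x = orb (A.image g) y →
      orb A (g⁻¹ • x) = orb A (g⁻¹ • y) := by
    intro x y h
    obtain ⟨l, hl, rfl⟩ := orb_eq_iff.1 h
    refine orb_eq_iff.2 ⟨g⁻¹ * l * g, mem_fix_image.1 hl, ?_⟩
    simp [mul_smul]
  symm
  refine finsum_eq_of_bijective (fun O : Orb A X => orb (A.image g) (g • O.out)) ?_ fun O => ?_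
  · refine Function.bijective_iff_has_inverse.2
      ⟨fun O => orb A (g⁻¹ • O.out), fun O => ?_, fun O => ?_⟩
    · dsimp only
      rw [key' _ (g • O.out) (orb_out _), inv_smul_smul, orb_out]
    · dsimp only
      rw [key _ (g⁻¹ • O.out) (orb_out _), smul_inv_smul, orb_out]
  · have h1 := (hA.translate g).eq_of_orb (orb_out (orb (A.image g) (g • O.out)))
    have h2 := (orbitVol_inv (A.image g)).eq_of_orb (orb_out (orb (A.image g) (g • O.out)))
    rw [h1, h2, orbitVol_smul, inv_smul_smul]

theorem integral_delta [FinitaryGSet X] [DecidableEq X] (x₀ : X) (f : X → k) :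
    integral (fun x => if x = x₀ then f x else 0) = f x₀ := by
  have hinv : FixInv (supp x₀) (fun x => if x = x₀ then f x else 0) := by
    intro g hg x
    have h0 := mem_fix_supp.1 hg
    have : g • x = x₀ ↔ x = x₀ := by
      conv_lhs => rw [← h0]
      exact smul_left_cancel_iff g
    by_cases h : x = x₀
    · subst h; simp [h0]
    · simp [this, h]
  obtain ⟨σ, hσ, hσx⟩ := exists_section (supp x₀) x₀
  rw [integral_eq hinv, integralOver_eq_section hinv σ hσ, finsum_eq_single _ (orb _ x₀)]
  · simp [hσx, orbitVol]
  · intro P hP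
    have : σ P ≠ x₀ := fun h => hP (by rw [← hσ P, h])
    simp [this]

/-- The function `K` on a product is invariant under `G(A)`. -/
def Inv₂ (A : Finset ℝ) (K : X → Y → k) : Prop :=
  ∀ g ∈ fix A, ∀ x y, K (g • x) (g • y) = K x y

theorem Inv₂.right [FinitaryGSet X] {A : Finset ℝ} {K : X → Y → k} (h : Inv₂ A K) (x : X) :
    FixInv (A ∪ supp x) (K x) := by
  intro g hg y
  rw [fix_union] at hg
  have h1 := h g hg.1 x y
  rwa [mem_fix_supp.1 hg.2] at h1

theorem Inv₂.integral_right [FinitaryGSet X] [FinitaryGSet Y] {A : Finset ℝ} {K : X → Y → k}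
    (h : Inv₂ A K) : FixInv A (fun x => integral (K x)) := by
  intro g hg x
  dsimp only
  rw [← integral_translate (h.right x).isSchwartz g]
  congr 1
  funext y
  rw [← h g hg x, smul_inv_smul]

theorem integral_integral [FinitaryGSet X] [FinitaryGSet Y] {A : Finset ℝ} {K : X → Y → k}
    (h : Inv₂ A K) : integral (fun x => integral (K x)) =
      ∑ᶠ R : Orb A (X × Y),
        (((-1) ^ ((supp R.out.1 ∪ supp R.out.2) \ A).card : ℤ) : k) * K R.out.1 R.out.2 := by
  rw [integral_eq h.integral_right, integralOver, ← sum_orb_prod A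
    (fun x y => (((-1) ^ ((supp x ∪ supp y) \ A).card : ℤ) : k) * K x y) _ Quotient.out orb_out]
  · refine finsum_congr fun P => ?_
    rw [integral_eq (h.right P.out), integralOver, mul_finsum_finite]
    refine finsum_congr fun Q => ?_
    rw [sign_union]
    unfold orbitVol
    push_cast
    ring
  · intro g hg x y
    rw [h g hg, supp_smul, supp_smul, ← Finset.image_union]
    rw [card_image_sdiff_of_mem _ hg]

/-- Fubini's theorem. -/
theorem integral_swap [FinitaryGSet X] [FinitaryGSet Y] {A : Finset ℝ} {K : X → Y → k}
    (h : Inv₂ A K) :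
    integral (fun x => integral (fun y => K x y)) =
      integral (fun y => integral (fun x => K x y)) := by
  have h' : Inv₂ A (fun y x => K x y) := fun g hg y x => h g hg x y
  rw [integral_integral h, integral_integral h',
    sum_orb_swap A (fun x y => (((-1) ^ ((supp x ∪ supp y) \ A).card : ℤ) : k) * K x y)]
  · simp only [Finset.union_comm]
  · intro g hg x y
    rw [h g hg, supp_smul, supp_smul, ← Finset.image_union]
    rw [card_image_sdiff_of_mem _ hg]

end Independence

section Matrices

variable {X Y Z : Type} [MulAction G X] [MulAction G Y] [MulAction G Z] {k : Type u} [CommRing k]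

instance finitaryGSet_prod [FinitaryGSet X] [FinitaryGSet Y] : FinitaryGSet (X × Y) where
  smooth z := by
    classical
    refine ⟨supp z.1 ∪ supp z.2, fun g hg => ?_⟩
    rw [fix_union] at hg
    exact Prod.ext (mem_fix_supp.1 hg.1) (mem_fix_supp.1 hg.2)
  finitary := by
    have : Finite (MulAction.orbitRel.Quotient G X) := FinitaryGSet.finitary
    let e : (Σ P : MulAction.orbitRel.Quotient G X, Orb (supp P.out) Y) →
        MulAction.orbitRel.Quotient G (X × Y) := fun p => Quotient.mk _ (p.1.out, p.2.out)
    refine Finite.of_surjective e fun R => ?_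
    induction R using Quotient.inductionOn with | _ z => ?_
    let P : MulAction.orbitRel.Quotient G X := Quotient.mk _ z.1
    have h : (Quotient.mk _ P.out : MulAction.orbitRel.Quotient G X) = Quotient.mk _ z.1 :=
      Quotient.out_eq P
    rw [Quotient.eq, MulAction.orbitRel_apply] at h
    obtain ⟨g, hg⟩ := h
    obtain ⟨l, hl, hy⟩ := orb_eq_iff.1 (orb_out (orb (supp P.out) (g • z.2)))
    refine ⟨⟨P, orb _ (g • z.2)⟩, ?_⟩
    change (Quotient.mk _ (P.out, (orb (supp P.out) (g • z.2)).out) :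
      MulAction.orbitRel.Quotient G (X × Y)) = _
    rw [Quotient.eq, MulAction.orbitRel_apply]
    refine ⟨l * g, Prod.ext ?_ ?_⟩
    · change (l * g) • z.1 = P.out
      change g • z.1 = P.out at hg
      rw [mul_smul, hg, mem_fix_supp.1 hl]
    · change (l * g) • z.2 = _
      rw [mul_smul, hy]

/-- A function on a product which is invariant under all of `G`. -/
def GInv (K : X → Y → k) : Prop := ∀ (g : G) (x : X) (y : Y), K (g • x) (g • y) = K x y

/-- The product of a `Y × X` matrix with a vector indexed by `X`. -/
noncomputable def mulVec (K : Y → X → k) (φ : X → k) (y : Y) : k :=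
  integral fun x => K y x * φ x

theorem GInv.inv [FinitaryGSet Y] {K : Y → X → k} (hK : GInv K) (y : Y) : FixInv (supp y) (K y) := by
  intro g hg x
  conv_lhs => rw [← mem_fix_supp.1 hg]
  exact hK g y x

theorem IsSchwartz.mul [FinitaryGSet X] {φ ψ : X → k} (h : IsSchwartz φ) (h' : IsSchwartz ψ) :
    IsSchwartz (fun x => φ x * ψ x) := by
  classical
  obtain ⟨A, hA⟩ := h.exists_inv
  obtain ⟨B, hB⟩ := h'.exists_inv
  refine FixInv.isSchwartz (A := A ∪ B) fun g hg x => ?_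
  rw [fix_union] at hg
  simp only [hA g hg.1, hB g hg.2]

theorem GInv.isSchwartz [FinitaryGSet X] [FinitaryGSet Y] {K : Y → X → k} (hK : GInv K) (y : Y) :
    IsSchwartz (K y) := (hK.inv y).isSchwartz

theorem GInv.swap {K : Y → X → k} (hK : GInv K) : GInv (fun x y => K y x) :=
  fun g x y => hK g y x

theorem mulVec_smul [FinitaryGSet X] [FinitaryGSet Y] {K : Y → X → k} (hK : GInv K) {φ : X → k}
    (hφ : IsSchwartz φ) (g : G) (y : Y) :
    mulVec K φ (g • y) = mulVec K (fun x => φ (g • x)) y := by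
  have h : IsSchwartz (fun x => K y x * φ (g • x)) := by
    obtain ⟨A, hA⟩ := hφ.exists_inv
    have := (hA.translate g⁻¹).isSchwartz
    rw [inv_inv] at this
    exact (hK.isSchwartz y).mul this
  unfold mulVec
  rw [← integral_translate h g]
  congr 1
  funext x
  rw [smul_inv_smul]
  congr 1
  rw [← hK g y, smul_inv_smul]

theorem mulVec_inv [FinitaryGSet X] [FinitaryGSet Y] {K : Y → X → k} (hK : GInv K) {A : Finset ℝ}
    {φ : X → k} (hφ : FixInv A φ) : FixInv A (mulVec K φ) := by
  intro g hg y
  rw [mulVec_smul hK hφ.isSchwartz]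
  congr 1
  funext x
  exact hφ g hg x

theorem mulVec_isSchwartz [FinitaryGSet X] [FinitaryGSet Y] {K : Y → X → k} (hK : GInv K)
    {φ : X → k} (hφ : IsSchwartz φ) : IsSchwartz (mulVec K φ) := by
  obtain ⟨A, hA⟩ := hφ.exists_inv
  exact (mulVec_inv hK hA).isSchwartz

/-- The product of a `Z × Y` matrix and a `Y × X` matrix. -/
noncomputable def matMul (K : Z → Y → k) (L : Y → X → k) (z : Z) (x : X) : k :=
  integral fun y => K z y * L y x

theorem matMul_gInv [FinitaryGSet X] [FinitaryGSet Y] [FinitaryGSet Z] {K : Z → Y → k}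
    {L : Y → X → k} (hK : GInv K) (hL : GInv L) : GInv (matMul K L) := by
  intro g z x
  change mulVec K (fun y => L y (g • x)) (g • z) = _
  rw [mulVec_smul hK (hL.swap.isSchwartz _)]
  simp only [hL g]
  rfl

theorem mulVec_mulVec [FinitaryGSet X] [FinitaryGSet Y] [FinitaryGSet Z] {K : Z → Y → k}
    {L : Y → X → k} (hK : GInv K) (hL : GInv L) {φ : X → k} (hφ : IsSchwartz φ) :
    mulVec K (mulVec L φ) = mulVec (matMul K L) φ := by
  classical
  funext z
  obtain ⟨A, hA⟩ := hφ.exists_inv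
  unfold mulVec matMul
  have h1 : ∀ y, K z y * integral (fun x => L y x * φ x) =
      integral (fun x => K z y * (L y x * φ x)) := fun y =>
    (integral_const_mul _ ((hL.isSchwartz y).mul hφ)).symm
  have h2 : ∀ x, integral (fun y => K z y * L y x) * φ x =
      integral (fun y => K z y * (L y x * φ x)) := fun x => by
    rw [← integral_mul_const _ ((hK.isSchwartz z).mul (hL.swap.isSchwartz x))]
    simp only [mul_assoc]
  simp only [h1, h2]
  refine integral_swap (A := A ∪ supp z) fun g hg y x => ?_
  rw [fix_union] at hg
  rw [hL g, hA g hg.1, (hK.inv z) g hg.2]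

theorem matMul_assoc {W : Type} [MulAction G W] [FinitaryGSet W] [FinitaryGSet X] [FinitaryGSet Y]
    [FinitaryGSet Z] {K : Z → Y → k} {L : Y → X → k} {M : X → W → k} (hK : GInv K) (hL : GInv L)
    (hM : GInv M) : matMul (matMul K L) M = matMul K (matMul L M) := by
  funext z w
  exact (congrFun (mulVec_mulVec hK hL (hM.swap.isSchwartz w)) z).symm

open Classical in
/-- The identity matrix: the characteristic function of the diagonal. -/
noncomputable def idMat (X : Type) (k : Type u) [CommRing k] (x y : X) : k := if x = y then 1 else 0

theorem idMat_gInv : GInv (idMat X k) := fun g x y => by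
  unfold idMat
  rw [smul_left_cancel_iff]

theorem mulVec_idMat [FinitaryGSet X] (φ : X → k) : mulVec (idMat X k) φ = φ := by
  classical
  funext x
  rw [← integral_delta x φ]
  unfold mulVec idMat
  congr 1
  funext y
  by_cases h : x = y
  · simp [h]
  · simp [h, Ne.symm h]

theorem idMat_matMul [FinitaryGSet X] (K : X → Y → k) : matMul (idMat X k) K = K := by
  funext x y
  exact congrFun (mulVec_idMat (fun x => K x y)) x

theorem matMul_idMat [FinitaryGSet Y] (K : X → Y → k) : matMul K (idMat Y k) = K := by
  classical
  funext x y
  rw [← integral_delta y (K x)]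
  unfold matMul idMat
  congr 1
  funext z
  by_cases h : z = y <;> simp [h]

theorem mulVec_add [FinitaryGSet X] [FinitaryGSet Y] {K : Y → X → k} (hK : GInv K) {φ ψ : X → k}
    (hφ : IsSchwartz φ) (hψ : IsSchwartz ψ) :
    mulVec K (φ + ψ) = mulVec K φ + mulVec K ψ := by
  funext y
  unfold mulVec
  rw [Pi.add_apply, ← integral_add ((hK.isSchwartz y).mul hφ) ((hK.isSchwartz y).mul hψ)]
  simp only [Pi.add_apply, mul_add]

theorem mulVec_const_smul [FinitaryGSet X] [FinitaryGSet Y] {K : Y → X → k} (hK : GInv K) (c : k)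
    {φ : X → k} (hφ : IsSchwartz φ) : mulVec K (c • φ) = c • mulVec K φ := by
  funext y
  unfold mulVec
  rw [Pi.smul_apply, smul_eq_mul, ← integral_const_mul _ ((hK.isSchwartz y).mul hφ)]
  simp only [Pi.smul_apply, smul_eq_mul, mul_left_comm]

theorem add_mulVec [FinitaryGSet X] [FinitaryGSet Y] {K L : Y → X → k} (hK : GInv K) (hL : GInv L)
    {φ : X → k} (hφ : IsSchwartz φ) : mulVec (K + L) φ = mulVec K φ + mulVec L φ := by
  funext y
  change _ = integral (fun x => K y x * φ x) + integral (fun x => L y x * φ x)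
  rw [← integral_add ((hK.isSchwartz y).mul hφ) ((hL.isSchwartz y).mul hφ)]
  unfold mulVec
  simp only [Pi.add_apply, add_mul]

end Matrices

/-! ### The Schwartz space -/

/-- The Schwartz space `𝒞(X)` of a finitary `G`-set. -/
def Schwartz (k : Type u) [CommRing k] (X : Type) [MulAction G X] [FinitaryGSet X] :
    Submodule k (X → k) where
  carrier := {φ | IsSchwartz φ}
  zero_mem' := FixInv.isSchwartz (A := ∅) fun _ _ _ => rfl
  add_mem' := fun {φ ψ} hφ hψ => by
    classical
    obtain ⟨A, hA⟩ := IsSchwartz.exists_inv hφ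
    obtain ⟨B, hB⟩ := IsSchwartz.exists_inv hψ
    exact ((hA.mono (Finset.subset_union_left (s₂ := B))).add
      (hB.mono Finset.subset_union_right)).isSchwartz
  smul_mem' := fun c φ hφ => by
    obtain ⟨A, hA⟩ := IsSchwartz.exists_inv hφ
    exact FixInv.isSchwartz (A := A) fun g hg x => by simp only [Pi.smul_apply, hA g hg]

/-! ### Permutation modules -/

/-- Objects `Vec_X` of the category of permutation modules; here `X` is a finitary `G`-set. -/
structure Perm (k : Type u) where
  carrier : Type
  [action : MulAction G carrier]
  [finitary : FinitaryGSet carrier]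

attribute [instance] Perm.action Perm.finitary

/-- The space of `G`-invariant `Y × X` matrices. -/
def InvMat (k : Type u) [CommRing k] (Y X : Type) [MulAction G X] [MulAction G Y] [FinitaryGSet X]
    [FinitaryGSet Y] : Submodule k (Y × X → k) where
  carrier := {A | IsSchwartz A ∧ ∀ (g : G) (z : Y × X), A (g • z) = A z}
  zero_mem' := ⟨(Schwartz k (Y × X)).zero_mem, fun _ _ => rfl⟩
  add_mem' := fun hA hB => ⟨(Schwartz k (Y × X)).add_mem hA.1 hB.1,
    fun g z => by simp only [Pi.add_apply, hA.2, hB.2]⟩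
  smul_mem' := fun c _ hA => ⟨(Schwartz k (Y × X)).smul_mem c hA.1,
    fun g z => by simp only [Pi.smul_apply, hA.2]⟩

section InvMat

variable {k : Type u} [CommRing k] {X Y Z : Type} [MulAction G X] [MulAction G Y] [MulAction G Z]
  [FinitaryGSet X] [FinitaryGSet Y] [FinitaryGSet Z]

/-- The entries of an invariant matrix. -/
def entry (A : InvMat k Y X) (y : Y) (x : X) : k := A.1 (y, x)

theorem entry_gInv (A : InvMat k Y X) : GInv (entry A) := fun g y x => A.2.2 g (y, x)

/-- The invariant matrix with the given entries. -/
def matOf (K : Y → X → k) (hK : GInv K) : InvMat k Y X :=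
  ⟨fun z => K z.1 z.2, FixInv.isSchwartz (A := ∅) fun g _ z => hK g z.1 z.2,
    fun g z => hK g z.1 z.2⟩

theorem mat_ext {A B : InvMat k Y X} (h : (entry A) = (entry B)) : A = B :=
  Subtype.ext (funext fun z => congrFun (congrFun h z.1) z.2)

end InvMat

noncomputable instance (k : Type u) [CommRing k] : Category.{u} (Perm k) where
  Hom X Y := InvMat k Y.carrier X.carrier
  id X := matOf (idMat X.carrier k) idMat_gInv
  comp A B := matOf (matMul (entry B) (entry A)) (matMul_gInv (entry_gInv B) (entry_gInv A))
  id_comp A := mat_ext (matMul_idMat (entry A))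
  comp_id A := mat_ext (idMat_matMul (entry A))
  assoc A B C := mat_ext (matMul_assoc (entry_gInv C) (entry_gInv B) (entry_gInv A)).symm

noncomputable instance (k : Type u) [CommRing k] : Preadditive (Perm k) where
  homGroup X Y := inferInstanceAs (AddCommGroup (InvMat k Y.carrier X.carrier))
  add_comp _ _ _ A B C := mat_ext (by
    funext z x
    exact congrFun (mulVec_add (entry_gInv C) ((entry_gInv A).swap.isSchwartz x) ((entry_gInv B).swap.isSchwartz x)) z)
  comp_add _ _ _ A B C := mat_ext (by
    funext z x
    exact congrFun (add_mulVec (entry_gInv B) (entry_gInv C) ((entry_gInv A).swap.isSchwartz x)) z)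

/-! ### The completed group algebra -/

/-- The open subgroups of `G`. -/
abbrev OpenSub : Type := {U : Subgroup G // IsOpenSubgroup U}

instance finitaryGSet_quotient (U : OpenSub) : FinitaryGSet (G ⧸ U.1) where
  smooth x := by
    classical
    obtain ⟨A, hA⟩ := U.2
    induction x using Quotient.inductionOn with | _ g => ?_
    refine ⟨A.image g, fun h hh => ?_⟩
    rw [mem_fix_image] at hh
    change (QuotientGroup.mk (h * g) : G ⧸ U.1) = QuotientGroup.mk g
    symm
    rw [QuotientGroup.eq, ← mul_assoc]
    exact hA hh
  finitary := by
    have := (MulAction.pretransitive_iff_subsingleton_quotient G (G ⧸ U.1)).1 inferInstance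
    infer_instance

section Pushforward

variable {k : Type u} [CommRing k] {X Y : Type} [MulAction G X] [MulAction G Y]

open Classical in
/-- Push-forward of functions along a map, by integrating over the fibres. -/
noncomputable def pushforward (f : X → Y) (φ : X → k) (y : Y) : k :=
  integral fun x => if f x = y then φ x else 0

open Classical in
/-- The matrix of the push-forward. -/
noncomputable def graphMat (k : Type u) [CommRing k] (f : X → Y) (y : Y) (x : X) : k :=
  if f x = y then 1 else 0

theorem pushforward_eq (f : X → Y) (φ : X → k) : pushforward f φ = mulVec (graphMat k f) φ := by
  funext y
  unfold pushforward mulVec graphMat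
  congr 1
  funext x
  split_ifs <;> simp

theorem graphMat_gInv {f : X → Y} (hf : ∀ (g : G) x, f (g • x) = g • f x) :
    GInv (graphMat k f) := fun g y x => by
  unfold graphMat
  rw [hf, smul_left_cancel_iff]

end Pushforward

theorem quotientMap_smul {U V : Subgroup G} (h : V ≤ U) (g : G) (x : G ⧸ V) :
    Subgroup.quotientMapOfLE h (g • x) = g • Subgroup.quotientMapOfLE h x := by
  induction x using Quotient.inductionOn with | _ l => rfl

/-- The inverse limit of the Schwartz spaces `𝒞(G/U)` over the open subgroups `U` of `G`, with
respect to the push-forward maps. -/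
noncomputable def limitSchwartz (k : Type u) [CommRing k] :
    Submodule k (∀ U : OpenSub, Schwartz k (G ⧸ U.1)) where
  carrier := {a | ∀ (U V : OpenSub) (h : V.1 ≤ U.1),
    (a U : G ⧸ U.1 → k) = pushforward (Subgroup.quotientMapOfLE h) (a V : G ⧸ V.1 → k)}
  zero_mem' := fun U V h => by
    have := mulVec_const_smul (graphMat_gInv (k := k) (quotientMap_smul h)) 0
      (0 : Schwartz k (G ⧸ V.1)).2
    rw [zero_smul, zero_smul] at this
    rw [pushforward_eq]
    exact this.symm
  add_mem' := fun {a b} ha hb U V h => by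
    have h1 := ha U V h
    have h2 := hb U V h
    rw [pushforward_eq] at h1 h2 ⊢
    have := mulVec_add (graphMat_gInv (k := k) (quotientMap_smul h)) (a V).2 (b V).2
    rw [← h1, ← h2] at this
    exact this.symm
  smul_mem' := fun c a ha U V h => by
    have h1 := ha U V h
    rw [pushforward_eq] at h1 ⊢
    have := mulVec_const_smul (graphMat_gInv (k := k) (quotientMap_smul h)) c (a V).2
    rw [← h1] at this
    exact this.symm

/-- The completed group algebra `A(G)`: the inverse limit of the Schwartz spaces `𝒞(G/U)`. Its
multiplication is convolution with respect to the principal measure. -/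
def CompletedGroupAlgebra (k : Type u) [CommRing k] : Type u := limitSchwartz k

namespace CompletedGroupAlgebra

variable {k : Type u} [CommRing k]

noncomputable instance : AddCommGroup (CompletedGroupAlgebra k) :=
  inferInstanceAs (AddCommGroup (limitSchwartz k))

noncomputable instance : Module k (CompletedGroupAlgebra k) :=
  inferInstanceAs (Module k (limitSchwartz k))

/-- The component of an element of `A(G)` in `𝒞(G/U)`. -/
def comp (a : CompletedGroupAlgebra k) (U : OpenSub) : G ⧸ U.1 → k := (a.1 U).1

theorem comp_isSchwartz (a : CompletedGroupAlgebra k) (U : OpenSub) : IsSchwartz (a.comp U) :=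
  (a.1 U).2

theorem comp_eq (a : CompletedGroupAlgebra k) {U V : OpenSub} (h : V.1 ≤ U.1) :
    a.comp U = mulVec (graphMat k (Subgroup.quotientMapOfLE h)) (a.comp V) := by
  rw [← pushforward_eq]
  exact a.2 U V h

theorem ext {a b : CompletedGroupAlgebra k} (h : ∀ U, a.comp U = b.comp U) : a = b :=
  Subtype.ext (funext fun U => Subtype.ext (h U))

theorem comp_add (a b : CompletedGroupAlgebra k) (U : OpenSub) :
    (a + b).comp U = a.comp U + b.comp U := rfl

theorem comp_smul (c : k) (a : CompletedGroupAlgebra k) (U : OpenSub) :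
    (c • a).comp U = c • a.comp U := rfl

end CompletedGroupAlgebra

section Action

variable {k : Type u} [CommRing k] {X Y : Type} [MulAction G X] [MulAction G Y]

/-- The function `φ` is invariant under the subgroup `V`. -/
def InvSub (V : Subgroup G) (φ : X → k) : Prop := ∀ g ∈ V, ∀ x, φ (g • x) = φ x

/-- The convolution `(ψ * φ)(x) = ∫_{G/V} ψ(g) φ(g⁻¹ x) dg`, for `ψ` a function on `G/V` and `φ` a
`V`-invariant function on `X`. -/
noncomputable def conv (V : OpenSub) (ψ : G ⧸ V.1 → k) (φ : X → k) (x : X) : k :=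
  integral fun q : G ⧸ V.1 => ψ q * φ (q.out⁻¹ • x)

open Classical in
/-- The action of `A(G)` on Schwartz functions: `a` acts on a `V`-invariant function `φ` as
convolution with the component of `a` in `𝒞(G/V)`. -/
noncomputable def act (a : CompletedGroupAlgebra k) (φ : X → k) : X → k :=
  if h : ∃ V : OpenSub, InvSub V.1 φ then conv h.choose (a.comp h.choose) φ else 0

theorem InvSub.mono {U V : Subgroup G} {φ : X → k} (h : InvSub U φ) (hVU : V ≤ U) : InvSub V φ :=
  fun g hg x => h g (hVU hg) x

/-- The open subgroup `G(A)`. -/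
def OpenSub.fix (A : Finset ℝ) : OpenSub := ⟨Delannoy.fix A, A, le_rfl⟩

theorem IsSchwartz.exists_invSub {φ : X → k} (h : IsSchwartz φ) :
    ∃ V : OpenSub, InvSub V.1 φ := by
  obtain ⟨A, hA⟩ := h.exists_inv
  exact ⟨OpenSub.fix A, hA⟩

theorem InvSub.isSchwartz [FinitaryGSet X] {V : OpenSub} {φ : X → k} (h : InvSub V.1 φ) :
    IsSchwartz φ := by
  obtain ⟨A, hA⟩ := V.2
  exact FixInv.isSchwartz (A := A) fun g hg x => h g (hA hg) x

/-- The matrix `(x, g) ↦ φ(g⁻¹ x)`. -/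
noncomputable def transMat (V : OpenSub) (φ : X → k) (x : X) (q : G ⧸ V.1) : k := φ (q.out⁻¹ • x)

theorem transMat_mk {V : OpenSub} {φ : X → k} (h : InvSub V.1 φ) (x : X) (g : G) :
    transMat V φ x (QuotientGroup.mk g) = φ (g⁻¹ • x) := by
  unfold transMat
  obtain ⟨v, hv⟩ := QuotientGroup.mk_out_eq_mul V.1 g
  rw [hv, mul_inv_rev, mul_smul]
  exact h _ (V.1.inv_mem v.2) _

theorem transMat_gInv {V : OpenSub} {φ : X → k} (h : InvSub V.1 φ) : GInv (transMat V φ) := by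
  intro g x q
  induction q using Quotient.inductionOn with | _ l => ?_
  change transMat V φ (g • x) (QuotientGroup.mk (g * l)) = transMat V φ x (QuotientGroup.mk l)
  rw [transMat_mk h, transMat_mk h, mul_inv_rev, mul_smul, inv_smul_smul]

theorem conv_eq (V : OpenSub) (ψ : G ⧸ V.1 → k) (φ : X → k) :
    conv V ψ φ = mulVec (transMat V φ) ψ := by
  funext x
  unfold conv mulVec transMat
  simp only [mul_comm]

theorem conv_mono [FinitaryGSet X] (a : CompletedGroupAlgebra k) {V V' : OpenSub}
    (hV : V'.1 ≤ V.1) {φ : X → k} (h : InvSub V.1 φ) :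
    conv V (a.comp V) φ = conv V' (a.comp V') φ := by
  classical
  rw [conv_eq, conv_eq, a.comp_eq hV, mulVec_mulVec (transMat_gInv h)
    (graphMat_gInv (quotientMap_smul hV)) (a.comp_isSchwartz V')]
  congr 1
  funext x q
  induction q using Quotient.inductionOn with | _ l => ?_
  change matMul _ _ x (QuotientGroup.mk l) = transMat V' φ x (QuotientGroup.mk l)
  rw [transMat_mk (h.mono hV), ← transMat_mk h, ← integral_delta (QuotientGroup.mk l)
    (transMat V φ x)]
  unfold matMul graphMat
  congr 1
  funext q
  have : (Subgroup.quotientMapOfLE hV) (QuotientGroup.mk l) = QuotientGroup.mk l := rfl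
  rw [this]
  by_cases hq : q = QuotientGroup.mk l
  · simp [hq]
  · simp [hq, Ne.symm hq]

theorem act_eq [FinitaryGSet X] (a : CompletedGroupAlgebra k) {V : OpenSub} {φ : X → k}
    (h : InvSub V.1 φ) : act a φ = mulVec (transMat V φ) (a.comp V) := by
  classical
  have hex : ∃ V : OpenSub, InvSub V.1 φ := ⟨V, h⟩
  rw [← conv_eq]
  unfold act
  rw [dif_pos hex]
  obtain ⟨A, hA⟩ := hex.choose.2
  obtain ⟨B, hB⟩ := V.2
  have h1 : (OpenSub.fix (A ∪ B)).1 ≤ hex.choose.1 := (fix_anti Finset.subset_union_left).trans hA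
  have h2 : (OpenSub.fix (A ∪ B)).1 ≤ V.1 := (fix_anti Finset.subset_union_right).trans hB
  rw [conv_mono a h1 hex.choose_spec, conv_mono a h2 h]

theorem act_isSchwartz [FinitaryGSet X] (a : CompletedGroupAlgebra k) {φ : X → k}
    (h : IsSchwartz φ) : IsSchwartz (act a φ) := by
  obtain ⟨V, hV⟩ := h.exists_invSub
  rw [act_eq a hV]
  exact mulVec_isSchwartz (transMat_gInv hV) (a.comp_isSchwartz V)

theorem act_mulVec [FinitaryGSet X] [FinitaryGSet Y] (a : CompletedGroupAlgebra k) {K : Y → X → k}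
    (hK : GInv K) {φ : X → k} (hφ : IsSchwartz φ) : act a (mulVec K φ) = mulVec K (act a φ) := by
  obtain ⟨V, hV⟩ := hφ.exists_invSub
  have hV' : InvSub V.1 (mulVec K φ) := fun g hg y => by
    rw [mulVec_smul hK hφ]
    simp only [hV g hg]
  rw [act_eq a hV, act_eq a hV', mulVec_mulVec hK (transMat_gInv hV) (a.comp_isSchwartz V)]
  congr 1
  funext y q
  induction q using Quotient.inductionOn with | _ l => ?_
  change transMat V _ y (QuotientGroup.mk l) = integral fun x => K y x * transMat V φ x
    (QuotientGroup.mk l)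
  simp only [transMat_mk hV', transMat_mk hV]
  exact mulVec_smul hK hφ _ _

theorem act_add [FinitaryGSet X] (a : CompletedGroupAlgebra k) {φ ψ : X → k} (hφ : IsSchwartz φ)
    (hψ : IsSchwartz ψ) : act a (φ + ψ) = act a φ + act a ψ := by
  classical
  obtain ⟨A, hA⟩ := hφ.exists_inv
  obtain ⟨B, hB⟩ := hψ.exists_inv
  have hA' : InvSub (OpenSub.fix (A ∪ B)).1 φ := hA.mono Finset.subset_union_left
  have hB' : InvSub (OpenSub.fix (A ∪ B)).1 ψ := hB.mono Finset.subset_union_right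
  have hAB : InvSub (OpenSub.fix (A ∪ B)).1 (φ + ψ) := fun g hg x => by
    simp only [Pi.add_apply, hA' g hg, hB' g hg]
  rw [act_eq a hA', act_eq a hB', act_eq a hAB, ← add_mulVec (transMat_gInv hA')
    (transMat_gInv hB') (a.comp_isSchwartz _)]
  rfl

theorem act_smul [FinitaryGSet X] (a : CompletedGroupAlgebra k) (c : k) {φ : X → k}
    (hφ : IsSchwartz φ) : act a (c • φ) = c • act a φ := by
  obtain ⟨V, hV⟩ := hφ.exists_invSub
  have hV' : InvSub V.1 (c • φ) := fun g hg x => by simp only [Pi.smul_apply, hV g hg]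
  rw [act_eq a hV, act_eq a hV', ← mulVec_const_smul (transMat_gInv hV) _ (a.comp_isSchwartz _)]
  funext x
  unfold mulVec transMat
  congr 1
  funext q
  simp only [Pi.smul_apply, smul_eq_mul]
  ring

theorem add_act [FinitaryGSet X] (a b : CompletedGroupAlgebra k) {φ : X → k} (hφ : IsSchwartz φ) :
    act (a + b) φ = act a φ + act b φ := by
  obtain ⟨V, hV⟩ := hφ.exists_invSub
  rw [act_eq _ hV, act_eq _ hV, act_eq _ hV, CompletedGroupAlgebra.comp_add,
    mulVec_add (transMat_gInv hV) (a.comp_isSchwartz _) (b.comp_isSchwartz _)]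

theorem smul_act [FinitaryGSet X] (c : k) (a : CompletedGroupAlgebra k) {φ : X → k}
    (hφ : IsSchwartz φ) : act (c • a) φ = c • act a φ := by
  obtain ⟨V, hV⟩ := hφ.exists_invSub
  rw [act_eq _ hV, act_eq _ hV, CompletedGroupAlgebra.comp_smul,
    mulVec_const_smul (transMat_gInv hV) _ (a.comp_isSchwartz _)]

end Action

namespace CompletedGroupAlgebra

variable {k : Type u} [CommRing k]

/-- Convolution on `A(G)`: the component of `a * b` in `𝒞(G/U)` is `a * b_U`, that is, the function
`x ↦ ∫_{G/V} a_V(g) b_U(g⁻¹ x) dg` where `V` is an open subgroup such that `b_U` is left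
`V`-invariant. -/
noncomputable instance : Mul (CompletedGroupAlgebra k) where
  mul a b := ⟨fun U => ⟨act a (b.comp U), act_isSchwartz a (b.comp_isSchwartz U)⟩, fun U V h => by
    change act a (b.comp U) = pushforward _ (act a (b.comp V))
    rw [b.comp_eq h, act_mulVec a (graphMat_gInv (quotientMap_smul h)) (b.comp_isSchwartz V),
      pushforward_eq]⟩

theorem comp_mul (a b : CompletedGroupAlgebra k) (U : OpenSub) :
    (a * b).comp U = act a (b.comp U) := rfl

/-- The point mass at the identity coset. -/
noncomputable def delta (k : Type u) [CommRing k] (U : OpenSub) : G ⧸ U.1 → k :=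
  fun q => idMat (G ⧸ U.1) k q (QuotientGroup.mk 1)

theorem delta_invSub (U : OpenSub) : InvSub U.1 (delta k U) := by
  intro g hg q
  have h : g • (QuotientGroup.mk 1 : G ⧸ U.1) = QuotientGroup.mk 1 := by
    change QuotientGroup.mk (g * 1) = _
    rw [mul_one, QuotientGroup.eq, mul_one]
    exact U.1.inv_mem hg
  unfold delta
  conv_lhs => rw [← h]
  exact idMat_gInv g q _

/-- The identity of `A(G)` is the compatible system of point masses at the identity cosets. -/
noncomputable instance : One (CompletedGroupAlgebra k) where
  one := ⟨fun U => ⟨delta k U, (delta_invSub U).isSchwartz⟩, fun U V h => by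
    change delta k U = pushforward _ (delta k V)
    classical
    rw [pushforward_eq]
    have := matMul_idMat (graphMat k (Subgroup.quotientMapOfLE h))
    funext q
    rw [show mulVec (graphMat k (Subgroup.quotientMapOfLE h)) (delta k V) q =
      matMul (graphMat k (Subgroup.quotientMapOfLE h)) (idMat (G ⧸ V.1) k) q (QuotientGroup.mk 1)
      from rfl, this]
    unfold delta idMat graphMat
    have h1 : (Subgroup.quotientMapOfLE h) (QuotientGroup.mk 1) = QuotientGroup.mk 1 := rfl
    rw [h1]
    by_cases hq : q = QuotientGroup.mk 1
    · simp [hq]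
    · simp [hq, Ne.symm hq]⟩

theorem comp_one (U : OpenSub) : (1 : CompletedGroupAlgebra k).comp U = delta k U := rfl

theorem one_act {X : Type} [MulAction G X] [FinitaryGSet X] {φ : X → k} (h : IsSchwartz φ) :
    act 1 φ = φ := by
  obtain ⟨V, hV⟩ := h.exists_invSub
  rw [act_eq _ hV, comp_one]
  funext x
  have := congrFun (congrFun (matMul_idMat (transMat V φ)) x) (QuotientGroup.mk 1)
  refine this.trans ?_
  rw [transMat_mk hV, inv_one, one_smul]

theorem mul_act {X : Type} [MulAction G X] [FinitaryGSet X] (a b : CompletedGroupAlgebra k)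
    {φ : X → k} (h : IsSchwartz φ) : act (a * b) φ = act a (act b φ) := by
  obtain ⟨V, hV⟩ := h.exists_invSub
  rw [act_eq (a * b) hV, act_eq b hV, act_mulVec a (transMat_gInv hV) (b.comp_isSchwartz V),
    comp_mul]

noncomputable instance : Ring (CompletedGroupAlgebra k) :=
  { (inferInstance : AddCommGroup (CompletedGroupAlgebra k)),
    (inferInstance : Mul (CompletedGroupAlgebra k)),
    (inferInstance : One (CompletedGroupAlgebra k)) with
    left_distrib := fun a b c => ext fun U =>
      act_add a (b.comp_isSchwartz U) (c.comp_isSchwartz U)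
    right_distrib := fun a b c => ext fun U => add_act a b (c.comp_isSchwartz U)
    zero_mul := fun a => ext fun U => by
      have := smul_act (0 : k) 0 (a.comp_isSchwartz U)
      rw [zero_smul, zero_smul] at this
      exact this
    mul_zero := fun a => ext fun U => by
      have := act_smul a (0 : k) ((0 : CompletedGroupAlgebra k).comp_isSchwartz U)
      rw [zero_smul, zero_smul] at this
      exact this
    mul_assoc := fun a b c => ext fun U => mul_act a b (c.comp_isSchwartz U)
    one_mul := fun a => ext fun U => one_act (a.comp_isSchwartz U)
    mul_one := fun a => ext fun U => by
      rw [comp_mul, comp_one, act_eq a (delta_invSub U)]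
      have : transMat U (delta k U) = idMat (G ⧸ U.1) k := by
        funext x q
        induction q using Quotient.inductionOn with | _ l => ?_
        change transMat U (delta k U) x (QuotientGroup.mk l) = idMat _ k x (QuotientGroup.mk l)
        rw [transMat_mk (delta_invSub U), ← idMat_gInv l⁻¹ x]
        unfold delta
        congr 1
        change _ = QuotientGroup.mk (l⁻¹ * l)
        rw [inv_mul_cancel]
      rw [this, mulVec_idMat] }

noncomputable instance : Algebra k (CompletedGroupAlgebra k) :=
  Algebra.ofModule (fun c a b => ext fun U => smul_act c a (b.comp_isSchwartz U))
    (fun c a b => ext fun U => act_smul a c (b.comp_isSchwartz U))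

/-- The `A(G)`-module structure on the Schwartz space `𝒞(X)`. -/
noncomputable instance (X : Type) [MulAction G X] [FinitaryGSet X] :
    Module (CompletedGroupAlgebra k) (Schwartz k X) where
  smul a φ := ⟨act a φ.1, act_isSchwartz a φ.2⟩
  one_smul φ := Subtype.ext (one_act φ.2)
  mul_smul a b φ := Subtype.ext (mul_act a b φ.2)
  smul_zero a := Subtype.ext (by
    have := act_smul a (0 : k) (0 : Schwartz k X).2
    rw [zero_smul, zero_smul] at this
    exact this)
  smul_add a φ ψ := Subtype.ext (act_add a φ.2 ψ.2)
  add_smul a b φ := Subtype.ext (add_act a b φ.2)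
  zero_smul φ := Subtype.ext (by
    have := smul_act (0 : k) 0 φ.2
    rw [zero_smul, zero_smul] at this
    exact this)

end CompletedGroupAlgebra

/-! ### The representation category -/

/-- A module over `A(G)` is smooth if for every element `x` there is an open subgroup `U` such that
the action of `A(G)` on `x` factors through `𝒞(G/U)`. -/
def IsSmoothModule (k : Type u) [CommRing k] :
    ObjectProperty (ModuleCat.{u} (CompletedGroupAlgebra k)) :=
  fun M => ∀ x : M, ∃ U : OpenSub, ∀ a : CompletedGroupAlgebra k, a.comp U = 0 → a • x = 0

/-- The category `Rep(G)` of smooth `A(G)`-modules. -/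
abbrev SmoothRep (k : Type u) [CommRing k] : Type (u + 1) := (IsSmoothModule k).FullSubcategory

/-- The objects of finite length in `Rep(G)`. (Submodules of smooth modules
are smooth, so the length in `Rep(G)` is the length as an `A(G)`-module.) -/
def IsFiniteLengthRep (k : Type u) [CommRing k] : ObjectProperty (SmoothRep k) :=
  fun M => IsFiniteLength (CompletedGroupAlgebra k) M.obj

/-- The category `Rep^f(G)` of objects of finite length in `Rep(G)`. -/
abbrev RepFin (k : Type u) [CommRing k] : Type (u + 1) := (IsFiniteLengthRep k).FullSubcategory

/-- The Schwartz space `𝒞(X)` as an object of `Rep(G)`. -/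
noncomputable def schwartzRep (k : Type u) [CommRing k] (X : Type) [MulAction G X]
    [FinitaryGSet X] : SmoothRep k where
  obj := ModuleCat.of (CompletedGroupAlgebra k) (Schwartz k X)
  property := fun (φ : Schwartz k X) => by
    obtain ⟨V, hV⟩ := IsSchwartz.exists_invSub φ.2
    refine ⟨V, fun a ha => Subtype.ext ?_⟩
    change act a φ.1 = 0
    rw [act_eq a hV, ha]
    have := mulVec_const_smul (transMat_gInv hV) 0 (Schwartz k (G ⧸ V.1)).zero_mem
    rwa [zero_smul, zero_smul] at this

/-- The functor from permutation modules to `Rep(G)` which maps `Vec_X` to `𝒞(X)` and a matrix to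
the operator that it defines. -/
noncomputable def permToRep (k : Type u) [CommRing k] : Perm k ⥤ SmoothRep k where
  obj X := schwartzRep k X.carrier
  map {X Y} A := ObjectProperty.homMk (ModuleCat.ofHom
    { toFun := fun φ : Schwartz k X.carrier =>
        (⟨mulVec (entry A) φ.1, mulVec_isSchwartz (entry_gInv A) φ.2⟩ : Schwartz k Y.carrier)
      map_add' := fun φ ψ => Subtype.ext (mulVec_add (entry_gInv A) φ.2 ψ.2)
      map_smul' := fun a φ => Subtype.ext (act_mulVec a (entry_gInv A) φ.2).symm })
  map_id X := by
    ext φ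
    exact Subtype.ext (mulVec_idMat φ.1)
  map_comp A B := by
    ext φ
    exact Subtype.ext (mulVec_mulVec (entry_gInv B) (entry_gInv A) φ.2).symm

/-! ### The `G`-sets `ℝ^(n)` -/

/-- The set `ℝ^(n)` of tuples `x_1 < ⋯ < x_n` of real numbers. -/
def RTuple (n : ℕ) : Type := {x : Fin n → ℝ // StrictMono x}

instance (n : ℕ) : MulAction G (RTuple n) where
  smul g x := ⟨fun i => g (x.1 i), fun _ _ h => g.strictMono (x.2 h)⟩
  one_smul _ := rfl
  mul_smul _ _ _ := rfl

instance (n : ℕ) : FinitaryGSet (RTuple n) where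
  smooth x := by
    classical
    exact ⟨Finset.univ.image x.1, fun g hg => Subtype.ext (funext fun i =>
      hg (x.1 i) (Finset.mem_image_of_mem _ (Finset.mem_univ i)))⟩
  finitary := by
    classical
    have : Subsingleton (MulAction.orbitRel.Quotient G (RTuple n)) := by
      refine ⟨fun a b => ?_⟩
      induction a using Quotient.inductionOn with | _ x => ?_
      induction b using Quotient.inductionOn with | _ y => ?_
      rw [Quotient.eq, MulAction.orbitRel_apply]
      have hf : ∀ i, (Function.extend y.1 x.1 0) (y.1 i) = x.1 i :=
        fun i => y.2.injective.extend_apply _ _ i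
      obtain ⟨g, hg⟩ := exists_ext (Finset.univ.image y.1) (Function.extend y.1 x.1 0) (by
        intro s hs t ht hst
        simp only [Finset.coe_image, Finset.coe_univ, Set.image_univ, Set.mem_range] at hs ht
        obtain ⟨i, rfl⟩ := hs
        obtain ⟨j, rfl⟩ := ht
        rw [hf, hf]
        exact x.2 (y.2.lt_iff_lt.1 hst))
      refine ⟨g, Subtype.ext (funext fun i => ?_)⟩
      change g (y.1 i) = x.1 i
      rw [hg _ (Finset.mem_image_of_mem _ (Finset.mem_univ i)), hf]
    infer_instance

/-! ### Delannoy paths -/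

/-- An `a`-Delannoy path: a tuple of non-zero 0-1 vectors with sum `a`. -/
@[ext]
structure DPath {ι : Type} (a : ι → ℕ) where
  steps : List (ι → ℕ)
  ne_zero : ∀ v ∈ steps, v ≠ 0
  zero_one : ∀ v ∈ steps, ∀ i, v i = 0 ∨ v i = 1
  sum_eq : steps.sum = a

/-- The length of a path is its number of steps. -/
def DPath.length {ι : Type} {a : ι → ℕ} (p : DPath a) : ℕ := p.steps.length

open Classical in
/-- The projection of a path along an injection `i` of index sets: restrict each step to the
coordinates in the image of `i`, and delete the steps that become zero. -/
noncomputable def DPath.proj {ι κ : Type} {a : ι → ℕ} (i : κ ↪ ι) (p : DPath a) : DPath (a ∘ i) where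
  steps := (p.steps.map (· ∘ i)).filter (· ≠ 0)
  ne_zero := fun v hv => by simpa using (List.mem_filter.1 hv).2
  zero_one := fun v hv j => by
    obtain ⟨w, hw, rfl⟩ := List.mem_map.1 (List.mem_filter.1 hv).1
    exact p.zero_one w hw (i j)
  sum_eq := by
    have h : ∀ L : List (κ → ℕ), (L.filter (· ≠ 0)).sum = L.sum := by
      intro L
      induction L with
      | nil => rfl
      | cons v L ih =>
        by_cases hv : v = 0
        · simpa [hv] using ih
        · simpa [hv] using ih
    have h' : ∀ L : List (ι → ℕ), (L.map (· ∘ i)).sum = L.sum ∘ i := by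
      intro L
      induction L with
      | nil => rfl
      | cons v L ih =>
        simp only [List.map_cons, List.sum_cons, ih]
        rfl
    rw [h, h', p.sum_eq]

instance DPath.finite {ι : Type} [Finite ι] (a : ι → ℕ) : Finite (DPath a) := by
  classical
  have := Fintype.ofFinite ι
  have hlen : ∀ p : DPath a, p.steps.length ≤ ∑ i, a i := by
    rintro ⟨L, h1, h0, rfl⟩
    dsimp only
    clear h0
    induction L with
    | nil => simp
    | cons v L ih =>
      have h2 : L.length ≤ ∑ i, L.sum i := ih fun w hw => h1 w (List.mem_cons_of_mem _ hw)
      have h3 : 0 < ∑ i, v i := by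
        obtain ⟨i, hi⟩ := Function.ne_iff.1 (h1 v List.mem_cons_self)
        exact (Nat.pos_of_ne_zero hi).trans_le
          (Finset.single_le_sum (fun j _ => Nat.zero_le (v j)) (Finset.mem_univ i))
      simp only [List.sum_cons, List.length_cons, Pi.add_apply, Finset.sum_add_distrib]
      omega
  have hfin := List.finite_length_le (ι → Bool) (∑ i, a i)
  have := hfin.to_subtype
  refine Finite.of_injective (fun p : DPath a =>
    (⟨p.steps.map (fun v i => decide (v i = 1)), by simpa using hlen p⟩ :
      {l : List (ι → Bool) | l.length ≤ ∑ i, a i})) ?_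
  intro p q h
  have h := congrArg Subtype.val h
  dsimp only at h
  refine DPath.ext ?_
  have key : ∀ L M : List (ι → ℕ), (∀ v ∈ L, ∀ i, v i = 0 ∨ v i = 1) →
      (∀ v ∈ M, ∀ i, v i = 0 ∨ v i = 1) →
      L.map (fun v i => decide (v i = 1)) = M.map (fun v i => decide (v i = 1)) → L = M := by
    intro L
    induction L with
    | nil => intro M _ _ h; simpa using h
    | cons v L ih =>
      rintro (_ | ⟨w, M⟩) hL hM h
      · simp at h
      · simp only [List.map_cons, List.cons.injEq] at h
        rw [ih M (fun v hv => hL v (List.mem_cons_of_mem _ hv))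
          (fun v hv => hM v (List.mem_cons_of_mem _ hv)) h.2]
        congr 1
        funext i
        have h1 := hL v List.mem_cons_self i
        have h2 := hM w List.mem_cons_self i
        have h3 := congrFun h.1 i
        simp only [decide_eq_decide] at h3
        omega
  exact key _ _ p.zero_one q.zero_one h

noncomputable instance DPath.fintype {ι : Type} [Finite ι] (a : ι → ℕ) : Fintype (DPath a) :=
  Fintype.ofFinite _

/-- The inclusions of two coordinates among three. -/
def pair (i j : Fin 3) (h : i ≠ j) : Fin 2 ↪ Fin 3 where
  toFun := ![i, j]
  inj' := by
    intro a b
    fin_cases a <;> fin_cases b <;> simp [h, h.symm]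

/-- The path `q` projects to `p₁₂`, `p₂₃` and `p₁₃`. -/
def IsLift {n m l : ℕ} (q : DPath ![n, m, l]) (p₁₂ : DPath ![n, m]) (p₂₃ : DPath ![m, l])
    (p₁₃ : DPath ![n, l]) : Prop :=
  (q.proj (pair 0 1 (by decide))).steps = p₁₂.steps ∧
  (q.proj (pair 1 2 (by decide))).steps = p₂₃.steps ∧
  (q.proj (pair 0 2 (by decide))).steps = p₁₃.steps

open Classical in
/-- The structure constants `ε(p₁, p₂, p₃)`. -/
noncomputable def eps {n m l : ℕ} (p₁ : DPath ![n, m]) (p₂ : DPath ![m, l]) (p₃ : DPath ![n, l]) : ℤ :=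
  if h : ∃ q : DPath ![n, m, l], IsLift q p₁ p₂ p₃ then (-1) ^ (h.choose.length + p₃.length) else 0

/-- The vector space `𝒟(n, m)` with basis the set of `(n, m)`-Delannoy paths. -/
abbrev PathSpace (k : Type u) [CommRing k] (n m : ℕ) : Type u := DPath ![n, m] →₀ k

/-- The bilinear composition law `𝒟(n, m) × 𝒟(m, l) → 𝒟(n, l)`, which is given on basis vectors by
`[p₁] ∘ [p₂] = ∑ p₃, ε(p₁, p₂, p₃) [p₃]`. -/
noncomputable def pathComp (k : Type u) [CommRing k] {n m l : ℕ} :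
    PathSpace k n m →ₗ[k] PathSpace k m l →ₗ[k] PathSpace k n l :=
  Finsupp.linearCombination k fun p₁ => Finsupp.linearCombination k fun p₂ =>
    ∑ p₃ : DPath ![n, l], Finsupp.single p₃ (eps p₁ p₂ p₃ : k)

/-- Associativity of the composition law. -/
def PathCompAssoc (k : Type u) [CommRing k] : Prop :=
  ∀ (n m l r : ℕ) (f : PathSpace k n m) (g : PathSpace k m l) (h : PathSpace k l r),
    pathComp k (pathComp k f g) h = pathComp k f (pathComp k g h)

/-- Existence of identity elements for the composition law. -/
def PathCompUnital (k : Type u) [CommRing k] : Prop :=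
  ∀ n : ℕ, ∃ e : PathSpace k n n, (∀ (m : ℕ) (f : PathSpace k n m), pathComp k e f = f) ∧
    ∀ (m : ℕ) (f : PathSpace k m n), pathComp k f e = f

/-- The path category `𝒟`: it has an object `X_n` for each natural number `n`, and the space of
morphisms `X_m ⟶ X_n` is `𝒟(n, m)`. It is a category once the composition law is known to be
associative and unital. -/
@[ext]
structure PathCat (k : Type u) [CommRing k] (h : PathCompAssoc k ∧ PathCompUnital k) where
  n : ℕ

namespace PathCat

variable {k : Type u} [CommRing k] {h : PathCompAssoc k ∧ PathCompUnital k}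

noncomputable instance : Category.{u} (PathCat k h) where
  Hom X Y := PathSpace k Y.n X.n
  id X := (h.2 X.n).choose
  comp f g := pathComp k g f
  id_comp f := (h.2 _).choose_spec.2 _ f
  comp_id f := (h.2 _).choose_spec.1 _ f
  assoc f₁ f₂ f₃ := (h.1 _ _ _ _ f₃ f₂ f₁).symm

noncomputable instance : Preadditive (PathCat k h) where
  homGroup X Y := inferInstanceAs (AddCommGroup (PathSpace k Y.n X.n))
  add_comp _ _ _ f f' g := (pathComp k g).map_add f f'
  comp_add _ _ _ f g g' := LinearMap.map_add₂ (pathComp k) g g' f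

noncomputable instance : Linear k (PathCat k h) where
  homModule X Y := inferInstanceAs (Module k (PathSpace k Y.n X.n))
  smul_comp _ _ _ r f g := (pathComp k g).map_smul r f
  comp_smul _ _ _ f r g := LinearMap.map_smul₂ (pathComp k) r g f

/-- The morphism `[p] : X_m ⟶ X_n` given by an `(n, m)`-Delannoy path `p`. -/
noncomputable def ofPath (h : PathCompAssoc k ∧ PathCompUnital k) {n m : ℕ} (p : DPath ![n, m]) :
    (⟨m⟩ : PathCat k h) ⟶ ⟨n⟩ :=
  (Finsupp.single p 1 : PathSpace k n m)

end PathCat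

/-- The orbit `O_p ⊂ ℝ^(n) × ℝ^(m)` of an `(n, m)`-Delannoy path `p`. It consists of those `(x, y)`
for which there are reals `w_1 < ⋯ < w_ℓ`, one for each step of `p`, such that the `x_i` (respectively
the `y_j`) are exactly those `w_r` for which the first (respectively second) coordinate of the
`r`-th step is `1`. -/
def orbitOf {n m : ℕ} (p : DPath ![n, m]) : Set (RTuple n × RTuple m) :=
  {z | ∃ w : RTuple p.length,
    Set.range z.1.1 = w.1 '' {r | (p.steps.get r) 0 = 1} ∧
    Set.range z.2.1 = w.1 '' {r | (p.steps.get r) 1 = 1}}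

theorem orbitOf_smul {n m : ℕ} (p : DPath ![n, m]) (g : G) (z : RTuple n × RTuple m) :
    g • z ∈ orbitOf p ↔ z ∈ orbitOf p := by
  have key : ∀ (g : G) (z : RTuple n × RTuple m), z ∈ orbitOf p → g • z ∈ orbitOf p := by
    rintro g z ⟨w, h1, h2⟩
    refine ⟨g • w, ?_, ?_⟩
    · change Set.range (g ∘ z.1.1) = (g ∘ w.1) '' _
      rw [Set.range_comp, h1, Set.image_comp]
    · change Set.range (g ∘ z.2.1) = (g ∘ w.1) '' _
      rw [Set.range_comp, h2, Set.image_comp]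
  refine ⟨fun h => ?_, key g z⟩
  have := key g⁻¹ _ h
  rwa [inv_smul_smul] at this

open Classical in
/-- The matrix `A_p`: the characteristic function of `O_p`, as a morphism
`Vec_{ℝ^(m)} ⟶ Vec_{ℝ^(n)}`. -/
noncomputable def pathMat (k : Type u) [CommRing k] {n m : ℕ} (p : DPath ![n, m]) :
    (Perm.mk (RTuple m) : Perm k) ⟶ Perm.mk (RTuple n) :=
  matOf (fun x y => if (x, y) ∈ orbitOf p then (1 : k) else 0) fun g x y => by
    have := orbitOf_smul p g (x, y)
    rw [Prod.smul_mk] at this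
    simp only [this]

/-- The operator `A_p : 𝒞(ℝ^(m)) ⟶ 𝒞(ℝ^(n))`. -/
noncomputable def pathOp (k : Type u) [CommRing k] {n m : ℕ} (p : DPath ![n, m]) :
    schwartzRep k (RTuple m) ⟶ schwartzRep k (RTuple n) :=
  (permToRep k).map (pathMat k p)

end Delannoy

open Delannoy CategoryTheory CategoryTheory.Idempotents

namespace Delannoy

/-! ### Tools for integration -/

section Integration

variable {X Y : Type} [MulAction G X] [MulAction G Y] [FinitaryGSet X] [FinitaryGSet Y]
  {k : Type u} [CommRing k]

/-! Everything is a computation with G-invariant kernels. A pair of finite subsets of the line is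
determined up to G by the order pattern of its points (`typ_eq_iff`, `exists_image_eq_of_typ`), and
such a pattern is a Delannoy path. So the orbits on ℝ^(n) × ℝ^(m) are the O_p, and `pathKer` is a
bijection from 𝒟(n, m) onto the invariant kernels. It carries the composition law to the matrix
product (`pathKer_pathComp`): for fixed x and z, the tuples y in position p₁ to x and p₂ to z are
either none or a single orbit of the stabilizer of (x, z), because the lift q is unique
(`IsLift.unique`), and the volume of that orbit is (-1)^(ℓ(q) - ℓ(p₃)) (`integral_pathOf`).
Associativity and identities are thus inherited from matrices, and 𝒟 becomes a full subcategory of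
the permutation modules.

The fibres of G/W → G/V have volume ±1, which is invertible, so A(G) → 𝒞(G/V) is onto
(`exists_comp_eq`). Hence 𝒞(X) is generated by point masses, one for each orbit, and a linear
operator f is given by the kernel f(δ_x)(y) (`exists_kernel`). So permutation modules embed fully
faithfully in smooth modules. A finitary G-set is a finite disjoint union of copies of the ℝ^(n),
since every open subgroup is some G(B); this gives the additive envelope.

For the Karoubi envelope, every smooth module of finite length must be a direct summand of a finite
sum of modules 𝒞(ℝ^(n)). Such a sum always maps onto it, since an element fixed by the relations of
a point mass is the image of that point mass (`SmoothRep.exists_linearMap`). The surjection splits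
once smooth modules are known to be semisimple, and for this it is enough to treat 𝒞(ℝ^(m)), by
induction on m.

For a word a of m letters ≤ or ≥ let E_a be `wordKer k a`, and let E'_a be its variant `wordKer' k
a`. A half-open interval has volume 0; integrating out one coordinate therefore gives E_a F = 0
whenever F does not depend on some coordinate of its first variable, and E_a E'_b = 0 for b ≠ a. On
the other hand every invariant kernel is a combination of kernels that omit a coordinate and of the
E'_b (`gInv_mem`). It follows that E_a K is a scalar multiple of E_a for every invariant K. So the
E_a are orthogonal idempotents, their images are simple (`isSimpleModule_range_wordKer`), and 1 - ∑
E_a is a combination of kernels that omit a coordinate (`idMat_sub_mem_indepSpan`). These factor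
through 𝒞(ℝ^(m-1)), which is semisimple by induction. -/

open Classical in
theorem integral_orb (A : Finset ℝ) (x₀ : X) :
    integral (fun x => if orb A x = orb A x₀ then (1 : k) else 0) = (orbitVol A x₀ : k) := by
  have hinv : FixInv A (fun x => if orb A x = orb A x₀ then (1 : k) else 0) := fun g hg x => by
    dsimp only
    rw [orb_smul hg]
  obtain ⟨σ, hσ, hσx⟩ := exists_section A x₀
  rw [integral_eq hinv, integralOver_eq_section hinv σ hσ, finsum_eq_single _ (orb A x₀)]
  · simp [hσx]
  · intro P hP
    simp [hσ, hP]

theorem integral_zero : integral (fun _ : X => (0 : k)) = 0 := by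
  have h : FixInv (k := k) ∅ (fun _ : X => (0 : k)) := fun _ _ _ => rfl
  rw [integral_eq h, integralOver]
  simp

/-- Change of variables along a map which is injective on the support. -/
theorem integral_eq_of_injOn {A : Finset ℝ} (θ : X → Y) (hθ : ∀ g ∈ fix A, ∀ x, θ (g • x) = g • θ x)
    {φ : X → k} (hφ : FixInv A φ) {ψ : Y → k}
    (h₁ : ∀ x, φ x ≠ 0 → ψ (θ x) = φ x) (h₂ : ∀ y, ψ y ≠ 0 → ∃ x, θ x = y ∧ φ x ≠ 0)
    (h₃ : ∀ x x', φ x ≠ 0 → φ x' ≠ 0 → θ x = θ x' → x = x') :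
    integral φ = integral ψ := by
  classical
  -- The function φ placed on the graph of θ. Integrating over y first gives φ(x), integrating over
  -- x first gives ψ(y), and Fubini compares the two.
  have hK : Inv₂ A (fun x y => if y = θ x then φ x else 0) := fun g hg x y => by
    simp only [hθ g hg, hφ g hg, smul_left_cancel_iff]
  have h := integral_swap hK
  have e₁ : ∀ x, integral (fun y => if y = θ x then φ x else 0) = φ x := fun x =>
    integral_delta (θ x) (fun _ => φ x)
  have e₂ : ∀ y, integral (fun x => if y = θ x then φ x else 0) = ψ y := by
    intro y
    by_cases hy : ψ y = 0
    · rw [hy]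
      refine Eq.trans ?_ (integral_zero (X := X))
      congr 1
      funext x
      split_ifs with hx
      · by_contra hne
        exact hne (by rw [← h₁ x hne, ← hx, hy])
      · rfl
    · obtain ⟨x₀, rfl, hx₀⟩ := h₂ y hy
      rw [h₁ x₀ hx₀, ← integral_delta x₀ φ]
      congr 1
      funext x
      by_cases hx : x = x₀
      · simp [hx]
      · rw [if_neg hx]
        split_ifs with hx'
        · by_contra hne
          exact hx (h₃ x x₀ hne hx₀ hx'.symm)
        · rfl
  simp only [e₁, e₂] at h
  exact h

theorem isSchwartz_sum {ι : Type*} (s : Finset ι) (f : ι → X → k) (hf : ∀ i ∈ s, IsSchwartz (f i)) :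
    IsSchwartz (fun x => ∑ i ∈ s, f i x) := by
  have := (Schwartz k X).sum_mem (t := s) (f := f) hf
  have h2 : (∑ i ∈ s, f i) = fun x => ∑ i ∈ s, f i x := by
    funext x; simp
  rw [h2] at this
  exact this

theorem integral_sum {ι : Type*} (s : Finset ι) (f : ι → X → k) (hf : ∀ i ∈ s, IsSchwartz (f i)) :
    integral (fun x => ∑ i ∈ s, f i x) = ∑ i ∈ s, integral (f i) := by
  classical
  induction s using Finset.induction_on with
  | empty => simpa using integral_zero
  | insert a s ha ih =>
    have h1 := hf a (Finset.mem_insert_self _ _)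
    have h2 : ∀ i ∈ s, IsSchwartz (f i) := fun i hi => hf i (Finset.mem_insert_of_mem hi)
    simp only [Finset.sum_insert ha]
    rw [integral_add h1 (isSchwartz_sum s f h2), ih h2]

/-- A half-open interval, possibly unbounded on its open side, has volume `0`. -/
theorem integral_Ico (a : ℝ) (B : Finset ℝ) (c : k) (f : ℝ → k)
    (hf : ∀ t, (a ≤ t ∧ ∀ b ∈ B, t < b) → f t = c)
    (hf' : ∀ t, ¬ (a ≤ t ∧ ∀ b ∈ B, t < b) → f t = 0) : integral f = 0 := by
  classical
  by_cases hB : ∃ b ∈ B, b ≤ a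
  · obtain ⟨b, hb, hba⟩ := hB
    rw [← integral_zero (X := ℝ)]
    congr 1
    funext t
    exact hf' t fun h => absurd (h.2 b hb) (not_lt.2 (hba.trans h.1))
  push Not at hB
  obtain ⟨p, hap, hp⟩ : ∃ p, a < p ∧ ∀ b ∈ B, p < b := by
    rcases B.eq_empty_or_nonempty with rfl | hne
    · exact ⟨a + 1, by linarith, by simp⟩
    · obtain ⟨p, h1, h2⟩ := exists_between (hB _ (B.min'_mem hne))
      exact ⟨p, h1, fun b hb => h2.trans_le (B.min'_le b hb)⟩
  have hpS : p ∉ insert a B := by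
    intro h
    rcases Finset.mem_insert.1 h with h | h
    · exact hap.ne' h
    · exact lt_irrefl _ (hp p h)
  have key : ∀ t, orb (insert a B) t = orb (insert a B) p ↔ a < t ∧ ∀ b ∈ B, t < b := by
    intro t
    rw [orb_line_iff]
    constructor
    · intro h
      exact ⟨(h a (by simp)).1.2 hap, fun b hb => (h b (by simp [hb])).2.2 (hp b hb)⟩
    · rintro ⟨h1, h2⟩ s hs
      rcases Finset.mem_insert.1 hs with rfl | hs
      · exact ⟨iff_of_true h1 hap, iff_of_false h1.le.not_gt hap.le.not_gt⟩
      · exact ⟨iff_of_false (h2 s hs).le.not_gt (hp s hs).le.not_gt, iff_of_true (h2 s hs) (hp s hs)⟩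
  -- The point a has volume 1 and the open interval to its right, which is the orbit of p, has
  -- volume -1, so the two contributions cancel. For empty B the interval is a ray, again of volume
  -- -1.
  have hsum : f = fun t => (if t = a then c else 0) +
      c * (if orb (insert a B) t = orb (insert a B) p then 1 else 0) := by
    funext t
    by_cases ht : t = a
    · subst ht
      rw [hf t ⟨le_rfl, hB⟩, if_pos rfl, if_neg]
      · simp
      · rw [key]; exact fun h => lt_irrefl _ h.1
    · rw [if_neg ht, zero_add]
      by_cases h : a < t ∧ ∀ b ∈ B, t < b
      · rw [if_pos ((key t).2 h), hf t ⟨h.1.le, h.2⟩, mul_one]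
      · rw [if_neg (fun h' => h ((key t).1 h')), mul_zero]
        exact hf' t fun h' => h ⟨lt_of_le_of_ne h'.1 (Ne.symm ht), h'.2⟩
  have s1 : IsSchwartz (fun t : ℝ => if t = a then c else 0) :=
    FixInv.isSchwartz (A := {a}) fun g hg t => by
      have h := hg a (by simp)
      have : g • t = a ↔ t = a := by
        change g t = a ↔ t = a
        conv_lhs => rw [← h]
        exact g.injective.eq_iff
      simp only [this]
  have s2 : IsSchwartz (fun t : ℝ => if orb (insert a B) t = orb (insert a B) p then (1 : k) else 0) :=
    FixInv.isSchwartz (A := insert a B) fun g hg t => by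
      rw [orb_smul hg]
  have s3 : IsSchwartz (fun t : ℝ => c * if orb (insert a B) t = orb (insert a B) p then (1 : k) else 0) :=
    (Schwartz k ℝ).smul_mem c s2
  rw [hsum, integral_add s1 s3, integral_const_mul _ s2, integral_orb, orbitVol_line, if_neg hpS,
    integral_delta a (fun _ => c)]
  simp

/-- The mirror image of `integral_Ico`. -/
theorem integral_Ioc (a : ℝ) (B : Finset ℝ) (c : k) (f : ℝ → k)
    (hf : ∀ t, (t ≤ a ∧ ∀ b ∈ B, b < t) → f t = c)
    (hf' : ∀ t, ¬ (t ≤ a ∧ ∀ b ∈ B, b < t) → f t = 0) : integral f = 0 := by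
  classical
  by_cases hB : ∃ b ∈ B, a ≤ b
  · obtain ⟨b, hb, hba⟩ := hB
    rw [← integral_zero (X := ℝ)]
    congr 1
    funext t
    exact hf' t fun h => absurd (h.2 b hb) (not_lt.2 (h.1.trans hba))
  push Not at hB
  obtain ⟨p, hap, hp⟩ : ∃ p, p < a ∧ ∀ b ∈ B, b < p := by
    rcases B.eq_empty_or_nonempty with rfl | hne
    · exact ⟨a - 1, by linarith, by simp⟩
    · obtain ⟨p, h1, h2⟩ := exists_between (hB _ (B.max'_mem hne))
      exact ⟨p, h2, fun b hb => (B.le_max' b hb).trans_lt h1⟩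
  have hpS : p ∉ insert a B := by
    intro h
    rcases Finset.mem_insert.1 h with h | h
    · exact hap.ne h
    · exact lt_irrefl _ (hp p h)
  have key : ∀ t, orb (insert a B) t = orb (insert a B) p ↔ t < a ∧ ∀ b ∈ B, b < t := by
    intro t
    rw [orb_line_iff]
    constructor
    · intro h
      exact ⟨(h a (by simp)).2.2 hap, fun b hb => (h b (by simp [hb])).1.2 (hp b hb)⟩
    · rintro ⟨h1, h2⟩ s hs
      rcases Finset.mem_insert.1 hs with rfl | hs
      · exact ⟨iff_of_false h1.le.not_gt hap.le.not_gt, iff_of_true h1 hap⟩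
      · exact ⟨iff_of_true (h2 s hs) (hp s hs), iff_of_false (h2 s hs).le.not_gt (hp s hs).le.not_gt⟩
  have hsum : f = fun t => (if t = a then c else 0) +
      c * (if orb (insert a B) t = orb (insert a B) p then 1 else 0) := by
    funext t
    by_cases ht : t = a
    · subst ht
      rw [hf t ⟨le_rfl, hB⟩, if_pos rfl, if_neg]
      · simp
      · rw [key]; exact fun h => lt_irrefl _ h.1
    · rw [if_neg ht, zero_add]
      by_cases h : t < a ∧ ∀ b ∈ B, b < t
      · rw [if_pos ((key t).2 h), hf t ⟨h.1.le, h.2⟩, mul_one]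
      · rw [if_neg (fun h' => h ((key t).1 h')), mul_zero]
        exact hf' t fun h' => h ⟨lt_of_le_of_ne h'.1 ht, h'.2⟩
  have s1 : IsSchwartz (fun t : ℝ => if t = a then c else 0) :=
    FixInv.isSchwartz (A := {a}) fun g hg t => by
      have h := hg a (by simp)
      have : g • t = a ↔ t = a := by
        change g t = a ↔ t = a
        conv_lhs => rw [← h]
        exact g.injective.eq_iff
      simp only [this]
  have s2 : IsSchwartz (fun t : ℝ => if orb (insert a B) t = orb (insert a B) p then (1 : k) else 0) :=
    FixInv.isSchwartz (A := insert a B) fun g hg t => by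
      rw [orb_smul hg]
  have s3 : IsSchwartz (fun t : ℝ => c * if orb (insert a B) t = orb (insert a B) p then (1 : k) else 0) :=
    (Schwartz k ℝ).smul_mem c s2
  rw [hsum, integral_add s1 s3, integral_const_mul _ s2, integral_orb, orbitVol_line, if_neg hpS,
    integral_delta a (fun _ => c)]
  simp

/-- Functoriality of push-forward: in the product of the two graph matrices the integral over Y
meets only the point f x. -/
theorem pushforward_mulVec_comp {Z : Type} [MulAction G Z] [FinitaryGSet Z] {f : X → Y} {g : Y → Z}
    (hf : ∀ (a : G) x, f (a • x) = a • f x) (hg : ∀ (a : G) y, g (a • y) = a • g y)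
    {φ : X → k} (hφ : IsSchwartz φ) :
    mulVec (graphMat k g) (mulVec (graphMat k f) φ) = mulVec (graphMat k (g ∘ f)) φ := by
  classical
  rw [mulVec_mulVec (graphMat_gInv hg) (graphMat_gInv hf) hφ]
  congr 1
  funext z x
  unfold matMul graphMat
  refine Eq.trans ?_ (integral_delta (f x) (fun y => if g y = z then (1 : k) else 0))
  congr 1
  funext y
  by_cases hy : y = f x
  · simp [hy]
  · simp [hy, Ne.symm hy]

end Integration

end Delannoy

namespace Delannoy

/-! ### Surjectivity of `A(G) → 𝒞(G/V)` -/

section Lift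

variable {k : Type u} [CommRing k]

/-- The base point of `G/V`. -/
def base (V : OpenSub) : G ⧸ V.1 := QuotientGroup.mk 1

theorem smul_base (V : OpenSub) (g : G) : g • base V = (QuotientGroup.mk g : G ⧸ V.1) := by
  change (QuotientGroup.mk (g * 1) : G ⧸ V.1) = _
  rw [mul_one]

theorem smul_base_eq_iff {V : OpenSub} {g : G} : g • base V = base V ↔ g ∈ V.1 := by
  rw [smul_base]
  unfold base
  rw [eq_comm, QuotientGroup.eq]
  simp

theorem fix_supp_base (V : OpenSub) : fix (supp (base V)) = V.1 := by
  ext g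
  rw [mem_fix_supp, smul_base_eq_iff]

/-- The sign `(-1)^n` where `V = G(A)` with `|A| = n`. -/
noncomputable def sgn (V : OpenSub) : ℤ := (-1) ^ (supp (base V)).card

theorem sgn_mul_self (V : OpenSub) : sgn V * sgn V = 1 := by
  unfold sgn
  rw [← pow_add]
  exact Even.neg_one_pow ⟨_, rfl⟩

/-- Intersection of open subgroups. -/
def OpenSub.inter (U V : OpenSub) : OpenSub :=
  ⟨U.1 ⊓ V.1, by
    classical
    obtain ⟨A, hA⟩ := U.2
    obtain ⟨B, hB⟩ := V.2
    exact ⟨A ∪ B, by rw [fix_union]; exact inf_le_inf hA hB⟩⟩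

/-- The fibre over the base coset is the V-orbit of the base coset of G/W. With V = G(A), W = G(B)
and A ⊆ B its volume is (-1)^|B \ A|, the product of the two signs. The other fibres are translates
of this one. -/
theorem integral_quotient_fibre {V W : OpenSub} (h : W.1 ≤ V.1) (q : G ⧸ V.1) :
    integral (fun q' => graphMat k (Subgroup.quotientMapOfLE h) q q') =
      ((sgn W * sgn V : ℤ) : k) := by
  classical
  induction q using Quotient.inductionOn with | _ g => ?_
  have hinv := graphMat_gInv (k := k) (quotientMap_smul h)
  have h1 : (fun q' => graphMat k (Subgroup.quotientMapOfLE h) (QuotientGroup.mk g) q') =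
      fun q' => (graphMat k (Subgroup.quotientMapOfLE h) (base V)) (g⁻¹ • q') := by
    funext q'
    rw [← hinv g⁻¹, ← smul_base, inv_smul_smul]
  change integral (fun q' => graphMat k (Subgroup.quotientMapOfLE h) (QuotientGroup.mk g) q') = _
  rw [h1, integral_translate (hinv.isSchwartz _)]
  have hsub : supp (base V) ⊆ supp (base W) := by
    rw [← fix_le_fix, fix_supp_base, fix_supp_base]
    exact h
  have h2 : graphMat k (Subgroup.quotientMapOfLE h) (base V) = fun q' =>
      if orb (supp (base V)) q' = orb (supp (base V)) (base W) then 1 else 0 := by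
    funext q'
    unfold graphMat
    suffices h0 : Subgroup.quotientMapOfLE h q' = base V ↔
        orb (supp (base V)) q' = orb (supp (base V)) (base W) by
      by_cases h' : Subgroup.quotientMapOfLE h q' = base V
      · rw [if_pos h', if_pos (h0.1 h')]
      · rw [if_neg h', if_neg (fun h'' => h' (h0.2 h''))]
    induction q' using Quotient.inductionOn with | _ l => ?_
    rw [orb_eq_iff, fix_supp_base]
    constructor
    · intro h3
      refine ⟨l, smul_base_eq_iff.1 ?_, smul_base W l⟩
      rw [smul_base]
      exact h3
    · rintro ⟨g', hg', h3⟩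
      change _ = (QuotientGroup.mk l : G ⧸ W.1) at h3
      change Subgroup.quotientMapOfLE h (QuotientGroup.mk l) = _
      rw [← h3, quotientMap_smul]
      exact smul_base_eq_iff.2 hg'
  rw [h2, integral_orb]
  congr 1
  unfold orbitVol sgn
  have hc := Finset.card_sdiff_add_card_eq_card hsub
  rw [← hc, pow_add, mul_assoc, ← mul_pow]
  simp

/-- Projection formula: a function pulled back from G/V is constant on fibres and leaves the fibre
integral, so only the volume of the fibre remains. As that volume is a sign, pulling back gives a
section of push-forward up to sign. -/
theorem push_pull {V W : OpenSub} (h : W.1 ≤ V.1) {ψ : G ⧸ V.1 → k} :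
    mulVec (graphMat k (Subgroup.quotientMapOfLE h)) (fun q' => ψ (Subgroup.quotientMapOfLE h q')) =
      ((sgn W * sgn V : ℤ) : k) • ψ := by
  classical
  funext q
  have h1 : (fun q' => graphMat k (Subgroup.quotientMapOfLE h) q q' *
      ψ (Subgroup.quotientMapOfLE h q')) =
      fun q' => graphMat k (Subgroup.quotientMapOfLE h) q q' * ψ q := by
    funext q'
    unfold graphMat
    split_ifs with h2
    · rw [h2]
    · simp
  unfold mulVec
  rw [h1, integral_mul_const _ ((graphMat_gInv (quotientMap_smul h)).isSchwartz _),
    integral_quotient_fibre]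
  rfl

theorem isSchwartz_comp {X Y : Type} [MulAction G X] [MulAction G Y] [FinitaryGSet X]
    [FinitaryGSet Y] {f : X → Y} (hf : ∀ (g : G) x, f (g • x) = g • f x) {ψ : Y → k}
    (hψ : IsSchwartz ψ) : IsSchwartz (fun x => ψ (f x)) := by
  obtain ⟨A, hA⟩ := hψ.exists_inv
  exact FixInv.isSchwartz (A := A) fun g hg x => by rw [hf, hA g hg]

/-- Every Schwartz function on `G/V` is the component of an element of `A(G)`. -/
theorem exists_comp_eq (V : OpenSub) {ψ : G ⧸ V.1 → k} (hψ : IsSchwartz ψ) :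
    ∃ a : CompletedGroupAlgebra k, a.comp V = ψ := by
  have hl : ∀ U : OpenSub, (U.inter V).1 ≤ U.1 := fun U => inf_le_left
  have hr : ∀ U : OpenSub, (U.inter V).1 ≤ V.1 := fun U => inf_le_right
  let f : ∀ U : OpenSub, G ⧸ (U.inter V).1 → k := fun U q =>
    ψ (Subgroup.quotientMapOfLE (hr U) q)
  have hf : ∀ U, IsSchwartz (f U) := fun U => isSchwartz_comp (quotientMap_smul (hr U)) hψ
  -- The component at U is built by pulling ψ back to G/(U ∩ V), dividing by the volume of the
  -- fibres of G/(U ∩ V) → G/V, and pushing forward to G/U. That volume is the sign c U, its own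
  -- inverse.
  let c : OpenSub → k := fun U => ((sgn (U.inter V) * sgn V : ℤ) : k)
  have hc : ∀ U, IsSchwartz (c U • f U) := fun U => (Schwartz k _).smul_mem _ (hf U)
  let a : ∀ U : OpenSub, G ⧸ U.1 → k := fun U =>
    mulVec (graphMat k (Subgroup.quotientMapOfLE (hl U))) (c U • f U)
  have ha : ∀ U, IsSchwartz (a U) := fun U =>
    mulVec_isSchwartz (graphMat_gInv (quotientMap_smul (hl U))) (hc U)
  refine ⟨⟨fun U => ⟨a U, ha U⟩, ?_⟩, ?_⟩
  · intro U W h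
    change a U = pushforward _ (a W)
    have hWU : (W.inter V).1 ≤ (U.inter V).1 := inf_le_inf_right _ h
    -- Compatibility already holds between the groups W ∩ V and U ∩ V: the fibre sign from
    -- `push_pull` turns c W into c U. Functoriality of push-forward then gives it for W and U.
    have e1 : mulVec (graphMat k (Subgroup.quotientMapOfLE hWU)) (c W • f W) = c U • f U := by
      rw [mulVec_const_smul (graphMat_gInv (quotientMap_smul hWU)) _ (hf W)]
      have : f W = fun q' => f U (Subgroup.quotientMapOfLE hWU q') := by
        funext q'
        induction q' using Quotient.inductionOn with | _ l => rfl
      rw [this, push_pull hWU, smul_smul]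
      congr 1
      simp only [c]
      rw [← Int.cast_mul]
      congr 1
      calc sgn (W.inter V) * sgn V * (sgn (W.inter V) * sgn (U.inter V))
          = (sgn (W.inter V) * sgn (W.inter V)) * (sgn (U.inter V) * sgn V) := by ring
        _ = _ := by rw [sgn_mul_self, one_mul]
    rw [pushforward_eq]
    change mulVec (graphMat k (Subgroup.quotientMapOfLE (hl U))) (c U • f U) =
      mulVec _ (mulVec (graphMat k (Subgroup.quotientMapOfLE (hl W))) (c W • f W))
    rw [← e1, pushforward_mulVec_comp (quotientMap_smul _) (quotientMap_smul _) (hc W),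
      pushforward_mulVec_comp (quotientMap_smul _) (quotientMap_smul _) (hc W)]
    congr 2
    funext q'
    induction q' using Quotient.inductionOn with | _ l => rfl
  · change mulVec (graphMat k (Subgroup.quotientMapOfLE (hl V))) (c V • f V) = ψ
    have : f V = fun q' => ψ (Subgroup.quotientMapOfLE (hl V) q') := rfl
    rw [mulVec_const_smul (graphMat_gInv (quotientMap_smul (hl V))) _ (hf V), this,
      push_pull (hl V), smul_smul]
    simp only [c]
    rw [← Int.cast_mul, show sgn (V.inter V) * sgn V * (sgn (V.inter V) * sgn V) =
      (sgn (V.inter V) * sgn (V.inter V)) * (sgn V * sgn V) by ring, sgn_mul_self, sgn_mul_self]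
    simp

end Lift

/-! ### Schwartz spaces as modules generated by point masses -/

section Generation

variable {k : Type u} [CommRing k] {X Y : Type} [MulAction G X] [MulAction G Y] [FinitaryGSet X]
  [FinitaryGSet Y]

theorem coe_smul_schwartz (a : CompletedGroupAlgebra k) (φ : Schwartz k X) :
    ((a • φ : Schwartz k X) : X → k) = act a φ.1 := rfl

/-- The stabilizer of a point, as an open subgroup. -/
def stab (x : X) : OpenSub := ⟨MulAction.stabilizer G x, FinitaryGSet.smooth x⟩

/-- The point mass at `x`. -/
noncomputable def pointMass (k : Type u) [CommRing k] (x : X) : Schwartz k X :=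
  ⟨fun y => idMat X k y x, (idMat_gInv.swap).isSchwartz x⟩

theorem pointMass_invSub (x : X) : InvSub (stab x).1 (pointMass k x).1 := by
  intro g hg y
  change idMat X k (g • y) x = idMat X k y x
  conv_lhs => rw [← MulAction.mem_stabilizer_iff.1 hg]
  exact idMat_gInv g y x

/-- On V-invariant functions a acts through its component at V alone, and convolution with the point
mass at gV is translation by g. -/
theorem act_of_comp_eq_delta (a : CompletedGroupAlgebra k) {V : OpenSub} {φ : X → k}
    (hφ : InvSub V.1 φ) {g : G}
    (ha : a.comp V = fun q => idMat (G ⧸ V.1) k q (QuotientGroup.mk g)) (x : X) :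
    act a φ x = φ (g⁻¹ • x) := by
  rw [act_eq a hφ, ha, ← transMat_mk hφ]
  exact congrFun (congrFun (matMul_idMat (transMat V φ)) x) _

/-- For finitely many functions, translation by a group element is the action of an element
of `A(G)`. -/
theorem exists_act_eq_translate (g : G) (V : OpenSub) : ∃ a : CompletedGroupAlgebra k,
    ∀ (X : Type) [MulAction G X] [FinitaryGSet X] (φ : X → k), InvSub V.1 φ →
      ∀ x, act a φ x = φ (g⁻¹ • x) := by
  obtain ⟨a, ha⟩ := exists_comp_eq V (k := k)
    (ψ := fun q => idMat (G ⧸ V.1) k q (QuotientGroup.mk g)) (idMat_gInv.swap.isSchwartz _)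
  exact ⟨a, fun X _ _ φ hφ x => act_of_comp_eq_delta a hφ ha x⟩

/-- In the convolution integral only the coset of g contributes, so a • δ_x, restricted to the orbit
of x, is the component of a at the stabilizer of x. In particular a • δ_x = 0 forces this component
to vanish. -/
theorem act_pointMass (a : CompletedGroupAlgebra k) (x : X) (g : G) :
    act a (pointMass k x).1 (g • x) = a.comp (stab x) (QuotientGroup.mk g) := by
  classical
  rw [act_eq a (pointMass_invSub x), ← integral_delta (QuotientGroup.mk g) (a.comp (stab x))]
  unfold mulVec
  congr 1
  funext q
  induction q using Quotient.inductionOn with | _ l => ?_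
  change transMat (stab x) _ (g • x) (QuotientGroup.mk l) * a.comp (stab x) (QuotientGroup.mk l) = _
  rw [transMat_mk (pointMass_invSub x)]
  change idMat X k (l⁻¹ • g • x) x * _ = if (QuotientGroup.mk l : G ⧸ (stab x).1) = _ then _ else _
  have : l⁻¹ • g • x = x ↔ (QuotientGroup.mk l : G ⧸ (stab x).1) = QuotientGroup.mk g := by
    rw [QuotientGroup.eq, ← mul_smul]
    exact MulAction.mem_stabilizer_iff.symm
  unfold idMat
  by_cases h : l⁻¹ • g • x = x
  · rw [if_pos h, if_pos (this.1 h), one_mul]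
  · rw [if_neg h, if_neg (fun h' => h (this.2 h')), zero_mul]

theorem act_pointMass_of_notMem (a : CompletedGroupAlgebra k) {x y : X}
    (h : ∀ g : G, g • x ≠ y) : act a (pointMass k x).1 y = 0 := by
  rw [act_eq a (pointMass_invSub x)]
  unfold mulVec
  refine Eq.trans ?_ (integral_zero (X := G ⧸ (stab x).1))
  congr 1
  funext q
  unfold transMat
  change idMat X k _ x * _ = _
  unfold idMat
  rw [if_neg, zero_mul]
  intro h'
  exact h q.out (inv_smul_eq_iff.1 h').symm

/-- A Schwartz function supported on the orbit of `x` is a multiple of the point mass at `x`. -/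
theorem exists_smul_pointMass (x : X) (φ : Schwartz k X)
    (h : ∀ y, (∀ g : G, g • x ≠ y) → φ.1 y = 0) :
    ∃ a : CompletedGroupAlgebra k, a • pointMass k x = φ := by
  -- The orbit map of x. By `act_pointMass`, an element of A(G) whose component at the stabilizer is
  -- φ pulled back along this map sends the point mass at x to φ.
  let o : G ⧸ (stab x).1 → X := Quotient.lift (fun g => g • x) fun g g' hg => by
    have hg : g⁻¹ * g' ∈ MulAction.stabilizer G x := QuotientGroup.leftRel_apply.1 hg
    rw [MulAction.mem_stabilizer_iff, mul_smul, inv_smul_eq_iff] at hg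
    exact hg.symm
  have ho : ∀ (g : G) q, o (g • q) = g • o q := by
    intro g q
    induction q using Quotient.inductionOn with | _ l => exact mul_smul g l x
  obtain ⟨a, ha⟩ := exists_comp_eq (stab x) (isSchwartz_comp ho φ.2)
  refine ⟨a, Subtype.ext (funext fun y => ?_)⟩
  rw [coe_smul_schwartz]
  by_cases hy : ∃ g : G, g • x = y
  · obtain ⟨g, rfl⟩ := hy
    rw [act_pointMass, ha]
    rfl
  · push Not at hy
    rw [act_pointMass_of_notMem a hy, h y hy]

/-- A Schwartz function is the sum of its restrictions to the finitely many G-orbits, and each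
restriction is a multiple of the point mass at the chosen representative. -/
theorem span_pointMass :
    Submodule.span (CompletedGroupAlgebra k)
      (Set.range fun O : MulAction.orbitRel.Quotient G X => pointMass k O.out) = ⊤ := by
  classical
  have : Finite (MulAction.orbitRel.Quotient G X) := FinitaryGSet.finitary
  have := Fintype.ofFinite (MulAction.orbitRel.Quotient G X)
  rw [eq_top_iff]
  rintro φ -
  let cls : X → MulAction.orbitRel.Quotient G X := Quotient.mk _
  have hcls : ∀ (g : G) x, cls (g • x) = cls x := fun g x =>
    Quotient.sound (MulAction.orbitRel_apply.2 ⟨g, rfl⟩)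
  have hS : ∀ O, IsSchwartz (fun x => if cls x = O then φ.1 x else 0) := by
    intro O
    obtain ⟨A, hA⟩ := IsSchwartz.exists_inv φ.2
    refine FixInv.isSchwartz (A := A) fun g hg x => ?_
    simp only [hcls, hA g hg]
  have hsum : φ = ∑ O, (⟨_, hS O⟩ : Schwartz k X) := by
    apply Subtype.ext
    funext x
    simp [Finset.sum_apply]
  rw [hsum]
  refine Submodule.sum_mem _ fun O _ => ?_
  obtain ⟨a, ha⟩ := exists_smul_pointMass O.out (⟨_, hS O⟩ : Schwartz k X) (by
    intro y hy
    refine if_neg fun h => ?_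
    have h2 : cls O.out = cls y := by rw [h]; exact Quotient.out_eq O
    obtain ⟨g, hg⟩ := MulAction.orbitRel_apply.1 (Quotient.exact h2)
    exact hy g⁻¹ (by rw [← hg, inv_smul_smul]))
  rw [← ha]
  exact Submodule.smul_mem _ _ (Submodule.subset_span ⟨O, rfl⟩)

instance finite_schwartz : Module.Finite (CompletedGroupAlgebra k) (Schwartz k X) := by
  have : Finite (MulAction.orbitRel.Quotient G X) := FinitaryGSet.finitary
  refine ⟨?_⟩
  rw [← span_pointMass]
  exact Submodule.fg_span (Set.finite_range _)

/-- The kernel of an `A(G)`-linear operator. -/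
theorem exists_kernel (f : Schwartz k X →ₗ[CompletedGroupAlgebra k] Schwartz k Y) :
    ∃ K : Y → X → k, GInv K ∧ ∀ φ : Schwartz k X, (f φ).1 = mulVec K φ.1 := by
  -- The column of the kernel at x has to be f(δ_x). It is equivariant in x because a single element
  -- of A(G) translates both δ_x and f(δ_x) by g, and f commutes with that element.
  have hK : GInv (fun (y : Y) (x : X) => (f (pointMass k x)).1 y) := by
    intro g y x
    obtain ⟨V, hV⟩ := IsSchwartz.exists_invSub (f (pointMass k x)).2
    obtain ⟨a, ha⟩ := exists_act_eq_translate (k := k) g ((stab x).inter V)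
    have h1 : a • pointMass k x = pointMass k (g • x) := by
      apply Subtype.ext
      funext z
      rw [coe_smul_schwartz, ha X _ ((pointMass_invSub x).mono inf_le_left)]
      change idMat X k (g⁻¹ • z) x = idMat X k z (g • x)
      rw [← idMat_gInv g, smul_inv_smul]
    change (f (pointMass k (g • x))).1 (g • y) = (f (pointMass k x)).1 y
    rw [← h1, map_smul, coe_smul_schwartz, ha Y _ (hV.mono inf_le_right), inv_smul_smul]
  refine ⟨_, hK, fun φ => ?_⟩
  have hφ : φ ∈ Submodule.span (CompletedGroupAlgebra k)
      (Set.range fun O : MulAction.orbitRel.Quotient G X => pointMass k O.out) := by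
    rw [span_pointMass]; trivial
  induction hφ using Submodule.span_induction with
  | mem φ h =>
    obtain ⟨O, rfl⟩ := h
    funext y
    exact (congrFun (congrFun (matMul_idMat (fun (y : Y) (x : X) => (f (pointMass k x)).1 y)) y)
      O.out).symm
  | zero =>
    rw [map_zero]
    have := mulVec_const_smul hK 0 (0 : Schwartz k X).2
    rw [zero_smul, zero_smul] at this
    exact this.symm
  | add φ ψ _ _ h1 h2 =>
    rw [map_add]
    exact (congrArg₂ (· + ·) h1 h2).trans (mulVec_add hK φ.2 ψ.2).symm
  | smul a φ _ h =>
    rw [map_smul, coe_smul_schwartz, h, coe_smul_schwartz, act_mulVec a hK φ.2]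

/-- The columns of a matrix are its values on point masses, so an operator determines its kernel. -/
theorem kernel_ext {K L : Y → X → k}
    (h : ∀ φ : Schwartz k X, mulVec K φ.1 = mulVec L φ.1) : K = L := by
  funext y x
  have h1 := congrFun (congrFun (matMul_idMat K) y) x
  have h2 := congrFun (congrFun (matMul_idMat L) y) x
  rw [← h1, ← h2]
  exact congrFun (h (pointMass k x)) y

end Generation

/-! ### Permutation modules as a full subcategory of the smooth modules -/

section PermToRep

variable (k : Type u) [CommRing k]

instance : (permToRep k).Full where
  map_surjective {X Y} f := by
    obtain ⟨K, hK, h⟩ := exists_kernel (X := X.carrier) (Y := Y.carrier) f.hom.hom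
    refine ⟨matOf K hK, ?_⟩
    ext φ
    exact Subtype.ext (h φ).symm

instance : (permToRep k).Faithful where
  map_injective {X Y A B} h := by
    apply mat_ext
    apply kernel_ext
    intro φ
    have := congrArg (fun f => (f.hom.hom φ : Schwartz k Y.carrier).1) h
    exact this

instance : (permToRep k).Additive where
  map_add {X Y A B} := by
    ext φ
    exact Subtype.ext (add_mulVec (entry_gInv A) (entry_gInv B) φ.2)

end PermToRep

end Delannoy

namespace Delannoy

/-! ### The sets `ℝ^(n)` -/

section RTuple

variable {n : ℕ}

/-- The tuple with given entries. -/
def RTuple.of (f : Fin n → ℝ) (hf : StrictMono f) : RTuple n := ⟨f, hf⟩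

theorem RTuple.ext {x y : RTuple n} (h : ∀ i, x.1 i = y.1 i) : x = y := Subtype.ext (funext h)

theorem RTuple.ext_iff {x y : RTuple n} : x = y ↔ ∀ i, x.1 i = y.1 i :=
  ⟨fun h _ => h ▸ rfl, RTuple.ext⟩

theorem exists_smul_rtuple_eq (x y : RTuple n) : ∃ g : G, g • x = y := by
  classical
  have hf : ∀ i, (Function.extend x.1 y.1 0) (x.1 i) = y.1 i :=
    fun i => x.2.injective.extend_apply _ _ i
  obtain ⟨g, hg⟩ := exists_ext (Finset.univ.image x.1) (Function.extend x.1 y.1 0) (by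
    intro s hs t ht hst
    simp only [Finset.coe_image, Finset.coe_univ, Set.image_univ, Set.mem_range] at hs ht
    obtain ⟨i, rfl⟩ := hs
    obtain ⟨j, rfl⟩ := ht
    rw [hf, hf]
    exact y.2 (x.2.lt_iff_lt.1 hst))
  refine ⟨g, Subtype.ext (funext fun i => ?_)⟩
  change g (x.1 i) = y.1 i
  rw [hg _ (Finset.mem_image_of_mem _ (Finset.mem_univ i)), hf]

theorem smul_rtuple_apply (g : G) (x : RTuple n) (i : Fin n) : (g • x).1 i = g (x.1 i) := rfl

theorem supp_rtuple (x : RTuple n) : supp x = Finset.univ.image x.1 := by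
  apply supp_eq_of
  intro g
  rw [mem_fix, RTuple.ext_iff]
  simp [smul_rtuple_apply]

theorem coe_supp_rtuple (x : RTuple n) : (supp x : Set ℝ) = Set.range x.1 := by
  rw [supp_rtuple]; simp

theorem mem_supp_rtuple {x : RTuple n} {t : ℝ} : t ∈ supp x ↔ ∃ i, x.1 i = t := by
  rw [← Finset.mem_coe, coe_supp_rtuple]; rfl

theorem card_supp_rtuple (x : RTuple n) : (supp x).card = n := by
  rw [supp_rtuple, Finset.card_image_of_injective _ x.2.injective, Finset.card_univ, Fintype.card_fin]

theorem supp_rtuple_injective : Function.Injective (supp : RTuple n → Finset ℝ) := by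
  intro x y h
  apply Subtype.ext
  rw [← StrictMono.range_inj x.2 y.2, ← coe_supp_rtuple, ← coe_supp_rtuple, h]

theorem exists_supp_rtuple_eq {S : Finset ℝ} (h : S.card = n) : ∃ x : RTuple n, supp x = S := by
  refine ⟨RTuple.of (S.orderEmbOfFin h) (S.orderEmbOfFin h).strictMono, ?_⟩
  apply Finset.coe_injective
  rw [coe_supp_rtuple]
  exact S.range_orderEmbOfFin h

end RTuple

/-! ### The path of a family of finite sets -/

section Typ

variable {ι κ : Type} [Fintype ι] [Fintype κ]

open Classical in
/-- The union of a finite family of finite sets. -/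
noncomputable def allPts (S : ι → Finset ℝ) : Finset ℝ := Finset.univ.biUnion S

theorem mem_allPts {S : ι → Finset ℝ} {t : ℝ} : t ∈ allPts S ↔ ∃ i, t ∈ S i := by
  simp [allPts]

open Classical in
/-- The vector which records the sets containing `t`. -/
noncomputable def indic (S : ι → Finset ℝ) (t : ℝ) (i : ι) : ℕ := if t ∈ S i then 1 else 0

/-- The steps of the path which records the relative position of the sets `S i`. -/
noncomputable def typ (S : ι → Finset ℝ) : List (ι → ℕ) := ((allPts S).sort (· ≤ ·)).map (indic S)

theorem length_typ (S : ι → Finset ℝ) : (typ S).length = (allPts S).card := by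
  simp [typ]

theorem indic_ne_zero {S : ι → Finset ℝ} {t : ℝ} : indic S t ≠ 0 ↔ t ∈ allPts S := by
  rw [Function.ne_iff, mem_allPts]
  simp [indic]

theorem typ_ne_zero (S : ι → Finset ℝ) : ∀ v ∈ typ S, v ≠ 0 := by
  intro v hv
  obtain ⟨t, ht, rfl⟩ := List.mem_map.1 hv
  exact indic_ne_zero.2 ((Finset.mem_sort _).1 ht)

theorem typ_zero_one (S : ι → Finset ℝ) : ∀ v ∈ typ S, ∀ i, v i = 0 ∨ v i = 1 := by
  intro v hv i
  obtain ⟨t, ht, rfl⟩ := List.mem_map.1 hv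
  unfold indic
  split_ifs <;> simp

theorem sum_typ (S : ι → Finset ℝ) : (typ S).sum = fun i => (S i).card := by
  classical
  have h : (typ S).sum = ∑ t ∈ allPts S, indic S t := by
    have := List.sum_toFinset (indic S) (Finset.sort_nodup (allPts S) (· ≤ ·))
    rw [Finset.sort_toFinset] at this
    exact this.symm
  rw [h]
  funext i
  rw [Finset.sum_apply]
  unfold indic
  rw [← Finset.sum_filter, Finset.sum_const, smul_eq_mul, mul_one]
  congr 1
  ext t
  simp only [Finset.mem_filter, mem_allPts]
  exact ⟨fun h => h.2, fun h => ⟨⟨i, h⟩, h⟩⟩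

/-- The points lost on passing to the family S ∘ e are those lying in none of its sets, and these
are exactly the points whose vector becomes zero. This is why projecting a path corresponds to
forgetting some of the sets. -/
theorem typ_comp (S : ι → Finset ℝ) (e : κ → ι) [DecidableEq (κ → ℕ)] :
    ((typ S).map (· ∘ e)).filter (· ≠ 0) = typ (S ∘ e) := by
  classical
  have h1 : (allPts (S ∘ e)).sort (· ≤ ·) =
      ((allPts S).sort (· ≤ ·)).filter (fun t => t ∈ allPts (S ∘ e)) := by
    have hnd : (((allPts S).sort (· ≤ ·)).filter (fun t => t ∈ allPts (S ∘ e))).Nodup :=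
      (Finset.sort_nodup _ _).filter _
    rw [← (List.toFinset_sort (· ≤ ·) hnd).2 ((Finset.pairwise_sort _ _).filter _)]
    congr 1
    ext t
    simp only [List.mem_toFinset, List.mem_filter, Finset.mem_sort, decide_eq_true_eq, mem_allPts,
      Function.comp_apply]
    exact ⟨fun ⟨j, hj⟩ => ⟨⟨_, hj⟩, j, hj⟩, fun h => h.2⟩
  unfold typ
  rw [h1, List.map_map, List.filter_map]
  congr 1
  apply List.filter_congr
  intro t _
  have : ((fun v : ι → ℕ => v ∘ e) ∘ indic S) t = indic (S ∘ e) t := rfl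
  simp only [Function.comp_apply]
  rw [decide_eq_decide]
  exact indic_ne_zero (S := S ∘ e)

/-- A path is the path of the sets `S i` if and only if there are points `w_r`, one for each step,
such that `S i` consists of the `w_r` for which the `r`-th step involves `i`. -/
theorem typ_eq_iff {S : ι → Finset ℝ} {L : List (ι → ℕ)} (h0 : ∀ v ∈ L, v ≠ 0)
    (h1 : ∀ v ∈ L, ∀ i, v i = 0 ∨ v i = 1) :
    typ S = L ↔ ∃ w : RTuple L.length, ∀ i, (S i : Set ℝ) = w.1 '' {r | (L.get r) i = 1} := by
  classical
  constructor
  · rintro rfl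
    have hlen : (typ S).length = ((allPts S).sort (· ≤ ·)).length := by simp [typ]
    refine ⟨⟨fun r => ((allPts S).sort (· ≤ ·)).get (r.cast hlen), ?_⟩, fun i => ?_⟩
    · intro a b hab
      exact (Finset.sortedLT_sort _).strictMono_get (by simpa using hab)
    · have hget : ∀ r : Fin (typ S).length, (typ S).get r =
          indic S (((allPts S).sort (· ≤ ·)).get (r.cast hlen)) := by
        intro r
        exact List.getElem_map _
      ext t
      simp only [Finset.mem_coe, Set.mem_image, Set.mem_ofPred_eq, hget]
      constructor
      · intro ht
        have : t ∈ (allPts S).sort (· ≤ ·) := (Finset.mem_sort _).2 (mem_allPts.2 ⟨i, ht⟩)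
        obtain ⟨r, hr⟩ := List.get_of_mem this
        refine ⟨r.cast hlen.symm, ?_, hr⟩
        change indic S (((allPts S).sort (· ≤ ·)).get r) i = 1
        rw [hr]
        simp [indic, ht]
      · rintro ⟨r, hr, rfl⟩
        by_contra hc
        unfold indic at hr
        rw [if_neg hc] at hr
        exact absurd hr (by norm_num)
  · rintro ⟨w, hw⟩
    have hmem : ∀ r i, w.1 r ∈ S i ↔ (L.get r) i = 1 := by
      intro r i
      rw [← Finset.mem_coe, hw]
      exact w.2.injective.mem_set_image
    have hsort : (allPts S).sort (· ≤ ·) = List.ofFn w.1 := by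
      have hnd : (List.ofFn w.1).Nodup := List.nodup_ofFn.2 w.2.injective
      rw [← (List.toFinset_sort (· ≤ ·) hnd).2 (List.pairwise_ofFn.2 fun i j hij => (w.2 hij).le)]
      congr 1
      ext t
      rw [List.mem_toFinset, List.mem_ofFn, mem_allPts]
      constructor
      · rintro ⟨i, hi⟩
        rw [← Finset.mem_coe, hw] at hi
        obtain ⟨r, _, hr⟩ := hi
        exact ⟨r, hr⟩
      · rintro ⟨r, rfl⟩
        obtain ⟨i, hi⟩ := Function.ne_iff.1 (h0 _ (L.get_mem r))
        exact ⟨i, (hmem r i).2 ((h1 _ (L.get_mem r) i).resolve_left hi)⟩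
    unfold typ
    rw [hsort, List.map_ofFn]
    conv_rhs => rw [← List.ofFn_get L]
    congr 1
    funext r
    funext i
    simp only [Function.comp_apply, indic, hmem]
    split_ifs with h
    · exact h.symm
    · exact ((h1 _ (L.get_mem r) i).resolve_right h).symm

/-- Families of sets with the same path are conjugate under `G`. -/
theorem exists_image_eq_of_typ {S S' : ι → Finset ℝ} (h : typ S = typ S') :
    ∃ g : G, ∀ i, (S i).image g = S' i := by
  classical
  obtain ⟨w, hw⟩ := (typ_eq_iff (typ_ne_zero S') (typ_zero_one S')).1 h
  obtain ⟨w', hw'⟩ := (typ_eq_iff (typ_ne_zero S') (typ_zero_one S')).1 rfl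
  obtain ⟨g, hg⟩ := exists_smul_rtuple_eq w w'
  refine ⟨g, fun i => Finset.coe_injective ?_⟩
  rw [Finset.coe_image, hw, hw', ← hg, Set.image_image]
  rfl

theorem typ_image (S : ι → Finset ℝ) (g : G) : typ (fun i => (S i).image g) = typ S := by
  classical
  rw [typ_eq_iff (typ_ne_zero S) (typ_zero_one S)]
  obtain ⟨w, hw⟩ := (typ_eq_iff (typ_ne_zero S) (typ_zero_one S)).1 rfl
  refine ⟨g • w, fun i => ?_⟩
  rw [Finset.coe_image, hw, Set.image_image]
  rfl

/-- The path of a family of finite sets. -/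
noncomputable def typPath (S : ι → Finset ℝ) {a : ι → ℕ} (h : ∀ i, (S i).card = a i) : DPath a where
  steps := typ S
  ne_zero := typ_ne_zero S
  zero_one := typ_zero_one S
  sum_eq := by rw [sum_typ]; exact funext h

/-- Every path is the path of some family of sets. -/
theorem exists_typ_eq {a : ι → ℕ} (p : DPath a) :
    ∃ S : ι → Finset ℝ, typ S = p.steps ∧ ∀ i, (S i).card = a i := by
  classical
  let w : RTuple p.steps.length := ⟨fun r => (r : ℝ), fun r s h => by simpa using h⟩
  let S : ι → Finset ℝ := fun i => (Finset.univ.filter fun r => (p.steps.get r) i = 1).image w.1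
  have h : typ S = p.steps := (typ_eq_iff p.ne_zero p.zero_one).2 ⟨w, fun i => by
    simp [S]⟩
  refine ⟨S, h, fun i => ?_⟩
  have := congrFun (sum_typ S) i
  rw [h, p.sum_eq] at this
  exact this.symm

end Typ

/-! ### Uniqueness of lifts -/

/-- At a coordinate i where v and v' differ, at most one of the two entries is zero. A coordinate
where that vector is nonzero then serves as the second one. -/
theorem exists_pair_ne {v v' : Fin 3 → ℕ} (h : v ≠ v') (hv : v ≠ 0) (hv' : v' ≠ 0) :
    ∃ (i j : Fin 3) (hij : i ≠ j), i < j ∧ v ∘ pair i j hij ≠ 0 ∧ v' ∘ pair i j hij ≠ 0 ∧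
      v ∘ pair i j hij ≠ v' ∘ pair i j hij := by
  have key : ∃ i j : Fin 3, i ≠ j ∧ v i ≠ v' i ∧ (v i ≠ 0 ∨ v j ≠ 0) ∧ (v' i ≠ 0 ∨ v' j ≠ 0) := by
    obtain ⟨i, hi⟩ := Function.ne_iff.1 h
    by_cases h1 : v i = 0
    · obtain ⟨j, hj⟩ := Function.ne_iff.1 hv
      have hj : v j ≠ 0 := hj
      exact ⟨i, j, fun e => hj (e ▸ h1), hi, Or.inr hj, Or.inl fun h2 => hi (h1.trans h2.symm)⟩
    · by_cases h2 : v' i = 0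
      · obtain ⟨j, hj⟩ := Function.ne_iff.1 hv'
        have hj : v' j ≠ 0 := hj
        exact ⟨i, j, fun e => hj (e ▸ h2), hi, Or.inl h1, Or.inr hj⟩
      · obtain ⟨j, hj⟩ : ∃ j : Fin 3, i ≠ j := ⟨i + 1, by fin_cases i <;> decide⟩
        exact ⟨i, j, hj, hi, Or.inl h1, Or.inl h2⟩
  obtain ⟨i, j, hij, hi, h1, h2⟩ := key
  rcases lt_or_gt_of_ne hij with hlt | hlt
  · refine ⟨i, j, hij, hlt, fun h0 => ?_, fun h0 => ?_, fun h0 => hi (congrFun h0 0)⟩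
    · exact h1.elim (fun h => h (congrFun h0 0)) (fun h => h (congrFun h0 1))
    · exact h2.elim (fun h => h (congrFun h0 0)) (fun h => h (congrFun h0 1))
  · refine ⟨j, i, hij.symm, hlt, fun h0 => ?_, fun h0 => ?_, fun h0 => hi (congrFun h0 1)⟩
    · exact h1.elim (fun h => h (congrFun h0 1)) (fun h => h (congrFun h0 0))
    · exact h2.elim (fun h => h (congrFun h0 1)) (fun h => h (congrFun h0 0))

/-- If the first steps differ, `exists_pair_ne` supplies two coordinates in which both survive the
deletion of zero vectors and still differ, so the corresponding projections already disagree in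
their first entry. If they agree they can be cancelled. -/
theorem eq_of_proj_eq (L L' : List (Fin 3 → ℕ)) (hL : ∀ v ∈ L, v ≠ 0) (hL' : ∀ v ∈ L', v ≠ 0)
    (h : ∀ (i j : Fin 3) (hij : i ≠ j), i < j →
      (L.map (· ∘ pair i j hij)).filter (· ≠ 0) = (L'.map (· ∘ pair i j hij)).filter (· ≠ 0)) :
    L = L' := by
  have nil : ∀ (v : Fin 3 → ℕ) (L : List (Fin 3 → ℕ)), v ≠ 0 → ¬ ∀ (i j : Fin 3) (hij : i ≠ j), i < j →
      ((v :: L).map (· ∘ pair i j hij)).filter (· ≠ 0) = [] := by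
    intro v L hv h
    -- The all-ones vector is only an auxiliary partner for v: `exists_pair_ne` is applied to the
    -- two to find a pair of coordinates on which v does not vanish.
    have h2 : (1 : Fin 3 → ℕ) ≠ 0 := by simp
    by_cases hv1 : v = 1
    · have := h 0 1 (by decide) (by decide)
      rw [List.filter_eq_nil_iff] at this
      refine this (v ∘ pair 0 1 (by decide)) (by simp) ?_
      simp only [ne_eq, decide_not, Bool.not_eq_true', decide_eq_false_iff_not]
      intro h0
      rw [hv1] at h0
      exact absurd (congrFun h0 0) (by simp)
    · obtain ⟨i, j, hij, hlt, h3, -, -⟩ := exists_pair_ne hv1 hv h2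
      have := h i j hij hlt
      rw [List.filter_eq_nil_iff] at this
      exact this (v ∘ pair i j hij) (by simp) (by simpa using h3)
  induction L generalizing L' with
  | nil =>
    cases L' with
    | nil => rfl
    | cons v L' => exact absurd (fun i j hij hlt => (h i j hij hlt).symm) (nil v L' (hL' v (by simp)))
  | cons v L ih =>
    cases L' with
    | nil => exact absurd h (nil v L (hL v (by simp)))
    | cons v' L' =>
      have hvv : v = v' := by
        by_contra hne
        obtain ⟨i, j, hij, hlt, h1, h2, h3⟩ :=
          exists_pair_ne hne (hL v (by simp)) (hL' v' (by simp))
        have := h i j hij hlt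
        rw [List.map_cons, List.map_cons, List.filter_cons_of_pos (by simpa using h1),
          List.filter_cons_of_pos (by simpa using h2)] at this
        exact h3 (List.cons.inj this).1
      subst hvv
      congr 1
      refine ih L' (fun w hw => hL w (by simp [hw])) (fun w hw => hL' w (by simp [hw])) ?_
      intro i j hij hlt
      have := h i j hij hlt
      rw [List.map_cons, List.map_cons] at this
      by_cases h1 : v ∘ pair i j hij = 0
      · rwa [List.filter_cons_of_neg (by simpa using h1),
          List.filter_cons_of_neg (by simpa using h1)] at this
      · rw [List.filter_cons_of_pos (by simpa using h1),
          List.filter_cons_of_pos (by simpa using h1)] at this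
        exact (List.cons.inj this).2

theorem DPath.proj_steps {ι κ : Type} {a : ι → ℕ} (e : κ ↪ ι) (p : DPath a)
    [inst : DecidableEq (κ → ℕ)] :
    (p.proj e).steps = (p.steps.map (· ∘ e)).filter (· ≠ 0) := by
  unfold DPath.proj
  congr!

theorem IsLift.unique {n m l : ℕ} {p₁ : DPath ![n, m]} {p₂ : DPath ![m, l]} {p₃ : DPath ![n, l]}
    {q q' : DPath ![n, m, l]} (h : IsLift q p₁ p₂ p₃) (h' : IsLift q' p₁ p₂ p₃) : q = q' := by
  apply DPath.ext
  apply eq_of_proj_eq _ _ q.ne_zero q'.ne_zero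
  have e1 := h.1.trans h'.1.symm
  have e2 := h.2.1.trans h'.2.1.symm
  have e3 := h.2.2.trans h'.2.2.symm
  have key : ∀ i j : Fin 3, i < j → i = 0 ∧ j = 1 ∨ i = 1 ∧ j = 2 ∨ i = 0 ∧ j = 2 := by decide
  intro i j hij hlt
  rcases key i j hlt with ⟨rfl, rfl⟩ | ⟨rfl, rfl⟩ | ⟨rfl, rfl⟩
  · rw [DPath.proj_steps, DPath.proj_steps] at e1
    exact e1
  · rw [DPath.proj_steps, DPath.proj_steps] at e2
    exact e2
  · rw [DPath.proj_steps, DPath.proj_steps] at e3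
    exact e3

end Delannoy

namespace Delannoy

/-! ### Paths and orbits -/

section PathOf

variable {n m l : ℕ}

/-- The path of a pair of tuples. -/
noncomputable def pathOf (x : RTuple n) (y : RTuple m) : DPath ![n, m] :=
  typPath ![supp x, supp y] (Fin.forall_fin_two.2 ⟨card_supp_rtuple x, card_supp_rtuple y⟩)

/-- The path of a triple of tuples. -/
noncomputable def pathOf₃ (x : RTuple n) (y : RTuple m) (z : RTuple l) : DPath ![n, m, l] :=
  typPath ![supp x, supp y, supp z] (Fin.forall_fin_succ.2 ⟨card_supp_rtuple x,
    Fin.forall_fin_two.2 ⟨card_supp_rtuple y, card_supp_rtuple z⟩⟩)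

theorem pathOf_steps (x : RTuple n) (y : RTuple m) : (pathOf x y).steps = typ ![supp x, supp y] := rfl

theorem pathOf₃_steps (x : RTuple n) (y : RTuple m) (z : RTuple l) :
    (pathOf₃ x y z).steps = typ ![supp x, supp y, supp z] := rfl

/-- By `typ_eq_iff` the sets O_p are the fibres of `pathOf`, so each pair of tuples lies in exactly
one of them. -/
theorem mem_orbitOf_iff {p : DPath ![n, m]} {x : RTuple n} {y : RTuple m} :
    (x, y) ∈ orbitOf p ↔ pathOf x y = p := by
  rw [DPath.ext_iff, pathOf_steps, typ_eq_iff p.ne_zero p.zero_one]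
  simp only [Fin.forall_fin_two]
  change (∃ w : RTuple p.length, Set.range x.1 = _ ∧ Set.range y.1 = _) ↔
    ∃ w : RTuple p.length, (supp x : Set ℝ) = _ ∧ (supp y : Set ℝ) = _
  rw [coe_supp_rtuple, coe_supp_rtuple]
  exact Iff.rfl

theorem exists_pathOf_eq (p : DPath ![n, m]) : ∃ x y, pathOf x y = p := by
  obtain ⟨S, hS, hc⟩ := exists_typ_eq p
  obtain ⟨x, hx⟩ : ∃ x : RTuple n, supp x = S 0 := exists_supp_rtuple_eq (hc 0)
  obtain ⟨y, hy⟩ : ∃ y : RTuple m, supp y = S 1 := exists_supp_rtuple_eq (hc 1)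
  refine ⟨x, y, DPath.ext ?_⟩
  rw [← hS, pathOf_steps]
  congr 1
  funext i
  fin_cases i
  · exact hx
  · exact hy

theorem exists_pathOf₃_eq (q : DPath ![n, m, l]) : ∃ x y z, pathOf₃ x y z = q := by
  obtain ⟨S, hS, hc⟩ := exists_typ_eq q
  obtain ⟨x, hx⟩ : ∃ x : RTuple n, supp x = S 0 := exists_supp_rtuple_eq (hc 0)
  obtain ⟨y, hy⟩ : ∃ y : RTuple m, supp y = S 1 := exists_supp_rtuple_eq (hc 1)
  obtain ⟨z, hz⟩ : ∃ z : RTuple l, supp z = S 2 := exists_supp_rtuple_eq (hc 2)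
  refine ⟨x, y, z, DPath.ext ?_⟩
  rw [← hS, pathOf₃_steps]
  congr 1
  funext i
  fin_cases i
  · exact hx
  · exact hy
  · exact hz

theorem pathOf_smul (g : G) (x : RTuple n) (y : RTuple m) : pathOf (g • x) (g • y) = pathOf x y := by
  apply DPath.ext
  rw [pathOf_steps, pathOf_steps, ← typ_image ![supp x, supp y] g]
  congr 1
  funext i
  fin_cases i
  · exact supp_smul g x
  · exact supp_smul g y

/-- The path determines the pair of supports up to G, and a tuple is determined by its support. With
`exists_pathOf_eq` this makes paths a classification of orbits. -/
theorem exists_smul_of_pathOf_eq {x x' : RTuple n} {y y' : RTuple m} (h : pathOf x y = pathOf x' y') :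
    ∃ g : G, g • x = x' ∧ g • y = y' := by
  obtain ⟨g, hg⟩ := exists_image_eq_of_typ (congrArg DPath.steps h)
  exact ⟨g, supp_rtuple_injective ((supp_smul g x).trans (hg 0)),
    supp_rtuple_injective ((supp_smul g y).trans (hg 1))⟩

theorem exists_smul_of_pathOf₃_eq {x x' : RTuple n} {y y' : RTuple m} {z z' : RTuple l}
    (h : pathOf₃ x y z = pathOf₃ x' y' z') : ∃ g : G, g • x = x' ∧ g • y = y' ∧ g • z = z' := by
  obtain ⟨g, hg⟩ := exists_image_eq_of_typ (congrArg DPath.steps h)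
  exact ⟨g, supp_rtuple_injective ((supp_smul g x).trans (hg 0)),
    supp_rtuple_injective ((supp_smul g y).trans (hg 1)),
    supp_rtuple_injective ((supp_smul g z).trans (hg 2))⟩

theorem isLift_pathOf₃ (x : RTuple n) (y : RTuple m) (z : RTuple l) :
    IsLift (pathOf₃ x y z) (pathOf x y) (pathOf y z) (pathOf x z) := by
  classical
  refine ⟨?_, ?_, ?_⟩ <;> rw [DPath.proj_steps, pathOf₃_steps, typ_comp, pathOf_steps] <;>
  · congr 1
    funext i
    fin_cases i <;> rfl

theorem length_pathOf (x : RTuple n) (y : RTuple m) : (pathOf x y).length = (supp x ∪ supp y).card := by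
  classical
  change (typ _).length = _
  rw [length_typ]
  congr 1
  ext t
  simp [mem_allPts, Fin.exists_fin_succ]

theorem length_pathOf₃ (x : RTuple n) (y : RTuple m) (z : RTuple l) :
    (pathOf₃ x y z).length = (supp x ∪ supp z ∪ supp y).card := by
  classical
  change (typ _).length = _
  rw [length_typ]
  congr 1
  ext t
  simp only [mem_allPts, Fin.exists_fin_succ, Finset.mem_union]
  simp
  tauto

variable (k : Type u) [CommRing k]

-- The integrand is the indicator of the tuples y with the prescribed positions to x and z. Since a
-- lift is unique, any two such y give triples with the same path, hence are conjugate under the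
-- stabilizer of (x, z). The integral is thus the volume of one orbit, or 0 when there is no such y.
open Classical in
theorem integral_pathOf (p₁ : DPath ![n, m]) (p₂ : DPath ![m, l]) (x : RTuple n) (z : RTuple l) :
    integral (fun y => (if pathOf x y = p₁ then (1 : k) else 0) * (if pathOf y z = p₂ then 1 else 0)) =
      (eps p₁ p₂ (pathOf x z) : k) := by
  by_cases hex : ∃ y, pathOf x y = p₁ ∧ pathOf y z = p₂
  · obtain ⟨y₀, rfl, rfl⟩ := hex
    have hl := isLift_pathOf₃ x y₀ z
    have hq : ∃ q, IsLift q (pathOf x y₀) (pathOf y₀ z) (pathOf x z) := ⟨_, hl⟩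
    have heps : eps (pathOf x y₀) (pathOf y₀ z) (pathOf x z) = orbitVol (supp x ∪ supp z) y₀ := by
      unfold eps
      rw [dif_pos hq, hq.choose_spec.unique hl, length_pathOf₃, length_pathOf]
      unfold orbitVol
      -- The number of points of y₀ outside x and z is ℓ(q) - ℓ(p₃), and the exponent ℓ(q) + ℓ(p₃)
      -- exceeds it by the even number 2 ℓ(p₃).
      rw [Finset.card_union (supp x ∪ supp z), Finset.inter_comm]
      have := Finset.card_sdiff_add_card_inter (supp y₀) (supp x ∪ supp z)
      rw [show (supp x ∪ supp z).card + (supp y₀).card - (supp y₀ ∩ (supp x ∪ supp z)).card +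
        (supp x ∪ supp z).card = 2 * (supp x ∪ supp z).card + (supp y₀ \ (supp x ∪ supp z)).card by omega,
        pow_add, pow_mul]
      simp
    rw [heps, ← integral_orb]
    congr 1
    funext y
    have key : (pathOf x y = pathOf x y₀ ∧ pathOf y z = pathOf y₀ z) ↔
        orb (supp x ∪ supp z) y = orb (supp x ∪ supp z) y₀ := by
      rw [orb_eq_iff]
      constructor
      · rintro ⟨h1, h2⟩
        have hl' := isLift_pathOf₃ x y z
        rw [h1, h2] at hl'
        obtain ⟨g, hx, hy, hz⟩ := exists_smul_of_pathOf₃_eq (hl.unique hl')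
        refine ⟨g, ?_, hy⟩
        rw [fix_union]
        exact ⟨mem_fix_supp.2 hx, mem_fix_supp.2 hz⟩
      · rintro ⟨g, hg, rfl⟩
        rw [fix_union] at hg
        have hx := mem_fix_supp.1 hg.1
        have hz := mem_fix_supp.1 hg.2
        constructor
        · conv_lhs => rw [← hx, pathOf_smul]
        · conv_lhs => rw [← hz, pathOf_smul]
    by_cases h : pathOf x y = pathOf x y₀ ∧ pathOf y z = pathOf y₀ z
    · rw [if_pos h.1, if_pos h.2, if_pos (key.1 h), one_mul]
    · rw [if_neg fun h' => h (key.2 h')]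
      by_cases h1 : pathOf x y = pathOf x y₀
      · rw [if_neg fun h2 => h ⟨h1, h2⟩, mul_zero]
      · rw [if_neg h1, zero_mul]
  · have heps : eps p₁ p₂ (pathOf x z) = 0 := by
      unfold eps
      rw [dif_neg]
      rintro ⟨q, hq⟩
      -- A lift is the path of some triple. As its outer entries have the same path as (x, z), an
      -- element of G moves them to x and z, and the translated middle entry is a tuple that was
      -- assumed not to exist.
      obtain ⟨x', y', z', rfl⟩ := exists_pathOf₃_eq q
      have hl := isLift_pathOf₃ x' y' z'
      obtain ⟨g, rfl, rfl⟩ := exists_smul_of_pathOf_eq (DPath.ext (hl.2.2.symm.trans hq.2.2))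
      refine hex ⟨g • y', ?_, ?_⟩
      · rw [pathOf_smul]
        exact DPath.ext (hl.1.symm.trans hq.1)
      · rw [pathOf_smul]
        exact DPath.ext (hl.2.1.symm.trans hq.2.1)
    rw [heps, Int.cast_zero]
    refine Eq.trans ?_ (integral_zero (X := RTuple m))
    congr 1
    funext y
    by_cases h1 : pathOf x y = p₁
    · rw [if_neg fun h2 => hex ⟨y, h1, h2⟩, mul_zero]
    · rw [if_neg h1, zero_mul]

variable {k}

/-- The invariant kernel of an element of `𝒟(n, m)`. -/
noncomputable def pathKer (f : PathSpace k n m) (x : RTuple n) (y : RTuple m) : k := f (pathOf x y)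

theorem pathKer_gInv (f : PathSpace k n m) : GInv (pathKer f) := fun g x y => by
  unfold pathKer
  rw [pathOf_smul]

theorem pathKer_injective : Function.Injective (pathKer : PathSpace k n m → _) := by
  intro f f' h
  ext p
  obtain ⟨x, y, rfl⟩ := exists_pathOf_eq p
  exact congrFun (congrFun h x) y

/-- An invariant kernel is constant on orbits, so its values at one chosen pair for each path are
the required coefficients. -/
theorem exists_pathKer_eq {K : RTuple n → RTuple m → k} (hK : GInv K) :
    ∃ f : PathSpace k n m, pathKer f = K := by
  choose X Y hXY using fun p : DPath ![n, m] => exists_pathOf_eq p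
  refine ⟨Finsupp.equivFunOnFinite.symm fun p => K (X p) (Y p), ?_⟩
  funext x y
  change K (X (pathOf x y)) (Y (pathOf x y)) = K x y
  obtain ⟨g, hx, hy⟩ := exists_smul_of_pathOf_eq (hXY (pathOf x y))
  rw [← hK g, hx, hy]

theorem pathComp_apply (f : PathSpace k n m) (f' : PathSpace k m l) (p : DPath ![n, l]) :
    pathComp k f f' p = ∑ p₁, ∑ p₂, f p₁ * f' p₂ * (eps p₁ p₂ p : k) := by
  classical
  unfold pathComp
  rw [Finsupp.linearCombination_apply, Finsupp.sum_fintype _ _ (by simp), LinearMap.sum_apply,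
    Finsupp.finsetSum_apply]
  refine Finset.sum_congr rfl fun p₁ _ => ?_
  rw [LinearMap.smul_apply, Finsupp.linearCombination_apply, Finsupp.sum_fintype _ _ (by simp),
    Finsupp.smul_apply, Finsupp.finsetSum_apply, smul_eq_mul, Finset.mul_sum]
  refine Finset.sum_congr rfl fun p₂ _ => ?_
  rw [Finsupp.smul_apply, Finsupp.finsetSum_apply, smul_eq_mul, mul_assoc]
  congr 2
  simp [Finsupp.single_apply]

theorem pathKer_eq_sum (f : PathSpace k n m) [DecidableEq (DPath ![n, m])] (x : RTuple n)
    (y : RTuple m) : pathKer f x y = ∑ p, f p * if pathOf x y = p then 1 else 0 := by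
  simp [pathKer]

/-- Both sides are bilinear, so it is enough to multiply the indicator kernels of two orbits, where
the integral over y is a structure constant by `integral_pathOf`. -/
theorem pathKer_pathComp (f : PathSpace k n m) (f' : PathSpace k m l) :
    pathKer (pathComp k f f') = matMul (pathKer f) (pathKer f') := by
  classical
  funext x z
  unfold pathKer at *
  change pathComp k f f' (pathOf x z) = integral fun y => pathKer f x y * pathKer f' y z
  have h1 : ∀ (p₁ : DPath ![n, m]) (p₂ : DPath ![m, l]), IsSchwartz fun y =>
      (if pathOf x y = p₁ then (1 : k) else 0) * (if pathOf y z = p₂ then 1 else 0) := by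
    intro p₁ p₂
    have a1 : GInv fun x y => if pathOf x y = p₁ then (1 : k) else 0 := fun g x y => by
      simp only [pathOf_smul]
    have a2 : GInv fun z y => if pathOf y z = p₂ then (1 : k) else 0 := fun g x y => by
      simp only [pathOf_smul]
    exact (a1.isSchwartz x).mul (a2.isSchwartz z)
  have h2 : (fun y => pathKer f x y * pathKer f' y z) = fun y => ∑ p₁, ∑ p₂, f p₁ * f' p₂ *
      ((if pathOf x y = p₁ then (1 : k) else 0) * (if pathOf y z = p₂ then 1 else 0)) := by
    funext y
    rw [pathKer_eq_sum, pathKer_eq_sum, Finset.sum_mul_sum]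
    refine Finset.sum_congr rfl fun _ _ => Finset.sum_congr rfl fun _ _ => ?_
    ring
  have h3 : ∀ (p₁ : DPath ![n, m]) (p₂ : DPath ![m, l]), IsSchwartz fun y => f p₁ * f' p₂ *
      ((if pathOf x y = p₁ then (1 : k) else 0) * (if pathOf y z = p₂ then 1 else 0)) :=
    fun p₁ p₂ => (Schwartz k _).smul_mem _ (h1 p₁ p₂)
  rw [h2, integral_sum _ _ fun p₁ _ => isSchwartz_sum _ _ fun p₂ _ => h3 p₁ p₂, pathComp_apply]
  refine Finset.sum_congr rfl fun p₁ _ => ?_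
  rw [integral_sum _ _ fun p₂ _ => h3 p₁ p₂]
  refine Finset.sum_congr rfl fun p₂ _ => ?_
  rw [integral_const_mul _ (h1 p₁ p₂), integral_pathOf]

end PathOf

/-! ### The path category and permutation modules -/

section PathFunctor

variable (k : Type u) [CommRing k]

/-- `pathKer` is injective and multiplicative, so associativity is inherited from the matrix
product, where it is a form of Fubini's theorem. -/
theorem pathCompAssoc : PathCompAssoc k := by
  intro n m l r f g h
  apply pathKer_injective
  rw [pathKer_pathComp, pathKer_pathComp, pathKer_pathComp, pathKer_pathComp,
    matMul_assoc (pathKer_gInv f) (pathKer_gInv g) (pathKer_gInv h)]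

theorem pathCompUnital : PathCompUnital k := by
  intro n
  obtain ⟨e, he⟩ := exists_pathKer_eq (idMat_gInv (X := RTuple n) (k := k))
  refine ⟨e, fun m f => pathKer_injective ?_, fun m f => pathKer_injective ?_⟩
  · rw [pathKer_pathComp, he, idMat_matMul]
  · rw [pathKer_pathComp, he, matMul_idMat]

variable {k} (h : PathCompAssoc k ∧ PathCompUnital k)

theorem pathKer_id (X : PathCat k h) : pathKer (𝟙 X : PathSpace k X.n X.n) = idMat (RTuple X.n) k := by
  -- The identity of the path category is an arbitrarily chosen two-sided identity element. Writing
  -- the identity matrix as the kernel of some e, the product of the two is at once the kernel of 𝟙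
  -- X and the kernel of e.
  have h1 : pathKer (𝟙 X : PathSpace k X.n X.n) = matMul (pathKer (𝟙 X : PathSpace k X.n X.n))
      (idMat (RTuple X.n) k) := (matMul_idMat _).symm
  obtain ⟨e, he⟩ := exists_pathKer_eq (idMat_gInv (X := RTuple X.n) (k := k))
  rw [h1, ← he, ← pathKer_pathComp]
  congr 1
  exact (h.2 X.n).choose_spec.1 _ e

/-- The functor from the path category to permutation modules. -/
noncomputable def pathToPerm : PathCat k h ⥤ Perm k where
  obj X := Perm.mk (RTuple X.n)
  map f := matOf (pathKer f) (pathKer_gInv f)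
  map_id X := mat_ext (pathKer_id h X)
  map_comp {X Y Z} f g := mat_ext (pathKer_pathComp (k := k) (n := Z.n) (m := Y.n) (l := X.n) g f)

instance : (pathToPerm h).Full where
  map_surjective {X Y} A := by
    obtain ⟨f, hf⟩ := exists_pathKer_eq (entry_gInv A)
    exact ⟨f, mat_ext hf⟩

instance : (pathToPerm h).Faithful where
  map_injective hfg := pathKer_injective (congrArg entry hfg)

instance : (pathToPerm h).Additive where
  map_add := rfl

theorem pathToPerm_ofPath {n m : ℕ} (p : DPath ![n, m]) :
    (pathToPerm h).map (PathCat.ofPath h p) = pathMat k p := by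
  classical
  apply mat_ext
  funext x y
  change (Finsupp.single p 1 : PathSpace k n m) (pathOf x y) = if (x, y) ∈ orbitOf p then 1 else 0
  rw [Finsupp.single_apply]
  by_cases hp : p = pathOf x y
  · exact (if_pos hp).trans (if_pos (mem_orbitOf_iff.2 hp.symm)).symm
  · exact (if_neg hp).trans (if_neg (fun h' => hp (mem_orbitOf_iff.1 h').symm)).symm

end PathFunctor

/-! ### Linearity over k of the functor to representations -/

section Linear

variable {k : Type u} [Field k] (h : PathCompAssoc k ∧ PathCompUnital k)

/-- Scalars of k act on morphisms of smooth modules through the algebra map to A(G); on functions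
this has to be matched with pointwise scaling. -/
theorem algebraMap_smul_schwartz {X : Type} [MulAction G X] [FinitaryGSet X] (c : k)
    (φ : Schwartz k X) : ((algebraMap k (CompletedGroupAlgebra k) c • φ : Schwartz k X) : X → k) =
      c • (φ : X → k) := by
  rw [Algebra.algebraMap_eq_smul_one, coe_smul_schwartz, smul_act c 1 φ.2,
    CompletedGroupAlgebra.one_act φ.2]

instance : (pathToPerm h ⋙ permToRep k).Linear k where
  map_smul {X Y} f c := by
    ext φ
    apply Subtype.ext
    change mulVec (pathKer (c • f : PathSpace k Y.n X.n)) φ.1 =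
      ((algebraMap k (CompletedGroupAlgebra k) c • (⟨_, mulVec_isSchwartz (pathKer_gInv f) φ.2⟩ :
        Schwartz k (RTuple Y.n)) : Schwartz k (RTuple Y.n)) : RTuple Y.n → k)
    rw [algebraMap_smul_schwartz]
    funext y
    unfold mulVec
    rw [Pi.smul_apply, smul_eq_mul, ← integral_const_mul _ (((pathKer_gInv f).isSchwartz y).mul φ.2)]
    congr 1
    funext x
    exact mul_assoc _ _ _

end Linear

end Delannoy

namespace Delannoy

/-! ### Integration over the fibres of the maps forgetting a coordinate -/

section Fibres

variable {k : Type u} [CommRing k]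

/-- Forget the `i`-th entry of a tuple. -/
def RTuple.del {m : ℕ} (i : Fin (m + 1)) (x : RTuple (m + 1)) : RTuple m :=
  RTuple.of (fun j => x.1 (i.succAbove j)) fun _ _ h => x.2 (Fin.strictMono_succAbove i h)

theorem RTuple.del_smul {m : ℕ} (i : Fin (m + 1)) (g : G) (x : RTuple (m + 1)) :
    (g • x).del i = g • x.del i := rfl

theorem RTuple.del_eq_iff {m : ℕ} {i : Fin (m + 1)} {x y : RTuple (m + 1)} :
    x.del i = y.del i ↔ ∀ j, j ≠ i → x.1 j = y.1 j := by
  rw [RTuple.ext_iff]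
  constructor
  · intro h j hj
    obtain ⟨l, rfl⟩ := Fin.exists_succAbove_eq hj
    exact h l
  · intro h j
    exact h _ (Fin.succAbove_ne i j)

/-- The integral of a function on `ℝ^(m+1)` vanishes if its restriction to each fibre of the map
which forgets the `i`-th coordinate is constant on a half-open interval and `0` elsewhere. -/
theorem integral_eq_zero_of_fibres {m : ℕ} (i : Fin (m + 1)) {φ : RTuple (m + 1) → k}
    (hφ : IsSchwartz φ)
    (H : ∀ y₀, φ y₀ ≠ 0 → ∃ (a : ℝ) (B : Finset ℝ),
      ((∀ t, a ≤ t → (∀ b ∈ B, t < b) → ∃ y : RTuple (m + 1), y.del i = y₀.del i ∧ y.1 i = t ∧ φ y = φ y₀) ∧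
        ∀ y : RTuple (m + 1), y.del i = y₀.del i → φ y ≠ 0 → a ≤ y.1 i ∧ ∀ b ∈ B, y.1 i < b) ∨
      ((∀ t, t ≤ a → (∀ b ∈ B, b < t) → ∃ y : RTuple (m + 1), y.del i = y₀.del i ∧ y.1 i = t ∧ φ y = φ y₀) ∧
        ∀ y : RTuple (m + 1), y.del i = y₀.del i → φ y ≠ 0 → y.1 i ≤ a ∧ ∀ b ∈ B, b < y.1 i)) :
    integral φ = 0 := by
  classical
  obtain ⟨A, hA⟩ := hφ.exists_inv
  -- Fubini for φ placed on the graph of `RTuple.del i`: the integral of φ becomes an integral over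
  -- ℝ^(m) of its integrals over fibres, and each of these is shown to vanish.
  have hK : Inv₂ A (fun (y : RTuple (m + 1)) (w : RTuple m) => if w = y.del i then φ y else 0) :=
    fun g hg y w => by simp only [RTuple.del_smul, hA g hg, smul_left_cancel_iff]
  have h := integral_swap hK
  simp only [fun y : RTuple (m + 1) => integral_delta (y.del i) (fun _ : RTuple m => φ y)] at h
  refine h.trans ?_
  refine Eq.trans ?_ (integral_zero (X := RTuple m))
  congr 1
  funext w
  have huniq : ∀ y y' : RTuple (m + 1), y.del i = y'.del i → y.1 i = y'.1 i → y = y' := by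
    intro y y' h1 h2
    apply RTuple.ext
    intro j
    by_cases hj : j = i
    · rw [hj, h2]
    · exact RTuple.del_eq_iff.1 h1 j hj
  by_cases hw : ∃ y₀ : RTuple (m + 1), y₀.del i = w ∧ φ y₀ ≠ 0
  · obtain ⟨y₀, rfl, hy₀⟩ := hw
    -- The i-th coordinate embeds the fibre through y₀ in the line. There φ becomes ρ, which takes
    -- the single value φ y₀ on a half-open interval and 0 elsewhere.
    let ρ : ℝ → k := fun t =>
      if ∃ y : RTuple (m + 1), y.del i = y₀.del i ∧ y.1 i = t ∧ φ y ≠ 0 then φ y₀ else 0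
    obtain ⟨a, B, hab⟩ := H y₀ hy₀
    have hconst : ∀ y : RTuple (m + 1), y.del i = y₀.del i → φ y ≠ 0 → φ y = φ y₀ := by
      intro y h1 h2
      rcases hab with ⟨h3, h4⟩ | ⟨h3, h4⟩
      · obtain ⟨y', e1, e2, e3⟩ := h3 _ (h4 y h1 h2).1 (h4 y h1 h2).2
        rw [huniq y y' (h1.trans e1.symm) e2.symm, e3]
      · obtain ⟨y', e1, e2, e3⟩ := h3 _ (h4 y h1 h2).1 (h4 y h1 h2).2
        rw [huniq y y' (h1.trans e1.symm) e2.symm, e3]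
    have hψ : FixInv (A ∪ supp (y₀.del i))
        (fun y : RTuple (m + 1) => if y₀.del i = y.del i then φ y else 0) := by
      intro g hg y
      rw [fix_union] at hg
      have h0 := mem_fix_supp.1 hg.2
      dsimp only
      rw [RTuple.del_smul, hA g hg.1]
      conv_lhs => rw [← h0]
      simp only [smul_left_cancel_iff]
    have e : integral (fun y : RTuple (m + 1) => if y₀.del i = y.del i then φ y else 0) = integral ρ := by
      refine integral_eq_of_injOn (fun y => y.1 i) (fun g _ y => rfl) hψ ?_ ?_ ?_
      · intro y hy
        have h1 : y₀.del i = y.del i := by by_contra h1; rw [if_neg h1] at hy; exact hy rfl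
        rw [if_pos h1] at hy ⊢
        change (if _ then _ else _) = _
        rw [if_pos ⟨y, h1.symm, rfl, hy⟩, hconst y h1.symm hy]
      · intro t ht
        have h1 : ∃ y : RTuple (m + 1), y.del i = y₀.del i ∧ y.1 i = t ∧ φ y ≠ 0 := by
          by_contra h1
          exact ht (if_neg h1)
        obtain ⟨y, h1, h2, h3⟩ := h1
        exact ⟨y, h2, by rwa [if_pos h1.symm]⟩
      · intro y y' hy hy' hyy
        have h1 : y₀.del i = y.del i := by by_contra h1; rw [if_neg h1] at hy; exact hy rfl
        have h1' : y₀.del i = y'.del i := by by_contra h1; rw [if_neg h1] at hy'; exact hy' rfl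
        exact huniq y y' (h1.symm.trans h1') hyy
    rw [e]
    rcases hab with ⟨h3, h4⟩ | ⟨h3, h4⟩
    · refine integral_Ico a B (φ y₀) ρ (fun t ht => if_pos ?_) (fun t ht => if_neg ?_)
      · obtain ⟨y, e1, e2, e3⟩ := h3 t ht.1 ht.2
        exact ⟨y, e1, e2, by rwa [e3]⟩
      · rintro ⟨y, e1, rfl, e3⟩
        exact ht (h4 y e1 e3)
    · refine integral_Ioc a B (φ y₀) ρ (fun t ht => if_pos ?_) (fun t ht => if_neg ?_)
      · obtain ⟨y, e1, e2, e3⟩ := h3 t ht.1 ht.2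
        exact ⟨y, e1, e2, by rwa [e3]⟩
      · rintro ⟨y, e1, rfl, e3⟩
        exact ht (h4 y e1 e3)
  · push Not at hw
    refine Eq.trans ?_ (integral_zero (X := RTuple (m + 1)))
    congr 1
    funext y
    split_ifs with h1
    · exact hw y h1.symm
    · rfl

end Fibres

/-! ### The kernels attached to words -/

section Words

variable {m : ℕ}

/-- The relation `≤` or `≥`, depending on a letter. -/
def wrel (b : Bool) (s t : ℝ) : Prop := if b then s ≤ t else t ≤ s

theorem wrel_true {s t : ℝ} : wrel true s t ↔ s ≤ t := Iff.rfl

theorem wrel_false {s t : ℝ} : wrel false s t ↔ t ≤ s := by simp [wrel]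

theorem wrel_not {b : Bool} {s t : ℝ} : wrel (!b) s t ↔ wrel b t s := by
  cases b <;> simp [wrel]

theorem wrel_refl (b : Bool) (s : ℝ) : wrel b s s := by
  cases b <;> simp [wrel]

theorem wrel_map {b : Bool} (g : G) {s t : ℝ} : wrel b (g s) (g t) ↔ wrel b s t := by
  cases b <;> simp [wrel]

/-- Two tuples are related by a word `a` if their entries are related by the letters of `a`, and
the closed intervals which these entries bound are disjoint. -/
def wordRel (a : Fin m → Bool) (x y : RTuple m) : Prop :=
  (∀ i, wrel (a i) (x.1 i) (y.1 i)) ∧ ∀ i j, i < j → x.1 i < y.1 j ∧ y.1 i < x.1 j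

theorem wordRel_smul {a : Fin m → Bool} (g : G) {x y : RTuple m} :
    wordRel a (g • x) (g • y) ↔ wordRel a x y := by
  unfold wordRel
  simp only [smul_rtuple_apply, wrel_map, g.lt_iff_lt]

theorem wordRel_swap {a : Fin m → Bool} {x y : RTuple m} :
    wordRel a y x ↔ wordRel (fun i => !a i) x y := by
  unfold wordRel
  simp only [wrel_not]
  exact and_congr_right fun _ => forall₃_congr fun _ _ _ => and_comm

theorem wordRel_refl (a : Fin m → Bool) (x : RTuple m) : wordRel a x x :=
  ⟨fun _ => wrel_refl _ _, fun _ _ h => ⟨x.2 h, x.2 h⟩⟩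

variable (k : Type u) [CommRing k]

open Classical in
/-- The kernel attached to a word. -/
noncomputable def wordKer (a : Fin m → Bool) (x y : RTuple m) : k := if wordRel a x y then 1 else 0

open Classical in
/-- A variant of `wordKer` without the disjointness condition. -/
noncomputable def wordKer' (a : Fin m → Bool) (x y : RTuple m) : k :=
  if ∀ i, wrel (a i) (x.1 i) (y.1 i) then 1 else 0

theorem wordKer_gInv (a : Fin m → Bool) : GInv (wordKer k a) := fun g x y => by
  classical
  exact if_congr (wordRel_smul g) rfl rfl

theorem wordKer'_gInv (a : Fin m → Bool) : GInv (wordKer' k a) := fun g x y => by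
  classical
  exact if_congr (forall_congr' fun _ => wrel_map g) rfl rfl

/-- The disjointness condition is symmetric in the two tuples, so transposition only flips every
letter. It turns facts about left multiplication by these kernels into facts about right
multiplication. -/
theorem wordKer_swap (a : Fin m → Bool) :
    (fun x y => wordKer k a y x) = wordKer k (fun i => !a i) := by
  funext x y
  classical
  exact if_congr wordRel_swap rfl rfl

theorem wordKer_self (a : Fin m → Bool) (x : RTuple m) : wordKer k a x x = 1 :=
  if_pos (wordRel_refl a x)

variable {k}

/-- The function `F` does not depend on the `i`-th coordinate. -/
def Indep {T : Type*} (i : Fin m) (F : RTuple m → T) : Prop :=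
  ∀ y y' : RTuple m, (∀ j, j ≠ i → y.1 j = y'.1 j) → F y = F y'

/-- Change one entry of a tuple. -/
theorem exists_update (y : RTuple m) (i : Fin m) (t : ℝ) (h₁ : ∀ j, j < i → y.1 j < t)
    (h₂ : ∀ j, i < j → t < y.1 j) :
    ∃ y' : RTuple m, y'.1 i = t ∧ ∀ j, j ≠ i → y'.1 j = y.1 j := by
  refine ⟨RTuple.of (Function.update y.1 i t) ?_, Function.update_self _ _ _,
    fun j hj => Function.update_of_ne hj _ _⟩
  intro p q hpq
  by_cases hp : p = i
  · subst hp
    rw [Function.update_self, Function.update_of_ne hpq.ne']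
    exact h₂ q hpq
  · rw [Function.update_of_ne hp]
    by_cases hq : q = i
    · subst hq
      rw [Function.update_self]
      exact h₁ p hpq
    · rw [Function.update_of_ne hq]
      exact y.2 hpq

-- With the other coordinates of y fixed, the admissible values of y_i form a half-open interval:
-- the letter a i and the extra condition bound y_i weakly on one side, by x_i and s, and
-- disjointness from the neighbouring intervals bounds it strictly on the other. The integrand is
-- constant there, so each fibre contributes 0.
open Classical in
theorem integral_wordKer_mul {a : Fin (m + 1) → Bool} (x : RTuple (m + 1)) (i : Fin (m + 1)) (s : ℝ)
    {F : RTuple (m + 1) → k} (hF : Indep i F)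
    (hS : IsSchwartz fun y : RTuple (m + 1) =>
      wordKer k a x y * (F y * if wrel (a i) s (y.1 i) then 1 else 0)) :
    integral (fun y : RTuple (m + 1) =>
      wordKer k a x y * (F y * if wrel (a i) s (y.1 i) then 1 else 0)) = 0 := by
  have val : ∀ y : RTuple (m + 1), wordRel a x y → wrel (a i) s (y.1 i) →
      wordKer k a x y * (F y * if wrel (a i) s (y.1 i) then 1 else 0) = F y := by
    intro y h1 h2
    unfold wordKer
    rw [if_pos h1, if_pos h2, one_mul, mul_one]
  have cond : ∀ y : RTuple (m + 1),
      wordKer k a x y * (F y * if wrel (a i) s (y.1 i) then 1 else 0) ≠ 0 →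
      wordRel a x y ∧ wrel (a i) s (y.1 i) := by
    intro y hy
    unfold wordKer at hy
    constructor <;> by_contra hc
    · rw [if_neg hc, zero_mul] at hy
      exact hy rfl
    · rw [if_neg hc, mul_zero, mul_zero] at hy
      exact hy rfl
  refine integral_eq_zero_of_fibres i hS fun y₀ hy₀ => ?_
  obtain ⟨⟨r1, r2⟩, r3⟩ := cond y₀ hy₀
  rcases Bool.eq_false_or_eq_true (a i) with hai | hai
  · rw [hai, wrel_true] at r3
    have r1i := r1 i
    rw [hai, wrel_true] at r1i
    -- The closed end is the larger of x_i and s; the open end comes from the later entries of x and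
    -- y. The conditions against earlier entries are automatic, because x_j and y_j are below x_i
    -- for j < i.
    refine ⟨max (x.1 i) s, (Finset.univ.filter (i < ·)).image x.1 ∪
      (Finset.univ.filter (i < ·)).image y₀.1, Or.inl ⟨fun t hat hB => ?_, fun y hy hne => ?_⟩⟩
    · have hx : ∀ j, i < j → t < x.1 j := fun j hj => hB _ (by
        simp only [Finset.mem_union, Finset.mem_image, Finset.mem_filter, Finset.mem_univ, true_and]
        exact Or.inl ⟨j, hj, rfl⟩)
      have hy : ∀ j, i < j → t < y₀.1 j := fun j hj => hB _ (by
        simp only [Finset.mem_union, Finset.mem_image, Finset.mem_filter, Finset.mem_univ, true_and]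
        exact Or.inr ⟨j, hj, rfl⟩)
      have hxi := (le_max_left _ _).trans hat
      have hsi := (le_max_right _ _).trans hat
      obtain ⟨y, e1, e2⟩ := exists_update y₀ i t (fun j hj => (r2 j i hj).2.trans_le hxi) hy
      refine ⟨y, RTuple.del_eq_iff.2 e2, e1, ?_⟩
      rw [val y₀ ⟨r1, r2⟩ (by rwa [hai, wrel_true]), val y ⟨fun j => ?_, fun p q hpq => ⟨?_, ?_⟩⟩
        (by rwa [hai, wrel_true, e1])]
      · exact hF y y₀ e2
      · by_cases hj : j = i
        · subst hj; rw [hai, wrel_true, e1]; exact hxi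
        · rw [e2 j hj]; exact r1 j
      · by_cases hq : q = i
        · subst hq; rw [e1]; exact (x.2 hpq).trans_le hxi
        · rw [e2 q hq]; exact (r2 p q hpq).1
      · by_cases hp : p = i
        · subst hp; rw [e1]; exact hx q hpq
        · rw [e2 p hp]; exact (r2 p q hpq).2
    · obtain ⟨⟨s1, s2⟩, s3⟩ := cond y hne
      have s1i := s1 i
      rw [hai, wrel_true] at s3 s1i
      refine ⟨max_le s1i s3, fun b hb => ?_⟩
      simp only [Finset.mem_union, Finset.mem_image, Finset.mem_filter, Finset.mem_univ, true_and] at hb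
      rcases hb with ⟨j, hj, rfl⟩ | ⟨j, hj, rfl⟩
      · exact (s2 i j hj).2
      · rw [← RTuple.del_eq_iff.1 hy j hj.ne']
        exact y.2 hj
  · rw [hai, wrel_false] at r3
    have r1i := r1 i
    rw [hai, wrel_false] at r1i
    refine ⟨min (x.1 i) s, (Finset.univ.filter (· < i)).image x.1 ∪
      (Finset.univ.filter (· < i)).image y₀.1, Or.inr ⟨fun t hat hB => ?_, fun y hy hne => ?_⟩⟩
    · have hx : ∀ j, j < i → x.1 j < t := fun j hj => hB _ (by
        simp only [Finset.mem_union, Finset.mem_image, Finset.mem_filter, Finset.mem_univ, true_and]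
        exact Or.inl ⟨j, hj, rfl⟩)
      have hy : ∀ j, j < i → y₀.1 j < t := fun j hj => hB _ (by
        simp only [Finset.mem_union, Finset.mem_image, Finset.mem_filter, Finset.mem_univ, true_and]
        exact Or.inr ⟨j, hj, rfl⟩)
      have hxi := hat.trans (min_le_left _ _)
      have hsi := hat.trans (min_le_right _ _)
      obtain ⟨y, e1, e2⟩ := exists_update y₀ i t hy (fun j hj => hxi.trans_lt (r2 i j hj).1)
      refine ⟨y, RTuple.del_eq_iff.2 e2, e1, ?_⟩
      rw [val y₀ ⟨r1, r2⟩ (by rwa [hai, wrel_false]), val y ⟨fun j => ?_, fun p q hpq => ⟨?_, ?_⟩⟩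
        (by rwa [hai, wrel_false, e1])]
      · exact hF y y₀ e2
      · by_cases hj : j = i
        · subst hj; rw [hai, wrel_false, e1]; exact hxi
        · rw [e2 j hj]; exact r1 j
      · by_cases hq : q = i
        · subst hq; rw [e1]; exact hx p hpq
        · rw [e2 q hq]; exact (r2 p q hpq).1
      · by_cases hp : p = i
        · subst hp; rw [e1]; exact hxi.trans_lt (x.2 hpq)
        · rw [e2 p hp]; exact (r2 p q hpq).2
    · obtain ⟨⟨s1, s2⟩, s3⟩ := cond y hne
      have s1i := s1 i
      rw [hai, wrel_false] at s3 s1i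
      refine ⟨le_min s1i s3, fun b hb => ?_⟩
      simp only [Finset.mem_union, Finset.mem_image, Finset.mem_filter, Finset.mem_univ, true_and] at hb
      rcases hb with ⟨j, hj, rfl⟩ | ⟨j, hj, rfl⟩
      · exact (s2 j i hj).1
      · rw [← RTuple.del_eq_iff.1 hy j hj.ne]
        exact y.2 hj

/-- The bound s = x_i in `integral_wordKer_mul` is already part of the word relation, so it costs
nothing, and F is the factor that does not involve the i-th coordinate. -/
theorem wordKer_matMul_of_indep {Z : Type} [MulAction G Z] [FinitaryGSet Z] (a : Fin m → Bool)
    {F : RTuple m → Z → k} (hF : GInv F) {i : Fin m} (hi : ∀ z, Indep i fun x => F x z) :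
    matMul (wordKer k a) F = 0 := by
  classical
  cases m with
  | zero => exact i.elim0
  | succ m =>
    funext x z
    have e : (fun y => wordKer k a x y * F y z) = fun y =>
        wordKer k a x y * (F y z * if wrel (a i) (x.1 i) (y.1 i) then 1 else 0) := by
      funext y
      unfold wordKer
      by_cases h : wordRel a x y
      · rw [if_pos (h.1 i), mul_one]
      · rw [if_neg h, zero_mul, zero_mul]
    have hS : IsSchwartz (fun y => wordKer k a x y * F y z) :=
      ((wordKer_gInv k a).isSchwartz x).mul (hF.swap.isSchwartz z)
    unfold matMul
    rw [e] at hS ⊢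
    exact integral_wordKer_mul x i (x.1 i) (hi z) hS

/-- At a place i where the words differ, the condition of b on (y_i, z_i) is the letter a i read
from z_i to y_i. It bounds y_i on the same side as x_i does, so `integral_wordKer_mul` applies with
s = z_i. -/
theorem wordKer_matMul_wordKer' {a b : Fin m → Bool} (hab : a ≠ b) :
    matMul (wordKer k a) (wordKer' k b) = 0 := by
  classical
  obtain ⟨i, hi⟩ := Function.ne_iff.1 hab
  cases m with
  | zero => exact i.elim0
  | succ m =>
    funext x z
    have hb : b i = !a i := by
      revert hi
      cases a i <;> cases b i <;> simp
    have e : (fun y => wordKer k a x y * wordKer' k b y z) = fun y =>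
        wordKer k a x y * ((if ∀ j, j ≠ i → wrel (b j) (y.1 j) (z.1 j) then 1 else 0) *
          if wrel (a i) (z.1 i) (y.1 i) then 1 else 0) := by
      funext y
      congr 1
      unfold wordKer'
      rw [← wrel_not, ← hb, ite_zero_mul_ite_zero, mul_one]
      congr 1
      rw [eq_iff_iff]
      constructor
      · exact fun h => ⟨fun j _ => h j, h i⟩
      · rintro ⟨h1, h2⟩ j
        by_cases hj : j = i
        · rw [hj]; exact h2
        · exact h1 j hj
    have hS : IsSchwartz (fun y => wordKer k a x y * wordKer' k b y z) :=
      ((wordKer_gInv k a).isSchwartz x).mul ((wordKer'_gInv k b).swap.isSchwartz z)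
    unfold matMul
    rw [e] at hS ⊢
    refine integral_wordKer_mul x i (z.1 i) (fun y y' h => ?_) hS
    congr 1
    rw [eq_iff_iff]
    exact forall₂_congr fun j hj => by rw [h j hj]

end Words

end Delannoy

namespace Delannoy

/-! ### Generators for the invariant kernels on `ℝ^(m) × ℝ^(m)` -/

section Span

variable {m : ℕ} (k : Type u) [CommRing k]

open Classical in
/-- The elementary functions of `t` and `z`: the constant `1` and the characteristic functions of
`t ≤ z_j` and of `t ≥ z_j`. -/
noncomputable def elem (s : Option (Fin m × Bool)) (t : ℝ) (z : RTuple m) : k :=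
  match s with
  | none => 1
  | some p => if wrel p.2 t (z.1 p.1) then 1 else 0

/-- The span of the elementary functions. -/
def elemSpan (m : ℕ) : Submodule k (ℝ → RTuple m → k) := Submodule.span k (Set.range (elem k))

variable {k}

theorem elem_mem (s : Option (Fin m × Bool)) : elem k s ∈ elemSpan k m :=
  Submodule.subset_span ⟨s, rfl⟩

theorem one_mem_elemSpan : (1 : ℝ → RTuple m → k) ∈ elemSpan k m := elem_mem none

/-- Two half-lines bounded by entries of z that point the same way are nested, so their product is
one of the two factors. If they point in opposite directions, either they cover the line, and the
product is the sum minus 1, or they are disjoint, and it is 0. Which case occurs depends only on the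
indices, as z is increasing. -/
theorem elem_mul_mem (s s' : Option (Fin m × Bool)) : elem k s * elem k s' ∈ elemSpan k m := by
  classical
  have mixed : ∀ j j' : Fin m,
      elem k (some (j, true)) * elem k (some (j', false)) ∈ elemSpan k m := by
    intro j j'
    by_cases hj : j' ≤ j
    · have : elem k (some (j, true)) * elem k (some (j', false)) =
          elem k (some (j, true)) + elem k (some (j', false)) - 1 := by
        funext t z
        have hz : z.1 j' ≤ z.1 j := z.2.monotone hj
        change (if wrel true t (z.1 j) then (1 : k) else 0) * (if wrel false t (z.1 j') then 1 else 0) =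
          (if wrel true t (z.1 j) then (1 : k) else 0) + (if wrel false t (z.1 j') then 1 else 0) - 1
        simp only [wrel_true, wrel_false]
        by_cases h1 : t ≤ z.1 j
        · simp [h1]
        · have h2 : z.1 j' ≤ t := by linarith
          simp [h1, h2]
      rw [this]
      exact sub_mem (add_mem (elem_mem _) (elem_mem _)) one_mem_elemSpan
    · have : elem k (some (j, true)) * elem k (some (j', false)) = 0 := by
        funext t z
        have hz : z.1 j < z.1 j' := z.2 (not_le.1 hj)
        change (if wrel true t (z.1 j) then (1 : k) else 0) * (if wrel false t (z.1 j') then 1 else 0) = 0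
        simp only [wrel_true, wrel_false]
        by_cases h1 : t ≤ z.1 j
        · have h2 : ¬ z.1 j' ≤ t := by linarith
          simp [h2]
        · simp [h1]
      rw [this]
      exact zero_mem _
  have same : ∀ (b : Bool) (j j' : Fin m),
      elem k (some (j, b)) * elem k (some (j', b)) ∈ elemSpan k m := by
    intro b j j'
    have key : ∀ i i' : Fin m, (∀ (t : ℝ) (z : RTuple m), wrel b t (z.1 i) → wrel b t (z.1 i')) →
        elem k (some (i, b)) * elem k (some (i', b)) = elem k (some (i, b)) := by
      intro i i' h
      funext t z
      change (if wrel b t (z.1 i) then (1 : k) else 0) * (if wrel b t (z.1 i') then 1 else 0) =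
        if wrel b t (z.1 i) then (1 : k) else 0
      by_cases h1 : wrel b t (z.1 i)
      · rw [if_pos h1, if_pos (h t z h1), mul_one]
      · rw [if_neg h1, zero_mul]
    have tot : (∀ (t : ℝ) (z : RTuple m), wrel b t (z.1 j) → wrel b t (z.1 j')) ∨
        ∀ (t : ℝ) (z : RTuple m), wrel b t (z.1 j') → wrel b t (z.1 j) := by
      cases b with
      | true =>
        simp only [wrel_true]
        rcases le_total j j' with h | h
        · exact Or.inl fun t z h1 => h1.trans (z.2.monotone h)
        · exact Or.inr fun t z h1 => h1.trans (z.2.monotone h)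
      | false =>
        simp only [wrel_false]
        rcases le_total j j' with h | h
        · exact Or.inr fun t z h1 => (z.2.monotone h).trans h1
        · exact Or.inl fun t z h1 => (z.2.monotone h).trans h1
    rcases tot with h | h
    · rw [key j j' h]; exact elem_mem _
    · rw [mul_comm, key j' j h]; exact elem_mem _
  rcases s with _ | ⟨j, b⟩
  · have : elem k (none : Option (Fin m × Bool)) * elem k s' = elem k s' := one_mul _
    rw [this]
    exact elem_mem _
  rcases s' with _ | ⟨j', b'⟩
  · have : elem k (some (j, b)) * elem k (none : Option (Fin m × Bool)) = elem k (some (j, b)) :=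
      mul_one _
    rw [this]
    exact elem_mem _
  cases b <;> cases b'
  · exact same _ _ _
  · rw [mul_comm]; exact mixed _ _
  · exact mixed _ _
  · exact same _ _ _

theorem mul_mem_elemSpan {f g : ℝ → RTuple m → k} (hf : f ∈ elemSpan k m) (hg : g ∈ elemSpan k m) :
    f * g ∈ elemSpan k m := by
  have h := Submodule.mul_mem_mul hf hg
  unfold elemSpan at h
  rw [Submodule.span_mul_span] at h
  refine Submodule.span_le.2 ?_ h
  rintro _ ⟨_, ⟨s, rfl⟩, _, ⟨s', rfl⟩, rfl⟩
  exact elem_mul_mem s s'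

theorem prod_mem_elemSpan {ι : Type*} (s : Finset ι) (f : ι → ℝ → RTuple m → k)
    (hf : ∀ i ∈ s, f i ∈ elemSpan k m) : ∏ i ∈ s, f i ∈ elemSpan k m :=
  Finset.prod_induction f (· ∈ elemSpan k m) (fun _ _ => mul_mem_elemSpan) one_mem_elemSpan hf

/-- The product of elementary functions of the coordinates of `y` in a set `T`. -/
noncomputable def elemProd (T : Finset (Fin m)) (s : Fin m → Option (Fin m × Bool)) (y z : RTuple m) : k :=
  ∏ i ∈ T, elem k (s i) (y.1 i) z

theorem elemProd_gInv (T : Finset (Fin m)) (s : Fin m → Option (Fin m × Bool)) :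
    GInv (elemProd (k := k) T s) := by
  intro g y z
  unfold elemProd
  refine Finset.prod_congr rfl fun i _ => ?_
  rcases s i with _ | p
  · rfl
  · classical exact if_congr (wrel_map g) rfl rfl

theorem elemProd_indep {T : Finset (Fin m)} (s : Fin m → Option (Fin m × Bool)) {i : Fin m}
    (hi : i ∉ T) (z : RTuple m) : Indep i fun y => elemProd (k := k) T s y z := by
  intro y y' h
  refine Finset.prod_congr rfl fun j hj => ?_
  rw [h j fun e => hi (e ▸ hj)]

/-- Products of functions of one coordinate are combinations of products of elementary functions. -/
theorem prod_mem_span_elemProd (g : Fin m → ℝ → RTuple m → k) (hg : ∀ i, g i ∈ elemSpan k m) :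
    (fun y z : RTuple m => ∏ i, g i (y.1 i) z) ∈
      Submodule.span k (Set.range (elemProd (k := k) (m := m) Finset.univ)) := by
  classical
  have h : ∀ i, ∃ c : Option (Fin m × Bool) → k, ∑ s, c s • elem k s = g i := fun i =>
    (Submodule.mem_span_range_iff_exists_fun k).1 (hg i)
  choose c hc using h
  have e : (fun y z : RTuple m => ∏ i, g i (y.1 i) z) =
      ∑ s : Fin m → Option (Fin m × Bool), (∏ i, c i (s i)) • elemProd Finset.univ s := by
    funext y z
    simp only [Finset.sum_apply, Pi.smul_apply, smul_eq_mul, elemProd, ← Finset.prod_mul_distrib]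
    have h := Finset.prod_univ_sum (fun _ : Fin m => (Finset.univ : Finset (Option (Fin m × Bool))))
      (fun i s => c i s * elem k s (y.1 i) z)
    rw [Fintype.piFinset_univ] at h
    refine Eq.trans ?_ h
    refine Finset.prod_congr rfl fun i _ => ?_
    rw [← hc i]
    simp [Finset.sum_apply]
  rw [e]
  exact Submodule.sum_mem _ fun s _ => Submodule.smul_mem _ _ (Submodule.subset_span ⟨s, rfl⟩)

/-- Pairs of tuples with the same relative position are conjugate under `G`. -/
theorem exists_smul_of_lt_iff {n l : ℕ} {y y' : RTuple n} {z z' : RTuple l}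
    (h : ∀ i j, (y.1 i ≤ z.1 j ↔ y'.1 i ≤ z'.1 j) ∧ (z.1 j ≤ y.1 i ↔ z'.1 j ≤ y'.1 i)) :
    ∃ g : G, g • y = y' ∧ g • z = z' := by
  classical
  let f : ℝ → ℝ := fun t => if ∃ i, y.1 i = t then Function.extend y.1 y'.1 0 t
    else Function.extend z.1 z'.1 0 t
  have fy : ∀ i, f (y.1 i) = y'.1 i := fun i => by
    change (if _ then _ else _) = _
    rw [if_pos ⟨i, rfl⟩, y.2.injective.extend_apply]
  have fz : ∀ j, f (z.1 j) = z'.1 j := fun j => by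
    by_cases hj : ∃ i, y.1 i = z.1 j
    · obtain ⟨i, hi⟩ := hj
      rw [← hi, fy]
      exact le_antisymm ((h i j).1.1 hi.le) ((h i j).2.1 hi.ge)
    · change (if _ then _ else _) = _
      rw [if_neg hj, z.2.injective.extend_apply]
  obtain ⟨g, hg⟩ := exists_ext (supp y ∪ supp z) f (by
    intro s hs t ht hst
    simp only [Finset.coe_union, Set.mem_union, Finset.mem_coe, mem_supp_rtuple] at hs ht
    rcases hs with ⟨i, rfl⟩ | ⟨i, rfl⟩ <;> rcases ht with ⟨j, rfl⟩ | ⟨j, rfl⟩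
    · rw [fy, fy]; exact y'.2 (y.2.lt_iff_lt.1 hst)
    · rw [fy, fz, ← not_le, ← (h i j).2, not_le]; exact hst
    · rw [fz, fy, ← not_le, ← (h j i).1, not_le]; exact hst
    · rw [fz, fz]; exact z'.2 (z.2.lt_iff_lt.1 hst))
  refine ⟨g, RTuple.ext fun i => ?_, RTuple.ext fun j => ?_⟩
  · rw [smul_rtuple_apply, hg _ (Finset.mem_union_left _ (mem_supp_rtuple.2 ⟨i, rfl⟩)), fy]
  · rw [smul_rtuple_apply, hg _ (Finset.mem_union_right _ (mem_supp_rtuple.2 ⟨j, rfl⟩)), fz]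

/-- The orbit of (y, z) is determined by the truth values of all y_i ≤ z_j and y_i ≥ z_j. The
indicator of one pattern of truth values is a product over i of functions of y_i and z, each a
product of elementary functions and their complements, and K is a combination of these indicators.
-/
theorem gInv_mem_span_elemProd {K : RTuple m → RTuple m → k} (hK : GInv K) :
    K ∈ Submodule.span k (Set.range (elemProd (k := k) (m := m) Finset.univ)) := by
  classical
  let σ : RTuple m → RTuple m → (Fin m → Fin m → Bool → Bool) := fun y z i j b =>
    decide (wrel b (y.1 i) (z.1 j))
  have hσ : ∀ y z y' z', σ y z = σ y' z' → K y z = K y' z' := by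
    intro y z y' z' h
    have h' : ∀ i j b, wrel b (y.1 i) (z.1 j) ↔ wrel b (y'.1 i) (z'.1 j) := fun i j b => by
      have := congrFun (congrFun (congrFun h i) j) b
      simpa only [σ, decide_eq_decide] using this
    obtain ⟨g, hy, hz⟩ := exists_smul_of_lt_iff (y := y) (y' := y') (z := z) (z' := z') fun i j =>
      ⟨h' i j true, by simpa only [wrel_false] using h' i j false⟩
    rw [← hK g, hy, hz]
  -- The value of K on pairs with pattern τ. Patterns that no pair realizes get the value 0; their
  -- indicator vanishes, so the choice has no effect.
  let val : (Fin m → Fin m → Bool → Bool) → k := fun τ =>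
    if h : ∃ p : RTuple m × RTuple m, σ p.1 p.2 = τ then K h.choose.1 h.choose.2 else 0
  have hval : ∀ y z, val (σ y z) = K y z := by
    intro y z
    have h : ∃ p : RTuple m × RTuple m, σ p.1 p.2 = σ y z := ⟨(y, z), rfl⟩
    change dite _ _ _ = _
    rw [dif_pos h]
    exact hσ _ _ _ _ h.choose_spec
  let g : (Fin m → Fin m → Bool → Bool) → Fin m → ℝ → RTuple m → k := fun τ i =>
    ∏ j, ∏ b, if τ i j b then elem k (some (j, b)) else 1 - elem k (some (j, b))
  have hg : ∀ τ i, g τ i ∈ elemSpan k m := by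
    intro τ i
    refine prod_mem_elemSpan _ _ fun j _ => prod_mem_elemSpan _ _ fun b _ => ?_
    split_ifs
    · exact elem_mem _
    · exact sub_mem one_mem_elemSpan (elem_mem _)
  have hind : ∀ τ y z, ∏ i, g τ i (y.1 i) z = if σ y z = τ then 1 else 0 := by
    intro τ y z
    have h1 : ∀ i, g τ i (y.1 i) z = ∏ j, ∏ b, if σ y z i j b = τ i j b then (1 : k) else 0 := by
      intro i
      simp only [g, Finset.prod_apply]
      refine Finset.prod_congr rfl fun j _ => Finset.prod_congr rfl fun b _ => ?_
      have h2 : elem k (some (j, b)) (y.1 i) z = if σ y z i j b = true then 1 else 0 := by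
        change (if wrel b (y.1 i) (z.1 j) then (1 : k) else 0) = _
        simp [σ]
      cases hτ : τ i j b <;> simp [h2]
      cases σ y z i j b <;> simp
    simp only [h1, Finset.prod_ite_zero, Finset.prod_const_one]
    simp [funext_iff]
  have hsum : K = ∑ τ, val τ • fun y z : RTuple m => ∏ i, g τ i (y.1 i) z := by
    funext y z
    simp only [Finset.sum_apply, Pi.smul_apply, smul_eq_mul, hind]
    simp [hval]
  rw [hsum]
  exact Submodule.sum_mem _ fun τ _ => Submodule.smul_mem _ _ (prod_mem_span_elemProd _ (hg τ))

variable (k) in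
/-- The span of the invariant kernels that do not depend on some coordinate of the first variable. -/
def indepSpan (m : ℕ) : Submodule k (RTuple m → RTuple m → k) :=
  Submodule.span k {F | GInv F ∧ ∃ i, ∀ z, Indep i fun y => F y z}

theorem elemProd_mem_indepSpan {T : Finset (Fin m)} (s : Fin m → Option (Fin m × Bool)) {i : Fin m}
    (hi : i ∉ T) : elemProd (k := k) T s ∈ indepSpan k m :=
  Submodule.subset_span ⟨elemProd_gInv T s, i, elemProd_indep s hi⟩

/-- A factor equal to 1 leaves its coordinate free. Otherwise factor i compares y_i with one entry
z_(p i); unless p is increasing there are a < b with p b ≤ p a, and then the factors at a and b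
interact so that the product reduces to ones omitting a or b. -/
theorem elemProd_mem (s : Fin m → Option (Fin m × Bool)) :
    elemProd (k := k) Finset.univ s ∈
      indepSpan k m ⊔ Submodule.span k (Set.range (wordKer' (m := m) k)) := by
  classical
  by_cases hnone : ∃ i, s i = none
  · obtain ⟨i, hi⟩ := hnone
    refine Submodule.mem_sup_left ?_
    have : elemProd (k := k) Finset.univ s = elemProd (Finset.univ.erase i) s := by
      funext y z
      unfold elemProd
      rw [← Finset.mul_prod_erase _ _ (Finset.mem_univ i), hi]
      exact one_mul _
    rw [this]
    exact elemProd_mem_indepSpan s (Finset.notMem_erase _ _)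
  have hsome : ∀ i, ∃ p, s i = some p := fun i =>
    Option.ne_none_iff_exists'.1 fun h => hnone ⟨i, h⟩
  choose p hp using hsome
  -- A strictly increasing self-map of `Fin m` is the identity, so in this case y_i is compared with
  -- z_i for every i and the product is the kernel of a word.
  by_cases hmono : StrictMono fun i => (p i).1
  · refine Submodule.mem_sup_right (Submodule.subset_span ⟨fun i => (p i).2, ?_⟩)
    have hid : (fun i => (p i).1) = id := by
      rw [← StrictMono.range_inj hmono strictMono_id, Set.range_id, Set.range_eq_univ]
      exact Finite.surjective_of_injective hmono.injective
    funext y z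
    unfold wordKer' elemProd
    have h1 : ∀ i, elem k (s i) (y.1 i) z = if wrel (p i).2 (y.1 i) (z.1 i) then 1 else 0 := by
      intro i
      have h2 := congrFun hid i
      simp only [id] at h2
      rw [hp i]
      change (if wrel (p i).2 (y.1 i) (z.1 (p i).1) then (1 : k) else 0) = _
      rw [h2]
    simp only [h1, Finset.prod_ite_zero, Finset.prod_const_one, Finset.mem_univ, true_implies]
  · refine Submodule.mem_sup_left ?_
    obtain ⟨a, b, hab, hle⟩ : ∃ a b, a < b ∧ (p b).1 ≤ (p a).1 := by
      unfold StrictMono at hmono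
      push Not at hmono
      exact hmono
    have ha : a ∉ Finset.univ.erase a := Finset.notMem_erase _ _
    have hb : b ∉ Finset.univ.erase b := Finset.notMem_erase _ _
    have hba : b ∈ Finset.univ.erase a := Finset.mem_erase.2 ⟨hab.ne', Finset.mem_univ _⟩
    have hab' : a ∈ Finset.univ.erase b := Finset.mem_erase.2 ⟨hab.ne, Finset.mem_univ _⟩
    let R : RTuple m → RTuple m → k := elemProd ((Finset.univ.erase a).erase b) s
    let α : RTuple m → RTuple m → k := fun y z => elem k (s a) (y.1 a) z
    let β : RTuple m → RTuple m → k := fun y z => elem k (s b) (y.1 b) z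
    have e1 : ∀ y z, elemProd (k := k) (Finset.univ.erase a) s y z = β y z * R y z := fun y z =>
      (Finset.mul_prod_erase _ _ hba).symm
    have e2 : ∀ y z, elemProd (k := k) (Finset.univ.erase b) s y z = α y z * R y z := fun y z => by
      change _ = α y z * elemProd _ s y z
      rw [Finset.erase_right_comm]
      exact (Finset.mul_prod_erase _ _ hab').symm
    have e0 : ∀ y z, elemProd (k := k) Finset.univ s y z = α y z * (β y z * R y z) := fun y z => by
      rw [← e1]
      exact (Finset.mul_prod_erase _ _ (Finset.mem_univ a)).symm
    have ma := elemProd_mem_indepSpan (k := k) s ha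
    have mb := elemProd_mem_indepSpan (k := k) s hb
    have mR : R ∈ indepSpan k m :=
      elemProd_mem_indepSpan s (Finset.notMem_erase b (Finset.univ.erase a))
    have hα : ∀ y z, α y z = if wrel (p a).2 (y.1 a) (z.1 (p a).1) then 1 else 0 := fun y z => by
      change elem k (s a) (y.1 a) z = _
      rw [hp a]
      rfl
    have hβ : ∀ y z, β y z = if wrel (p b).2 (y.1 b) (z.1 (p b).1) then 1 else 0 := fun y z => by
      change elem k (s b) (y.1 b) z = _
      rw [hp b]
      rfl
    have lt1 : ∀ y : RTuple m, y.1 a < y.1 b := fun y => y.2 hab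
    have lt2 : ∀ z : RTuple m, z.1 (p b).1 ≤ z.1 (p a).1 := fun z => z.2.monotone hle
    -- Here y_a < y_b and z_(p b) ≤ z_(p a). For the letters ≤, ≤ the condition at b implies that at
    -- a; for ≤, ≥ at least one of the two always holds, so αβ = α + β - 1; for ≥, ≤ they contradict
    -- each other; for ≥, ≥ the condition at a implies that at b.
    rcases Bool.eq_false_or_eq_true (p a).2 with h1 | h1 <;>
      rcases Bool.eq_false_or_eq_true (p b).2 with h2 | h2 <;>
      simp only [h1, h2, wrel_true, wrel_false] at hα hβ
    · have : elemProd (k := k) Finset.univ s = elemProd (Finset.univ.erase a) s := by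
        funext y z
        have := lt1 y
        have := lt2 z
        rw [e0, e1, hα, hβ]
        by_cases h : y.1 b ≤ z.1 (p b).1
        · rw [if_pos (by linarith), one_mul]
        · simp [h]
      rw [this]
      exact ma
    · have : elemProd (k := k) Finset.univ s =
          elemProd (Finset.univ.erase a) s + elemProd (Finset.univ.erase b) s - R := by
        funext y z
        have := lt1 y
        have := lt2 z
        change _ = elemProd (Finset.univ.erase a) s y z + elemProd (Finset.univ.erase b) s y z - R y z
        rw [e0, e1, e2, hα, hβ]
        by_cases h : y.1 a ≤ z.1 (p a).1
        · simp [h]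
        · have : z.1 (p b).1 ≤ y.1 b := by linarith
          simp [h, this]
      rw [this]
      exact sub_mem (add_mem ma mb) mR
    · have : elemProd (k := k) Finset.univ s = 0 := by
        funext y z
        have := lt1 y
        have := lt2 z
        rw [e0, hα, hβ]
        by_cases h : y.1 b ≤ z.1 (p b).1
        · rw [if_neg (by linarith), zero_mul]
          rfl
        · simp [h]
      rw [this]
      exact zero_mem _
    · have : elemProd (k := k) Finset.univ s = elemProd (Finset.univ.erase b) s := by
        funext y z
        have := lt1 y
        have := lt2 z
        rw [e0, e2, hα, hβ]
        by_cases h : z.1 (p a).1 ≤ y.1 a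
        · rw [if_pos (show z.1 (p b).1 ≤ y.1 b by linarith), one_mul]
        · simp [h]
      rw [this]
      exact mb

/-- Every invariant kernel is a combination of kernels of words and of kernels which do not depend
on all coordinates. -/
theorem gInv_mem {K : RTuple m → RTuple m → k} (hK : GInv K) :
    K ∈ indepSpan k m ⊔ Submodule.span k (Set.range (wordKer' (m := m) k)) := by
  refine Submodule.span_le.2 ?_ (gInv_mem_span_elemProd hK)
  rintro _ ⟨s, rfl⟩
  exact elemProd_mem s

end Span

end Delannoy

namespace Delannoy

/-! ### Products of invariant kernels -/

section Kernels

variable {k : Type u} [CommRing k] {X Y Z : Type} [MulAction G X] [MulAction G Y] [MulAction G Z]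
  [FinitaryGSet X] [FinitaryGSet Y] [FinitaryGSet Z]

theorem GInv.zero : GInv (0 : Y → X → k) := fun _ _ _ => rfl

theorem GInv.add {K L : Y → X → k} (hK : GInv K) (hL : GInv L) : GInv (K + L) := fun g y x => by
  simp only [Pi.add_apply, hK g, hL g]

theorem GInv.smul (c : k) {K : Y → X → k} (hK : GInv K) : GInv (c • K) := fun g y x => by
  simp only [Pi.smul_apply, hK g]

theorem GInv.sum {ι : Type*} (s : Finset ι) {L : ι → Y → X → k} (hL : ∀ i, GInv (L i)) :
    GInv (∑ i ∈ s, L i) :=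
  Finset.sum_induction L GInv (fun _ _ => GInv.add) GInv.zero fun i _ => hL i

theorem matMul_zero (K : Z → Y → k) : matMul K (0 : Y → X → k) = 0 := by
  funext z x
  unfold matMul
  refine Eq.trans ?_ (integral_zero (X := Y))
  congr 1
  funext y
  exact mul_zero _

theorem matMul_add {K : Z → Y → k} {L M : Y → X → k} (hK : GInv K) (hL : GInv L) (hM : GInv M) :
    matMul K (L + M) = matMul K L + matMul K M := by
  funext z x
  exact congrFun (mulVec_add hK (hL.swap.isSchwartz x) (hM.swap.isSchwartz x)) z

theorem matMul_smul {K : Z → Y → k} {L : Y → X → k} (hK : GInv K) (hL : GInv L) (c : k) :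
    matMul K (c • L) = c • matMul K L := by
  funext z x
  exact congrFun (mulVec_const_smul hK c (hL.swap.isSchwartz x)) z

theorem matMul_sum {ι : Type*} (s : Finset ι) {K : Z → Y → k} {L : ι → Y → X → k} (hK : GInv K)
    (hL : ∀ i, GInv (L i)) : matMul K (∑ i ∈ s, L i) = ∑ i ∈ s, matMul K (L i) := by
  classical
  induction s using Finset.induction_on with
  | empty => exact matMul_zero K
  | insert a s ha ih =>
    rw [Finset.sum_insert ha, Finset.sum_insert ha, matMul_add hK (hL a) (GInv.sum s hL), ih]

theorem matMul_swap (K : Z → Y → k) (L : Y → X → k) :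
    (fun x z => matMul K L z x) = matMul (fun x y => L y x) (fun y z => K z y) := by
  funext x z
  unfold matMul
  simp only [mul_comm]

theorem smul_mulVec (c : k) {K : Y → X → k} (hK : GInv K) {φ : X → k} (hφ : IsSchwartz φ) :
    mulVec (c • K) φ = c • mulVec K φ := by
  funext y
  change integral _ = c * integral _
  rw [← integral_const_mul c ((hK.isSchwartz y).mul hφ)]
  congr 1
  funext x
  exact mul_assoc _ _ _

theorem zero_mulVec (φ : X → k) : mulVec (0 : Y → X → k) φ = 0 := by
  funext y
  unfold mulVec
  refine Eq.trans ?_ (integral_zero (X := X))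
  congr 1
  funext x
  exact zero_mul _

/-- The `A(G)`-linear operator defined by an invariant kernel. -/
noncomputable def opOf (K : Y → X → k) (hK : GInv K) :
    Schwartz k X →ₗ[CompletedGroupAlgebra k] Schwartz k Y where
  toFun φ := ⟨mulVec K φ.1, mulVec_isSchwartz hK φ.2⟩
  map_add' φ ψ := Subtype.ext (mulVec_add hK φ.2 ψ.2)
  map_smul' a φ := Subtype.ext (act_mulVec a hK φ.2).symm

theorem opOf_apply {K : Y → X → k} (hK : GInv K) (φ : Schwartz k X) :
    (opOf K hK φ).1 = mulVec K φ.1 := rfl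

end Kernels

/-! ### The idempotents attached to words -/

section Idempotents

variable {k : Type u} [Field k] {m : ℕ}

/-- Shifting each integer point by 1/4 in the direction of its letter keeps the intervals disjoint
and makes corresponding entries distinct, so no other word relates the two tuples. Such pairs
separate the kernels of words. -/
theorem exists_wordRel (a : Fin m → Bool) :
    ∃ x y : RTuple m, wordRel a x y ∧ ∀ b, wordRel b x y → b = a := by
  let x : RTuple m := RTuple.of (fun i => (i : ℝ)) fun i j h => Nat.cast_lt.2 h
  have hd : ∀ i : Fin m, |(if a i then 1 / 4 else -1 / 4 : ℝ)| = 1 / 4 := fun i => by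
    split_ifs <;> norm_num [abs_of_pos, abs_of_neg]
  have hd' := fun i => abs_le.1 (hd i).le
  have hlt : ∀ i j : Fin m, i < j → (i : ℝ) + 1 ≤ j := fun i j h => by exact_mod_cast h
  let y : RTuple m := RTuple.of (fun i => (i : ℝ) + if a i then 1 / 4 else -1 / 4) fun i j h => by
    have := hlt i j h
    have := hd' i
    have := hd' j
    dsimp only
    linarith
  have hx : ∀ i, x.1 i = i := fun _ => rfl
  have hy : ∀ i, y.1 i = (i : ℝ) + if a i then 1 / 4 else -1 / 4 := fun _ => rfl
  refine ⟨x, y, ⟨fun i => ?_, fun i j h => ?_⟩, fun b hb => ?_⟩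
  · rw [hx, hy]
    cases a i <;> norm_num [wrel]
  · rw [hx, hy, hx, hy]
    have := hlt i j h
    have := hd' i
    have := hd' j
    constructor <;> linarith
  · funext i
    have h := hb.1 i
    rw [hx, hy] at h
    revert h
    cases a i <;> cases b i <;> norm_num [wrel]

/-- By `gInv_mem`, K is a combination of kernels that omit a coordinate and of the kernels `wordKer'
k b`. Left multiplication by `wordKer k a` kills all of these except the one with b = a. -/
theorem exists_wordKer_matMul_eq' (a : Fin m → Bool) {K : RTuple m → RTuple m → k} (hK : GInv K) :
    ∃ c : k, matMul (wordKer k a) K = c • matMul (wordKer k a) (wordKer' k a) := by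
  classical
  let N : Submodule k (RTuple m → RTuple m → k) :=
    { carrier := {K | GInv K ∧ ∃ c : k,
        matMul (wordKer k a) K = c • matMul (wordKer k a) (wordKer' k a)}
      zero_mem' := ⟨GInv.zero, 0, by rw [matMul_zero, zero_smul]⟩
      add_mem' := by
        rintro K L ⟨hK, c, hc⟩ ⟨hL, d, hd⟩
        exact ⟨hK.add hL, c + d, by rw [matMul_add (wordKer_gInv k a) hK hL, hc, hd, add_smul]⟩
      smul_mem' := by
        rintro r K ⟨hK, c, hc⟩
        exact ⟨hK.smul r, r * c, by rw [matMul_smul (wordKer_gInv k a) hK, hc, mul_smul]⟩ }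
  have h : indepSpan k m ⊔ Submodule.span k (Set.range (wordKer' (m := m) k)) ≤ N := by
    refine sup_le (Submodule.span_le.2 ?_) (Submodule.span_le.2 ?_)
    · rintro F ⟨hF, i, hi⟩
      exact ⟨hF, 0, by rw [wordKer_matMul_of_indep a hF hi, zero_smul]⟩
    · rintro _ ⟨b, rfl⟩
      refine ⟨wordKer'_gInv k b, ?_⟩
      by_cases hab : a = b
      · exact ⟨1, by rw [hab, one_smul]⟩
      · exact ⟨0, by rw [wordKer_matMul_wordKer' hab, zero_smul]⟩
  exact (h (gInv_mem hK)).2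

/-- Taking K to be the identity matrix in `exists_wordKer_matMul_eq'` writes `wordKer k a` itself as
a multiple of this product. The scalar is nonzero because `wordKer k a` is 1 on the diagonal, so it
can be inverted. -/
theorem wordKer_matMul_wordKer'_self (a : Fin m → Bool) :
    ∃ c : k, c ≠ 0 ∧ matMul (wordKer k a) (wordKer' k a) = c • wordKer k a := by
  obtain ⟨c, hc⟩ := exists_wordKer_matMul_eq' a (idMat_gInv (X := RTuple m) (k := k))
  rw [matMul_idMat] at hc
  have hc0 : c ≠ 0 := by
    rintro rfl
    obtain ⟨x, -⟩ := exists_wordRel a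
    have := congrFun (congrFun hc x) x
    rw [wordKer_self, zero_smul] at this
    exact one_ne_zero this
  refine ⟨c⁻¹, inv_ne_zero hc0, ?_⟩
  conv_rhs => rw [hc]
  rw [smul_smul, inv_mul_cancel₀ hc0, one_smul]

theorem exists_wordKer_matMul_eq (a : Fin m → Bool) {K : RTuple m → RTuple m → k} (hK : GInv K) :
    ∃ c : k, matMul (wordKer k a) K = c • wordKer k a := by
  obtain ⟨c, hc⟩ := exists_wordKer_matMul_eq' a hK
  obtain ⟨d, -, hd⟩ := wordKer_matMul_wordKer'_self (k := k) a
  exact ⟨c * d, by rw [hc, hd, mul_smul]⟩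

/-- The transpose of `exists_wordKer_matMul_eq` for the opposite word. -/
theorem exists_matMul_wordKer_eq (a : Fin m → Bool) {K : RTuple m → RTuple m → k} (hK : GInv K) :
    ∃ c : k, matMul K (wordKer k a) = c • wordKer k a := by
  obtain ⟨c, hc⟩ := exists_wordKer_matMul_eq (fun i => !a i) hK.swap
  refine ⟨c, ?_⟩
  have h := matMul_swap K (wordKer k a)
  rw [wordKer_swap k a, hc, ← wordKer_swap k a] at h
  funext x y
  exact congrFun (congrFun h y) x

/-- The product is known to be a scalar multiple of the kernel, and the scalar can be read off at
(x, x). There the integrand requires y to be related to x in both directions, which forces y = x, so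
the integral is 1. -/
theorem wordKer_mul_self (a : Fin m → Bool) :
    matMul (wordKer k a) (wordKer k a) = wordKer k a := by
  classical
  obtain ⟨c, hc⟩ := exists_wordKer_matMul_eq a (wordKer_gInv k a)
  obtain ⟨x, -⟩ := exists_wordRel a
  have h := congrFun (congrFun hc x) x
  have h1 : matMul (wordKer k a) (wordKer k a) x x = 1 := by
    rw [← integral_delta x (fun _ : RTuple m => (1 : k))]
    unfold matMul
    congr 1
    funext y
    split_ifs with hy
    · rw [hy, wordKer_self, one_mul]
    · unfold wordKer
      by_cases h1 : wordRel a x y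
      · refine mul_eq_zero_of_right _ (if_neg fun h2 => ?_)
        apply hy
        apply RTuple.ext
        intro i
        have h3 := h1.1 i
        have h4 := h2.1 i
        unfold wrel at h3 h4
        split_ifs at h3 h4
        · exact le_antisymm h4 h3
        · exact le_antisymm h3 h4
      · rw [if_neg h1, zero_mul]
  rw [h1, Pi.smul_apply, Pi.smul_apply, wordKer_self, smul_eq_mul, mul_one] at h
  rw [hc, ← h, one_smul]

/-- The product is a multiple c of the left factor and a multiple d of the right one. The diagonal
gives c = d, and a pair related by the word a alone gives c = 0. -/
theorem wordKer_mul_of_ne {a b : Fin m → Bool} (hab : a ≠ b) :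
    matMul (wordKer k a) (wordKer k b) = 0 := by
  obtain ⟨c, hc⟩ := exists_wordKer_matMul_eq a (wordKer_gInv k b)
  obtain ⟨d, hd⟩ := exists_matMul_wordKer_eq b (wordKer_gInv k a)
  obtain ⟨x, y, hxy, hxy'⟩ := exists_wordRel a
  have h1 : c = d := by
    have := congrFun (congrFun (hc.symm.trans hd) x) x
    simpa [wordKer_self] using this
  have h2 := congrFun (congrFun (hc.symm.trans hd) x) y
  have h3 : wordKer k a x y = 1 := if_pos hxy
  have h4 : wordKer k b x y = 0 := if_neg fun h => hab (hxy' b h).symm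
  rw [Pi.smul_apply, Pi.smul_apply, Pi.smul_apply, Pi.smul_apply, h3, h4, smul_zero, smul_eq_mul,
    mul_one] at h2
  rw [hc, h2, zero_smul]

theorem indepSpan_le (a : Fin m → Bool) {F : RTuple m → RTuple m → k} (hF : F ∈ indepSpan k m) :
    GInv F ∧ matMul (wordKer k a) F = 0 := by
  let N : Submodule k (RTuple m → RTuple m → k) :=
    { carrier := {K | GInv K ∧ matMul (wordKer k a) K = 0}
      zero_mem' := ⟨GInv.zero, matMul_zero _⟩
      add_mem' := by
        rintro K L ⟨hK, hc⟩ ⟨hL, hd⟩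
        exact ⟨hK.add hL, by rw [matMul_add (wordKer_gInv k a) hK hL, hc, hd, add_zero]⟩
      smul_mem' := by
        rintro r K ⟨hK, hc⟩
        exact ⟨hK.smul r, by rw [matMul_smul (wordKer_gInv k a) hK, hc, smul_zero]⟩ }
  have h : indepSpan k m ≤ N := by
    refine Submodule.span_le.2 ?_
    rintro F ⟨hF, i, hi⟩
    exact ⟨hF, wordKer_matMul_of_indep a hF hi⟩
  exact h hF

/-- Decompose K by `gInv_mem`. Multiplying by `wordKer k a` isolates the coefficient of `wordKer' k
a`, up to a nonzero scalar, so all these coefficients vanish. -/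
theorem mem_indepSpan_of_matMul_eq_zero {K : RTuple m → RTuple m → k} (hK : GInv K)
    (h : ∀ a, matMul (wordKer k a) K = 0) : K ∈ indepSpan k m := by
  classical
  obtain ⟨F, hF, L, hL, rfl⟩ := Submodule.mem_sup.1 (gInv_mem hK)
  obtain ⟨c, rfl⟩ := (Submodule.mem_span_range_iff_exists_fun k).1 hL
  have hw : ∀ b, GInv (c b • wordKer' (m := m) k b) := fun b => (wordKer'_gInv k b).smul _
  have hc : ∀ a, c a = 0 := by
    intro a
    obtain ⟨h1, h2⟩ := indepSpan_le a hF
    have h3 := h a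
    rw [matMul_add (wordKer_gInv k a) h1 (GInv.sum _ hw), h2, zero_add,
      matMul_sum _ (wordKer_gInv k a) hw, Finset.sum_eq_single a (fun b _ hb => by
        rw [matMul_smul (wordKer_gInv k a) (wordKer'_gInv k b), wordKer_matMul_wordKer' hb.symm,
          smul_zero]) (by simp),
      matMul_smul (wordKer_gInv k a) (wordKer'_gInv k a)] at h3
    obtain ⟨d, hd, hd'⟩ := wordKer_matMul_wordKer'_self (k := k) a
    obtain ⟨x, -⟩ := exists_wordRel a
    have h4 := congrFun (congrFun h3 x) x
    rw [hd'] at h4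
    simp only [Pi.smul_apply, wordKer_self, smul_eq_mul, mul_one, Pi.zero_apply, mul_eq_zero] at h4
    exact h4.resolve_right hd
  simpa [hc] using hF

/-- By orthogonality each `wordKer k a` annihilates the difference from the left. So, apart from the
word idempotents, the identity operator involves only kernels that omit a coordinate. -/
theorem idMat_sub_mem_indepSpan :
    idMat (RTuple m) k - ∑ a, wordKer (m := m) k a ∈ indepSpan k m := by
  classical
  have hs : GInv (∑ a, wordKer (m := m) k a) := GInv.sum _ (wordKer_gInv k)
  have e : idMat (RTuple m) k - ∑ a, wordKer (m := m) k a =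
      idMat (RTuple m) k + (-1 : k) • ∑ a, wordKer (m := m) k a := by
    rw [neg_one_smul, sub_eq_add_neg]
  rw [e]
  refine mem_indepSpan_of_matMul_eq_zero (idMat_gInv.add (hs.smul _)) fun a => ?_
  rw [matMul_add (wordKer_gInv k a) idMat_gInv (hs.smul _), matMul_smul (wordKer_gInv k a) hs,
    matMul_idMat, matMul_sum _ (wordKer_gInv k a) (wordKer_gInv k),
    Finset.sum_eq_single a (fun b _ hb => wordKer_mul_of_ne hb.symm) (by simp), wordKer_mul_self]
  simp

/-- The image of the idempotent attached to a word is a simple module. -/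
theorem isSimpleModule_range_wordKer (a : Fin m → Bool) :
    IsSimpleModule (CompletedGroupAlgebra k) (LinearMap.range (opOf _ (wordKer_gInv k a))) := by
  classical
  have hea := wordKer_gInv k a
  have idem : ∀ φ ∈ LinearMap.range (opOf _ hea), mulVec (wordKer k a) φ.1 = φ.1 := by
    rintro _ ⟨φ, rfl⟩
    rw [opOf_apply, mulVec_mulVec hea hea φ.2, wordKer_mul_self]
  rw [isSimpleModule_iff_toSpanSingleton_surjective]
  refine ⟨?_, ?_⟩
  · obtain ⟨x, -⟩ := exists_wordRel a
    refine ⟨⟨0, ⟨_, ⟨pointMass k x, rfl⟩⟩, fun h => ?_⟩⟩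
    have h1 : (opOf _ hea (pointMass k x)).1 x = 0 :=
      congrArg (fun ψ => ψ.1.1 x) h.symm
    have h2 : (opOf _ hea (pointMass k x)).1 x = 1 :=
      (congrFun (congrFun (matMul_idMat (wordKer k a)) x) x).trans (wordKer_self k a x)
    exact one_ne_zero (h2.symm.trans h1)
  rintro ⟨f, hf⟩ hf0
  have hfe := idem f hf
  obtain ⟨x₀, hx₀⟩ : ∃ x, f.1 x ≠ 0 := by
    by_contra hc
    push Not at hc
    exact hf0 (Subtype.ext (Subtype.ext (funext hc)))
  obtain ⟨U, hU⟩ := IsSchwartz.exists_invSub f.2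
  have hT := transMat_gInv hU
  -- It must be shown that f generates the image. Let T be the matrix with entries f(g⁻¹x), so that
  -- Tψ is the action on f of any element of A(G) with component ψ at U; S is the indicator of the
  -- orbit of (base coset, x₀).
  let S : G ⧸ U.1 → RTuple m → k := fun q x => if ∃ g : G, q = g • base U ∧ x = g • x₀ then 1 else 0
  have hS : GInv S := by
    intro g q x
    refine if_congr ⟨?_, ?_⟩ rfl rfl
    · rintro ⟨l, h1, h2⟩
      exact ⟨g⁻¹ * l, by rw [mul_smul, ← h1, inv_smul_smul], by rw [mul_smul, ← h2, inv_smul_smul]⟩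
    · rintro ⟨l, rfl, rfl⟩
      exact ⟨g * l, (mul_smul _ _ _).symm, (mul_smul _ _ _).symm⟩
  have hTS := matMul_gInv hT hS
  have heT : matMul (wordKer k a) (transMat U f.1) = transMat U f.1 := by
    funext x q
    induction q using Quotient.inductionOn with | _ l => ?_
    change mulVec (wordKer k a) (fun y => transMat U f.1 y (QuotientGroup.mk l)) x =
      transMat U f.1 x (QuotientGroup.mk l)
    simp only [transMat_mk hU]
    exact (mulVec_smul hea f.2 l⁻¹ x).symm.trans (congrFun hfe _)
  -- As f lies in the image of the idempotent, T is unchanged by left multiplication with it. Hence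
  -- TS is a scalar multiple of the idempotent.
  obtain ⟨c, hc⟩ := exists_wordKer_matMul_eq a hTS
  rw [← matMul_assoc hea hT hS, heT] at hc
  have hc0 : c ≠ 0 := by
    have h1 := congrFun (congrFun hc x₀) x₀
    rw [Pi.smul_apply, Pi.smul_apply, wordKer_self, smul_eq_mul, mul_one] at h1
    have s1 : IsSchwartz fun q : G ⧸ U.1 =>
        if orb (supp x₀) q = orb (supp x₀) (base U) then (1 : k) else 0 :=
      FixInv.isSchwartz (A := supp x₀) fun g hg t => by rw [orb_smul hg]
    -- The entry of TS at (x₀, x₀) is f(x₀) times the volume of an orbit of the stabilizer of x₀,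
    -- which is ±1. This entry is c, so c is nonzero.
    have h2 : matMul (transMat U f.1) S x₀ x₀ = f.1 x₀ * (orbitVol (supp x₀) (base U) : k) := by
      rw [← integral_orb, ← integral_const_mul _ s1]
      unfold matMul
      congr 1
      funext q
      have key : (∃ g : G, q = g • base U ∧ x₀ = g • x₀) ↔
          orb (supp x₀) q = orb (supp x₀) (base U) := by
        rw [orb_eq_iff]
        constructor
        · rintro ⟨g, h1, h2⟩
          exact ⟨g, mem_fix_supp.2 h2.symm, h1.symm⟩
        · rintro ⟨g, h1, h2⟩
          exact ⟨g, h2.symm, (mem_fix_supp.1 h1).symm⟩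
      by_cases hq : ∃ g : G, q = g • base U ∧ x₀ = g • x₀
      · rw [if_pos (key.1 hq)]
        have : S q x₀ = 1 := if_pos hq
        rw [this, mul_one, mul_one]
        obtain ⟨g, rfl, h2⟩ := hq
        rw [smul_base, transMat_mk hU]
        exact congrArg f.1 (inv_smul_eq_iff.2 h2)
      · rw [if_neg fun h => hq (key.2 h)]
        have : S q x₀ = 0 := if_neg hq
        rw [this, mul_zero, mul_zero]
    rw [← h1, h2]
    refine mul_ne_zero hx₀ ?_
    unfold orbitVol
    simp
  rintro ⟨φ, hφ⟩
  -- Since TS is c times the idempotent, which fixes φ, one has φ = T(c⁻¹ Sφ). Lifting c⁻¹ Sφ to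
  -- A(G) gives an element that maps f to φ.
  obtain ⟨b, hb⟩ := exists_comp_eq U ((Schwartz k (G ⧸ U.1)).smul_mem c⁻¹
    (mulVec_isSchwartz hS φ.2))
  refine ⟨b, Subtype.ext (Subtype.ext ?_)⟩
  change act b f.1 = φ.1
  rw [act_eq b hU, hb, mulVec_const_smul hT _ (mulVec_isSchwartz hS φ.2), mulVec_mulVec hT hS φ.2, hc,
    smul_mulVec _ hea φ.2, idem φ hφ, smul_smul, inv_mul_cancel₀ hc0, one_smul]

end Idempotents

/-! ### Semisimplicity of smooth modules -/

section Semisimple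

variable {k : Type u} [Field k]

theorem RTuple.del_surjective {m : ℕ} (i : Fin (m + 1)) : Function.Surjective (RTuple.del i) := by
  intro w
  obtain ⟨x, -⟩ := exists_wordRel (fun _ : Fin (m + 1) => true)
  obtain ⟨g, hg⟩ := exists_smul_rtuple_eq (x.del i) w
  exact ⟨g • x, (RTuple.del_smul i g x).trans hg⟩

variable (k) in
/-- The sum of the semisimple submodules. -/
noncomputable def semisimplePart (M : Type*) [AddCommGroup M] [Module (CompletedGroupAlgebra k) M] :
    Submodule (CompletedGroupAlgebra k) M :=
  sSup {P | IsSemisimpleModule (CompletedGroupAlgebra k) P}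

theorem range_le_of_isSemisimple {M N : Type*} [AddCommGroup M] [AddCommGroup N]
    [Module (CompletedGroupAlgebra k) M] [Module (CompletedGroupAlgebra k) N]
    [IsSemisimpleModule (CompletedGroupAlgebra k) M] (f : M →ₗ[CompletedGroupAlgebra k] N) :
    LinearMap.range f ≤ semisimplePart k N :=
  le_sSup (IsSemisimpleModule.range f)

theorem isSemisimple_of_forall_mem {M : Type*} [AddCommGroup M] [Module (CompletedGroupAlgebra k) M]
    (h : ∀ x : M, x ∈ semisimplePart k M) :
    IsSemisimpleModule (CompletedGroupAlgebra k) M := by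
  refine isSemisimpleModule_of_isSemisimpleModule_submodule'
    (p := fun P : {P : Submodule (CompletedGroupAlgebra k) M |
      IsSemisimpleModule (CompletedGroupAlgebra k) P} => P.1) (fun P => P.2) ?_
  rw [← sSup_eq_iSup', eq_top_iff]
  exact fun x _ => h x

/-- A kernel that omits the i-th coordinate factors through 𝒞(ℝ^(m-1)) by way of the map forgetting
that coordinate. Its image is therefore a quotient of a module that is semisimple by induction. -/
theorem mem_of_mem_indepSpan {m : ℕ} (ih : ∀ n < m, IsSemisimpleModule (CompletedGroupAlgebra k)
      (Schwartz k (RTuple n))) {F : RTuple m → RTuple m → k} (hF : F ∈ indepSpan k m)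
    (φ ψ : Schwartz k (RTuple m)) (hψ : ψ.1 = mulVec F φ.1) :
    ψ ∈ semisimplePart k (Schwartz k (RTuple m)) := by
  classical
  induction hF using Submodule.span_induction generalizing ψ with
  | mem F hF =>
    obtain ⟨hF, i, hi⟩ := hF
    cases m with
    | zero => exact i.elim0
    | succ m =>
      have := ih m (Nat.lt_succ_self m)
      have hs := Function.surjInv_eq (RTuple.del_surjective i)
      let F' : RTuple m → RTuple (m + 1) → k := fun w z =>
        F (Function.surjInv (RTuple.del_surjective i) w) z
      have hFF' : ∀ y z, F y z = F' (y.del i) z := fun y z =>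
        hi z y _ (RTuple.del_eq_iff.1 (hs (y.del i)).symm)
      have hF' : GInv F' := by
        intro g w z
        obtain ⟨y, rfl⟩ := RTuple.del_surjective i w
        rw [← RTuple.del_smul, ← hFF', ← hFF', hF]
      let P : RTuple (m + 1) → RTuple m → k := fun y w => idMat (RTuple m) k (y.del i) w
      have hP : GInv P := fun g y w => idMat_gInv g (y.del i) w
      refine range_le_of_isSemisimple (opOf P hP) ⟨opOf F' hF' φ, Subtype.ext ?_⟩
      rw [hψ, opOf_apply, opOf_apply]
      funext y
      refine (congrFun (mulVec_idMat (mulVec F' φ.1)) (y.del i)).trans ?_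
      unfold mulVec
      simp only [hFF']
  | zero =>
    have : ψ = 0 := Subtype.ext (by rw [hψ, zero_mulVec]; rfl)
    rw [this]
    exact zero_mem _
  | add F F' hF hF' h h' =>
    have g := (indepSpan_le (fun _ => true) hF).1
    have g' := (indepSpan_le (fun _ => true) hF').1
    have : ψ = opOf F g φ + opOf F' g' φ := Subtype.ext (by
      rw [hψ, add_mulVec g g' φ.2]; rfl)
    rw [this]
    exact add_mem (h _ rfl) (h' _ rfl)
  | smul c F hF h =>
    have g := (indepSpan_le (fun _ => true) hF).1
    have : ψ = algebraMap k (CompletedGroupAlgebra k) c • opOf F g φ := Subtype.ext (by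
      rw [hψ, smul_mulVec c g φ.2]
      exact (algebraMap_smul_schwartz c (opOf F g φ)).symm)
    rw [this]
    exact Submodule.smul_mem _ _ (h _ rfl)

/-- Split the identity operator into the word idempotents and the remainder. The former have simple
images, and the remainder maps into the semisimple part by `mem_of_mem_indepSpan`. -/
theorem isSemisimpleModule_rtuple (m : ℕ) :
    IsSemisimpleModule (CompletedGroupAlgebra k) (Schwartz k (RTuple m)) := by
  classical
  induction m using Nat.strong_induction_on with | _ m ih => ?_
  refine isSemisimple_of_forall_mem fun φ => ?_
  have hmem := idMat_sub_mem_indepSpan (k := k) (m := m)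
  have hs : ∀ a ∈ Finset.univ, GInv (wordKer (m := m) k a) := fun a _ => wordKer_gInv k a
  have hdec : φ = opOf _ (indepSpan_le (fun _ => true) hmem).1 φ +
      ∑ a, opOf _ (wordKer_gInv k a) φ := by
    apply Subtype.ext
    have h1 : ∀ s : Finset (Fin m → Bool), (∑ a ∈ s, opOf _ (wordKer_gInv k a) φ).1 =
        mulVec (∑ a ∈ s, wordKer k a) φ.1 := by
      intro s
      induction s using Finset.induction_on with
      | empty => exact (zero_mulVec _).symm
      | insert a s ha ih =>
        rw [Finset.sum_insert ha, Finset.sum_insert ha,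
          add_mulVec (wordKer_gInv k a) (GInv.sum s (wordKer_gInv k)) φ.2, ← ih]
        rfl
    refine Eq.trans ?_ (congrArg₂ (· + ·) rfl (h1 Finset.univ).symm)
    rw [opOf_apply, ← add_mulVec (indepSpan_le (fun _ => true) hmem).1
      (GInv.sum _ (wordKer_gInv k)) φ.2, sub_add_cancel, mulVec_idMat]
  rw [hdec]
  refine add_mem (mem_of_mem_indepSpan ih hmem φ (opOf _ (indepSpan_le (fun _ => true) hmem).1 φ) rfl) (Submodule.sum_mem _ fun a _ => ?_)
  have := isSimpleModule_range_wordKer (k := k) a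
  exact le_sSup (a := LinearMap.range (opOf _ (wordKer_gInv k a)))
    (show IsSemisimpleModule _ _ from inferInstance) ⟨φ, rfl⟩

theorem comp_eq_zero_of_smul_pointMass {X : Type} [MulAction G X] [FinitaryGSet X] {x : X}
    {a : CompletedGroupAlgebra k} (h : a • pointMass k x = 0) : a.comp (stab x) = 0 := by
  funext q
  induction q using Quotient.inductionOn with | _ g => ?_
  exact (act_pointMass a x g).symm.trans (congrFun (congrArg Subtype.val h) (g • x))

/-- The module `𝒞(ℝ^(n))` is generated by a point mass, and its relations are those which hold in
all smooth modules. -/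
theorem exists_linearMap_pointMass {M : Type*} [AddCommGroup M] [Module (CompletedGroupAlgebra k) M]
    {n : ℕ} (x : RTuple n) (v : M)
    (hv : ∀ a : CompletedGroupAlgebra k, a.comp (stab x) = 0 → a • v = 0) :
    ∃ f : Schwartz k (RTuple n) →ₗ[CompletedGroupAlgebra k] M, f (pointMass k x) = v := by
  let s := LinearMap.toSpanSingleton (CompletedGroupAlgebra k) (Schwartz k (RTuple n)) (pointMass k x)
  have hs : Function.Surjective s := fun φ => exists_smul_pointMass x φ fun y hy =>
    absurd (exists_smul_rtuple_eq x y) fun ⟨g, hg⟩ => hy g hg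
  let t := LinearMap.toSpanSingleton (CompletedGroupAlgebra k) M v
  -- An element that kills the point mass has zero component at the stabilizer of x, hence kills v;
  -- so a • δ_x ↦ a • v is well defined.
  have hst : LinearMap.ker s ≤ LinearMap.ker t := fun a ha =>
    hv a (comp_eq_zero_of_smul_pointMass (X := RTuple n) (x := x) ha)
  refine ⟨(Submodule.liftQ (LinearMap.ker s) t hst) ∘ₗ (s.quotKerEquivOfSurjective hs).symm, ?_⟩
  have h1 : (s.quotKerEquivOfSurjective hs).symm (pointMass k x) = Submodule.Quotient.mk 1 := by
    rw [LinearEquiv.symm_apply_eq]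
    exact (one_smul (CompletedGroupAlgebra k) (pointMass k x)).symm
  change Submodule.liftQ _ t hst ((s.quotKerEquivOfSurjective hs).symm (pointMass k x)) = v
  rw [h1]
  exact one_smul _ v

/-- An open subgroup is some G(B), which is the stabilizer of the tuple that lists B in increasing
order. -/
theorem exists_stab_eq (U : OpenSub) : ∃ (n : ℕ) (x : RTuple n), stab x = U := by
  obtain ⟨B, hB⟩ := exists_eq_fix U.2
  obtain ⟨x, hx⟩ := exists_supp_rtuple_eq (S := B) rfl
  refine ⟨_, x, Subtype.ext ?_⟩
  exact (stabilizer_eq x).trans (by rw [hx, hB])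

/-- Smoothness of v involves an open subgroup, which may be taken to be the stabilizer of a tuple.
Thus the modules 𝒞(ℝ^(n)) generate the category of smooth modules. -/
theorem SmoothRep.exists_linearMap (M : SmoothRep k) (v : M.obj) :
    ∃ (n : ℕ) (x : RTuple n) (f : Schwartz k (RTuple n) →ₗ[CompletedGroupAlgebra k] M.obj),
      f (pointMass k x) = v := by
  obtain ⟨U, hU⟩ := M.property v
  obtain ⟨n, x, rfl⟩ := exists_stab_eq U
  exact ⟨n, x, exists_linearMap_pointMass x v hU⟩

/-- Smooth modules are semisimple. -/
instance SmoothRep.isSemisimpleModule (M : SmoothRep k) :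
    IsSemisimpleModule (CompletedGroupAlgebra k) M.obj := by
  refine isSemisimple_of_forall_mem fun v => ?_
  obtain ⟨n, x, f, rfl⟩ := M.exists_linearMap v
  have := isSemisimpleModule_rtuple (k := k) n
  exact range_le_of_isSemisimple f ⟨_, rfl⟩

/-- For semisimple modules, finite length and finite generation are equivalent. -/
theorem SmoothRep.isFiniteLength_iff (M : SmoothRep k) :
    IsFiniteLength (CompletedGroupAlgebra k) M.obj ↔ Module.Finite (CompletedGroupAlgebra k) M.obj := by
  have := (IsSemisimpleModule.finite_tfae (R := CompletedGroupAlgebra k) (M := M.obj)).out 0 3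
  exact this.symm

end Semisimple

end Delannoy

namespace Delannoy

open CategoryTheory.Limits

/-! ### Biproducts of permutation modules -/

section Biproducts

variable {k : Type u} [CommRing k]

theorem entry_sum {ι : Type*} (s : Finset ι) {X Y : Perm k} (f : ι → (X ⟶ Y)) :
    entry (∑ i ∈ s, f i : X ⟶ Y) = ∑ i ∈ s, entry (f i) :=
  map_sum (⟨⟨entry, rfl⟩, fun _ _ => rfl⟩ : (X ⟶ Y) →+ (Y.carrier → X.carrier → k)) f s

instance finitaryGSet_sigma {ι : Type} [Finite ι] (Y : ι → Type) [∀ i, MulAction G (Y i)]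
    [∀ i, FinitaryGSet (Y i)] : FinitaryGSet (Σ i, Y i) where
  smooth := by
    rintro ⟨i, y⟩
    obtain ⟨A, hA⟩ := FinitaryGSet.smooth y
    exact ⟨A, fun g hg => congrArg (Sigma.mk i) (MulAction.mem_stabilizer_iff.1 (hA hg))⟩
  finitary := by
    have : ∀ i, Finite (MulAction.orbitRel.Quotient G (Y i)) := fun i => FinitaryGSet.finitary
    refine Finite.of_surjective
      (fun p : Σ i, MulAction.orbitRel.Quotient G (Y i) =>
        (Quotient.mk _ ⟨p.1, p.2.out⟩ : MulAction.orbitRel.Quotient G (Σ i, Y i))) fun R => ?_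
    induction R using Quotient.inductionOn with | _ z => ?_
    obtain ⟨i, y⟩ := z
    refine ⟨⟨i, Quotient.mk _ y⟩, ?_⟩
    obtain ⟨g, hg⟩ := MulAction.orbitRel_apply.1
      (Quotient.exact (Quotient.out_eq (Quotient.mk (MulAction.orbitRel G (Y i)) y)))
    exact Quotient.sound (MulAction.orbitRel_apply.2 ⟨g, congrArg (Sigma.mk i) hg⟩)

variable {ι : Type} {Y : ι → Perm k} {X : Perm k} {θ : ∀ i, (Y i).carrier → X.carrier}
  (hθ : ∀ i (g : G) y, θ i (g • y) = g • θ i y)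
  (hinj : Function.Injective fun p : Σ i, (Y i).carrier => θ p.1 p.2)

/-- The inclusion given by an equivariant map. -/
noncomputable def graphHom {X Y : Perm k} {θ : Y.carrier → X.carrier}
    (hθ : ∀ (g : G) y, θ (g • y) = g • θ y) : Y ⟶ X :=
  matOf (graphMat k θ) (graphMat_gInv hθ)

/-- The projection given by an equivariant map. -/
noncomputable def graphHom' {X Y : Perm k} {θ : Y.carrier → X.carrier}
    (hθ : ∀ (g : G) y, θ (g • y) = g • θ y) : X ⟶ Y :=
  matOf (fun y x => graphMat k θ x y) (graphMat_gInv hθ).swap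

open Classical in
theorem entry_graphHom_comp {X Y Y' : Perm k} {θ : Y.carrier → X.carrier} {θ' : Y'.carrier → X.carrier}
    (hθ : ∀ (g : G) y, θ (g • y) = g • θ y) (hθ' : ∀ (g : G) y, θ' (g • y) = g • θ' y)
    (y' : Y'.carrier) (y : Y.carrier) :
    entry (graphHom hθ ≫ graphHom' hθ') y' y = if θ' y' = θ y then 1 else 0 := by
  change (integral fun x => graphMat k θ' x y' * graphMat k θ x y) = _
  rw [← integral_delta (θ y) (fun x : X.carrier => if θ' y' = x then (1 : k) else 0)]
  congr 1
  funext x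
  unfold graphMat
  by_cases h : x = θ y
  · rw [if_pos h, if_pos h.symm, mul_one]
  · rw [if_neg h, if_neg (Ne.symm h), mul_zero]

open Classical in
theorem entry_graphHom'_comp {X Y : Perm k} {θ : Y.carrier → X.carrier}
    (hθ : ∀ (g : G) y, θ (g • y) = g • θ y) (hinj : Function.Injective θ) (x' x : X.carrier) :
    entry (graphHom' hθ ≫ graphHom hθ) x' x = if x' = x ∧ ∃ y, θ y = x then 1 else 0 := by
  change (integral fun y => graphMat k θ x' y * graphMat k θ x y) = _
  by_cases h : ∃ y, θ y = x
  · obtain ⟨y₀, rfl⟩ := h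
    refine Eq.trans ?_ ((integral_delta y₀ (fun y : Y.carrier => if θ y = x' then (1 : k) else 0)).trans
      (if_congr ?_ rfl rfl))
    · congr 1
      funext y
      unfold graphMat
      by_cases h : y = y₀
      · rw [if_pos h, if_pos (congrArg θ h), mul_one]
      · rw [if_neg h, if_neg (fun h' => h (hinj h')), mul_zero]
    · exact ⟨fun h => ⟨h.symm, _, rfl⟩, fun h => h.1.symm⟩
  · rw [if_neg fun h' => h h'.2]
    refine Eq.trans ?_ (integral_zero (X := Y.carrier))
    congr 1
    funext y
    unfold graphMat
    rw [if_neg (fun h' : θ y = x => h ⟨y, h'⟩), mul_zero]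

/-- A decomposition of a finitary `G`-set gives a bicone of permutation modules. -/
noncomputable def permBicone : Bicone Y where
  pt := X
  π j := graphHom' (hθ j)
  ι j := graphHom (hθ j)
  ι_π j j' := by
    classical
    split_ifs with h
    · subst h
      apply mat_ext
      funext y' y
      refine (entry_graphHom_comp _ _ y' y).trans (if_congr ?_ rfl rfl)
      exact ⟨fun h => eq_of_heq (Sigma.mk.inj (@hinj ⟨j, y'⟩ ⟨j, y⟩ h)).2, fun h => congrArg _ h⟩
    · apply mat_ext
      funext y' y
      refine (entry_graphHom_comp _ _ y' y).trans (if_neg fun h' => h ?_)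
      exact (Sigma.mk.inj (@hinj ⟨j', y'⟩ ⟨j, y⟩ h')).1.symm

/-- Projection followed by inclusion for one piece is the diagonal matrix restricted to that piece.
Every point of X lies in exactly one piece, so these matrices add up to the identity. -/
noncomputable def isBilimit_permBicone [Fintype ι] (hsurj : ∀ x, ∃ i y, θ i y = x) :
    (permBicone hθ hinj).IsBilimit :=
  isBilimitOfTotal _ (by
    classical
    apply mat_ext
    refine (entry_sum _ _).trans ?_
    funext x' x
    obtain ⟨i, y, hy⟩ := hsurj x
    have hi : ∀ j, Function.Injective (θ j) := fun j y y' h =>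
      eq_of_heq (Sigma.mk.inj (@hinj ⟨j, y⟩ ⟨j, y'⟩ h)).2
    rw [Finset.sum_apply, Finset.sum_apply]
    refine (Finset.sum_congr rfl fun j _ => entry_graphHom'_comp (hθ j) (hi j) x' x).trans ?_
    rw [Finset.sum_eq_single i]
    · refine if_congr ⟨fun h => h.1, fun h => ⟨h, y, hy⟩⟩ rfl rfl
    · rintro j - hj
      refine if_neg ?_
      rintro ⟨-, y', hy'⟩
      exact hj (Sigma.mk.inj (@hinj ⟨j, y'⟩ ⟨i, y⟩ (hy'.trans hy.symm))).1
    · simp)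

instance : HasFiniteBiproducts (Perm k) where
  out n := ⟨fun Y => by
    let X : Perm k := Perm.mk (Σ i, (Y i).carrier)
    let θ : ∀ i, (Y i).carrier → X.carrier := fun i y => ⟨i, y⟩
    exact HasBiproduct.mk ⟨permBicone (X := X) (θ := θ) (fun _ _ _ => rfl) fun _ _ h => h,
      isBilimit_permBicone _ _ fun x => ⟨x.1, x.2, rfl⟩⟩⟩

end Biproducts

/-! ### Fully faithful functors from the additive envelope -/

section MatLift

variable {C : Type*} [Category C] [Preadditive C] {D : Type*} [Category D] [Preadditive D]
  [HasFiniteBiproducts D] (F : C ⥤ D) [F.Additive]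

/-- The extension of an additive functor to the additive envelope. (The functor `Mat_.lift`
requires the categories to live in the same universes.) -/
noncomputable def matLift : Mat_ C ⥤ D where
  obj M := ⨁ fun i => F.obj (M.X i)
  map f := biproduct.matrix fun i j => F.map (f i j)
  map_id M := by
    apply biproduct.hom_ext'
    intro i
    apply biproduct.hom_ext
    intro j
    by_cases h : i = j
    · subst h; simp
    · simp [Mat_.id_apply_of_ne _ _ _ h, biproduct.ι_π_ne _ h]
  map_comp f g := by
    apply biproduct.hom_ext'
    intro i
    apply biproduct.hom_ext
    intro j
    simp [biproduct.lift_desc]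

/-- The inclusion of a summand. -/
noncomputable def matLiftι (M : Mat_ C) (i : M.ι) : F.obj (M.X i) ⟶ (matLift F).obj M :=
  biproduct.ι (fun i => F.obj (M.X i)) i

/-- The projection to a summand. -/
noncomputable def matLiftπ (M : Mat_ C) (i : M.ι) : (matLift F).obj M ⟶ F.obj (M.X i) :=
  biproduct.π (fun i => F.obj (M.X i)) i

variable {F}

theorem matLift_hom_ext {M N : Mat_ C} {f g : (matLift F).obj M ⟶ (matLift F).obj N}
    (h : ∀ i j, matLiftι F M i ≫ f ≫ matLiftπ F N j = matLiftι F M i ≫ g ≫ matLiftπ F N j) :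
    f = g :=
  biproduct.hom_ext' _ _ fun i => biproduct.hom_ext _ _ fun j =>
    (Category.assoc _ _ _).trans ((h i j).trans (Category.assoc _ _ _).symm)

theorem matLiftι_map_π {M N : Mat_ C} (f : M ⟶ N) (i : M.ι) (j : N.ι) :
    matLiftι F M i ≫ (matLift F).map f ≫ matLiftπ F N j = F.map (f i j) :=
  (congrArg (biproduct.ι (fun i => F.obj (M.X i)) i ≫ ·) (biproduct.matrix_π _ j)).trans
    (biproduct.ι_desc _ i)

theorem matLiftι_π (M : Mat_ C) (i : M.ι) : matLiftι F M i ≫ matLiftπ F M i = 𝟙 _ :=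
  biproduct.ι_π_self _ i

theorem matLiftι_π_ne (M : Mat_ C) {i j : M.ι} (h : i ≠ j) : matLiftι F M i ≫ matLiftπ F M j = 0 :=
  biproduct.ι_π_ne _ h

instance : (matLift F).Additive where
  map_add {M N f g} := matLift_hom_ext fun i j => by
    rw [Preadditive.add_comp, Preadditive.comp_add, matLiftι_map_π, matLiftι_map_π, matLiftι_map_π]
    exact F.map_add

variable (F) in
/-- The functor `matLift F` extends `F`. -/
noncomputable def embeddingMatLiftIso : Mat_.embedding C ⋙ matLift F ≅ F :=
  NatIso.ofComponents
    (fun X =>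
      { hom := matLiftπ F ((Mat_.embedding C).obj X) PUnit.unit
        inv := matLiftι F ((Mat_.embedding C).obj X) PUnit.unit
        hom_inv_id := matLift_hom_ext (M := (Mat_.embedding C).obj X) fun i j => by
          obtain rfl : i = PUnit.unit := rfl
          obtain rfl : j = PUnit.unit := rfl
          have h : ∀ {A B : D} {a : A ⟶ B} {b : B ⟶ A}, a ≫ b = 𝟙 A → a ≫ (b ≫ a) ≫ b = a ≫ 𝟙 B ≫ b :=
            fun h => by rw [Category.assoc, h, reassoc_of% h, Category.id_comp, h]
          exact h (matLiftι_π (F := F) ((Mat_.embedding C).obj X) PUnit.unit)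
        inv_hom_id := matLiftι_π (F := F) ((Mat_.embedding C).obj X) PUnit.unit })
    fun {X Y} f => by
      refine biproduct.hom_ext' _ _ fun i => ?_
      obtain rfl : i = PUnit.unit := rfl
      have h := matLiftι_π (F := F) ((Mat_.embedding C).obj X) PUnit.unit
      have h' := matLiftι_map_π (F := F) ((Mat_.embedding C).map f) PUnit.unit PUnit.unit
      exact h'.trans ((Category.id_comp _).symm.trans ((congrArg (· ≫ F.map f) h.symm).trans
        (Category.assoc _ _ _)))

instance [F.Full] : (matLift F).Full where
  map_surjective {M N} g :=
    ⟨fun i j => F.preimage (matLiftι F M i ≫ g ≫ matLiftπ F N j), matLift_hom_ext fun i j =>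
      (matLiftι_map_π _ i j).trans (F.map_preimage _)⟩

instance [F.Faithful] : (matLift F).Faithful where
  map_injective {M N f g} h := by
    ext i j
    apply F.map_injective
    rw [← matLiftι_map_π, ← matLiftι_map_π, h]

end MatLift

/-! ### Decomposition of permutation modules -/

section Decomposition

variable (k : Type u) [CommRing k]

/-- Every orbit is isomorphic to some `ℝ^(n)`. -/
theorem exists_rtuple_orbit {X : Type} [MulAction G X] [FinitaryGSet X] (x : X) :
    ∃ (n : ℕ) (θ : RTuple n → X), (∀ (g : G) y, θ (g • y) = g • θ y) ∧ Function.Injective θ ∧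
      ∀ x', (∃ y, θ y = x') ↔ ∃ g : G, g • x = x' := by
  -- The tuple b listing the support of x has the same stabilizer as x, so g • b ↦ g • x identifies
  -- the two orbits whatever group elements γ are chosen below.
  obtain ⟨b, hb⟩ := exists_supp_rtuple_eq (S := supp x) rfl
  have hst : ∀ g : G, g • b = b ↔ g • x = x := fun g => by
    rw [← mem_fix_supp, ← mem_fix_supp, hb]
  have hst' : ∀ g g' : G, g • b = g' • b ↔ g • x = g' • x := fun g g' => by
    rw [← inv_smul_eq_iff, ← mul_smul, hst, mul_smul, inv_smul_eq_iff]
  choose γ hγ using fun y => exists_smul_rtuple_eq b y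
  have hθ : ∀ g : G, γ (g • b) • x = g • x := fun g => (hst' _ _).1 (hγ _)
  refine ⟨_, fun y => γ y • x, fun g y => ?_, fun y y' h => ?_, fun x' => ⟨?_, ?_⟩⟩
  · obtain ⟨l, rfl⟩ := exists_smul_rtuple_eq b y
    change γ (g • l • b) • x = g • γ (l • b) • x
    rw [← mul_smul, hθ, hθ, mul_smul]
  · rw [← hγ y, ← hγ y']
    exact (hst' _ _).2 h
  · rintro ⟨y, rfl⟩
    exact ⟨_, rfl⟩
  · rintro ⟨g, rfl⟩
    exact ⟨g • b, hθ g⟩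

variable {k} (h : PathCompAssoc k ∧ PathCompUnital k)

/-- X is the disjoint union of its finitely many orbits, each a copy of some ℝ^(n), and such a
decomposition is a biproduct of permutation modules. -/
instance : (matLift (pathToPerm h)).EssSurj where
  mem_essImage X := by
    classical
    have : Finite (MulAction.orbitRel.Quotient G X.carrier) := FinitaryGSet.finitary
    have := Fintype.ofFinite (MulAction.orbitRel.Quotient G X.carrier)
    choose n θ hθ hi hr using fun O : MulAction.orbitRel.Quotient G X.carrier =>
      exists_rtuple_orbit O.out
    let M : Mat_ (PathCat k h) := ⟨MulAction.orbitRel.Quotient G X.carrier, fun O => ⟨n O⟩⟩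
    have horb : ∀ O y, (Quotient.mk _ (θ O y) : MulAction.orbitRel.Quotient G X.carrier) = O := by
      intro O y
      obtain ⟨g, hg⟩ := (hr O (θ O y)).1 ⟨y, rfl⟩
      rw [← hg]
      exact (Quotient.sound (MulAction.orbitRel_apply.2 ⟨g, rfl⟩)).trans (Quotient.out_eq O)
    refine ⟨M, ⟨(biproduct.uniqueUpToIso _ (isBilimit_permBicone
      (Y := fun O => (pathToPerm h).obj (M.X O)) (X := X) (θ := θ) hθ ?_ ?_)).symm⟩⟩
    · rintro ⟨O, y⟩ ⟨O', y'⟩ e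
      have e : θ O y = θ O' y' := e
      obtain rfl : O = O' := (horb O y).symm.trans ((congrArg _ e).trans (horb O' y'))
      rw [hi O e]
    · intro x
      refine ⟨Quotient.mk _ x, (hr _ x).2 ?_⟩
      obtain ⟨g, hg⟩ := MulAction.orbitRel_apply.1 (Quotient.exact (Quotient.out_eq
        (Quotient.mk (MulAction.orbitRel G X.carrier) x)))
      exact ⟨g⁻¹, by rw [← hg, inv_smul_smul]⟩

instance : (matLift (pathToPerm h)).IsEquivalence where

end Decomposition

end Delannoy

namespace Delannoy

open CategoryTheory.Limits

/-! ### Functors from the Karoubi envelope -/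

section KaroubiExtension

variable {C : Type*} [Category C] [Preadditive C] {D : Type*} [Category D] [Preadditive D]
  (F : C ⥤ D)

/-- The functor between Karoubi envelopes given by a functor. -/
def karoubiMap : Karoubi C ⥤ Karoubi D where
  obj P := ⟨F.obj P.X, F.map P.p, by rw [← F.map_comp, P.idem]⟩
  map {P Q} f := ⟨F.map f.f, (by rw [← F.map_comp, ← F.map_comp, f.comm] : F.map P.p ≫ F.map f.f ≫ F.map Q.p = F.map f.f)⟩
  map_comp f g := Karoubi.hom_ext _ _ (F.map_comp f.f g.f)

instance [F.Full] : (karoubiMap F).Full where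
  map_surjective {P Q} g := by
    obtain ⟨f, hf⟩ := F.map_surjective g.f
    refine ⟨⟨P.p ≫ f ≫ Q.p, by simp [reassoc_of% P.idem, Q.idem]⟩, Karoubi.hom_ext _ _ ?_⟩
    have h : F.map (P.p ≫ f ≫ Q.p) = g.f := by
      rw [F.map_comp, F.map_comp, hf]
      exact g.comm
    exact h

instance [F.Faithful] : (karoubiMap F).Faithful where
  map_injective h := Karoubi.hom_ext _ _ (F.map_injective (congrArg Karoubi.Hom.f h))

instance [F.Additive] : (karoubiMap F).Additive where
  map_add {_ _ f g} := Karoubi.hom_ext _ _ (F.map_add (f := f.f) (g := g.f))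

/-- The functor `karoubiMap F` extends `F`. -/
def toKaroubiKaroubiMapIso : toKaroubi C ⋙ karoubiMap F ≅ F ⋙ toKaroubi D :=
  NatIso.ofComponents
    (fun X =>
      { hom := ⟨𝟙 (F.obj X), (by simp : F.map (𝟙 X) ≫ 𝟙 (F.obj X) ≫ 𝟙 (F.obj X) = 𝟙 (F.obj X))⟩
        inv := ⟨𝟙 (F.obj X), (by simp : 𝟙 (F.obj X) ≫ 𝟙 (F.obj X) ≫ F.map (𝟙 X) = 𝟙 (F.obj X))⟩
        hom_inv_id := Karoubi.hom_ext _ _ (by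
          have h : 𝟙 (F.obj X) ≫ 𝟙 (F.obj X) = F.map (𝟙 X) := by simp
          exact h)
        inv_hom_id := Karoubi.hom_ext _ _ (Category.comp_id _) })
    fun f => Karoubi.hom_ext _ _ ((Category.comp_id _).trans (Category.id_comp _).symm)

/-- If N is a retract of F X, the idempotent r ≫ s of F X lifts to X because F is full, and the lift
is idempotent because F is faithful. The pair of X and the lift is sent to N, up to isomorphism. -/
theorem karoubiMap_essSurj [F.Full] [F.Faithful] [IsIdempotentComplete D]
    (hF : ∀ N : D, ∃ (X : C) (s : N ⟶ F.obj X) (r : F.obj X ⟶ N), s ≫ r = 𝟙 N) :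
    (karoubiMap F).EssSurj where
  mem_essImage Q := by
    obtain ⟨N, ⟨e⟩⟩ := (inferInstance : (toKaroubi D).EssSurj).mem_essImage Q
    obtain ⟨X, s, r, hsr⟩ := hF N
    obtain ⟨p, hp⟩ := F.map_surjective (r ≫ s)
    have hpp : p ≫ p = p := F.map_injective (by
      rw [F.map_comp, hp, Category.assoc, reassoc_of% hsr])
    refine ⟨⟨X, p, hpp⟩, ⟨Iso.trans ?_ e⟩⟩
    exact
      { hom := ⟨r, (by rw [hp, Category.comp_id, Category.assoc, hsr, Category.comp_id] :
          F.map p ≫ r ≫ 𝟙 N = r)⟩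
        inv := ⟨s, (by rw [hp, Category.id_comp, reassoc_of% hsr] : 𝟙 N ≫ s ≫ F.map p = s)⟩
        hom_inv_id := Karoubi.hom_ext _ _ hp.symm
        inv_hom_id := Karoubi.hom_ext _ _ hsr }

end KaroubiExtension

/-! ### Representations of finite length -/

section FiniteLength

variable {k : Type u} [Field k]

theorem isFiniteLength_schwartzRep (X : Type) [MulAction G X] [FinitaryGSet X] :
    IsFiniteLengthRep k (schwartzRep k X) :=
  (schwartzRep k X).isFiniteLength_iff.2
    (inferInstanceAs (Module.Finite (CompletedGroupAlgebra k) (Schwartz k X)))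

/-- An idempotent is split by its image, a submodule, which inherits smoothness and finite length.
-/
instance : IsIdempotentComplete (RepFin k) where
  idempotents_split M p hp := by
    let f : M.obj.obj →ₗ[CompletedGroupAlgebra k] M.obj.obj := p.hom.hom.hom
    have hf : ∀ v, f (f v) = f v := fun v => congrArg (fun q => q.hom.hom.hom v) hp
    let N : RepFin k := ⟨⟨ModuleCat.of _ (LinearMap.range f), fun v => by
      obtain ⟨U, hU⟩ := M.obj.property v.1
      exact ⟨U, fun a ha => Subtype.ext (hU a ha)⟩⟩,
      M.property.of_injective (LinearMap.range f).injective_subtype⟩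
    let i : LinearMap.range f →ₗ[CompletedGroupAlgebra k] M.obj.obj := (LinearMap.range f).subtype
    let e : M.obj.obj →ₗ[CompletedGroupAlgebra k] LinearMap.range f := f.rangeRestrict
    refine ⟨N, ObjectProperty.homMk (ObjectProperty.homMk (ModuleCat.ofHom i)),
      ObjectProperty.homMk (ObjectProperty.homMk (ModuleCat.ofHom e)), ?_, ?_⟩
    · ext v
      obtain ⟨w, hw⟩ := v.2
      change f v.1 = v.1
      rw [← hw, hf]
    · ext v
      rfl

variable (h : PathCompAssoc k ∧ PathCompUnital k)

theorem isFiniteLength_matLift (M : Mat_ (PathCat k h)) :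
    IsFiniteLengthRep k ((matLift (pathToPerm h) ⋙ permToRep k).obj M) :=
  isFiniteLength_schwartzRep ((matLift (pathToPerm h)).obj M).carrier

/-- The functor from the additive envelope of the path category to representations of finite
length. -/
noncomputable def matToRepFin : Mat_ (PathCat k h) ⥤ RepFin k :=
  (IsFiniteLengthRep k).lift (matLift (pathToPerm h) ⋙ permToRep k) (isFiniteLength_matLift h)

instance : (matToRepFin h).Full := by unfold matToRepFin; infer_instance
instance : (matToRepFin h).Faithful := by unfold matToRepFin; infer_instance
instance : (matToRepFin h).Additive := by unfold matToRepFin; infer_instance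

/-- N is generated by finitely many elements, each the image of a point mass under a map from some
𝒞(ℝ^(n)). Their sum is a surjection onto N, and it splits because N and its cover are semisimple. -/
theorem exists_retract (N : RepFin k) : ∃ (M : Mat_ (PathCat k h)) (s : N ⟶ (matToRepFin h).obj M)
    (r : (matToRepFin h).obj M ⟶ N), s ≫ r = 𝟙 N := by
  classical
  have := N.obj.isFiniteLength_iff.1 N.property
  obtain ⟨d, v, hv⟩ := Module.Finite.exists_fin (R := CompletedGroupAlgebra k) (M := N.obj.obj)
  choose n x f hf using fun i => N.obj.exists_linearMap (v i)
  let M : Mat_ (PathCat k h) := ⟨Fin d, fun i => ⟨n i⟩⟩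
  let P := permToRep k
  let L := matLift (pathToPerm h)
  let f' : ∀ i, P.obj ((pathToPerm h).obj (M.X i)) ⟶ N.obj := fun i =>
    ObjectProperty.homMk (ModuleCat.ofHom (f i))
  let r : P.obj (L.obj M) ⟶ N.obj := ∑ i, P.map (matLiftπ (pathToPerm h) M i) ≫ f' i
  have hr : ∀ i, P.map (matLiftι (pathToPerm h) M i) ≫ r = f' i := by
    intro i
    rw [Preadditive.comp_sum, Finset.sum_eq_single i]
    · rw [← Category.assoc, ← P.map_comp, matLiftι_π, P.map_id, Category.id_comp]
    · intro j _ hj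
      rw [← Category.assoc, ← P.map_comp, matLiftι_π_ne M hj.symm, P.map_zero, zero_comp]
    · simp
  let r' : (P.obj (L.obj M)).obj →ₗ[CompletedGroupAlgebra k] N.obj.obj := r.hom.hom
  have hsurj : Function.Surjective r' := by
    -- It is enough to hit the generators, and the i-th one is the image of the point mass in the
    -- i-th summand.
    rw [← LinearMap.range_eq_top, eq_top_iff, ← hv, Submodule.span_le]
    rintro _ ⟨i, rfl⟩
    refine ⟨(P.map (matLiftι (pathToPerm h) M i)).hom.hom (pointMass k (x i)), ?_⟩
    exact (congrArg (fun q => q.hom.hom (pointMass k (x i))) (hr i)).trans (hf i)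
  obtain ⟨s, hs⟩ := IsSemisimpleModule.lifting_property r' hsurj LinearMap.id
  refine ⟨M, ObjectProperty.homMk (ObjectProperty.homMk (ModuleCat.ofHom s)),
    ObjectProperty.homMk r, ?_⟩
  ext w
  exact LinearMap.congr_fun hs w

/-- The functor from the additive-Karoubian envelope of the path category to representations of
finite length. -/
noncomputable def karoubiToRepFin : Karoubi (Mat_ (PathCat k h)) ⥤ RepFin k :=
  karoubiMap (matToRepFin h) ⋙ (toKaroubiEquivalence (RepFin k)).inverse

instance : (karoubiMap (matToRepFin h)).IsEquivalence where
  essSurj := karoubiMap_essSurj _ (exists_retract h)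

instance : (karoubiToRepFin h).IsEquivalence := by unfold karoubiToRepFin; infer_instance

instance : (karoubiToRepFin h).Additive := by unfold karoubiToRepFin; infer_instance

/-- The functor `karoubiToRepFin` extends the functor to `Rep(G)`. -/
noncomputable def karoubiToRepFinIso :
    Mat_.embedding (PathCat k h) ⋙ toKaroubi _ ⋙ karoubiToRepFin h ⋙ (IsFiniteLengthRep k).ι ≅
      pathToPerm h ⋙ permToRep k :=
  let e : toKaroubi _ ⋙ karoubiToRepFin h ≅ matToRepFin h :=
    Functor.isoWhiskerRight (toKaroubiKaroubiMapIso (matToRepFin h))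
        (toKaroubiEquivalence (RepFin k)).inverse ≪≫
      Functor.isoWhiskerLeft (matToRepFin h) (toKaroubiEquivalence (RepFin k)).unitIso.symm ≪≫
      Functor.rightUnitor _
  Functor.isoWhiskerLeft (Mat_.embedding _) (Functor.isoWhiskerRight e (IsFiniteLengthRep k).ι) ≪≫
    Functor.isoWhiskerRight (embeddingMatLiftIso (pathToPerm h)) (permToRep k)

end FiniteLength

end Delannoy

/-! ### Assembly of the claims -/

theorem theorem8p4 (k : Type u) [Field k] :
    (∀ (n m l : ℕ) (p₁ : DPath ![n, m]) (p₂ : DPath ![m, l]) (p₃ : DPath ![n, l])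
      (q q' : DPath ![n, m, l]), IsLift q p₁ p₂ p₃ → IsLift q' p₁ p₂ p₃ → q = q') ∧
    ∃ h : PathCompAssoc k ∧ PathCompUnital k,
    ∃ (Φ : PathCat k h ⥤ SmoothRep k) (hΦ : ∀ n, Φ.obj ⟨n⟩ = schwartzRep k (RTuple n)),
      (Φ.Additive ∧ Φ.Linear k ∧ ∀ (n m : ℕ) (p : DPath ![n, m]),
        Φ.map (PathCat.ofPath h p) =
          eqToHom (hΦ m) ≫ pathOp k p ≫ eqToHom (hΦ n).symm) ∧
      (Φ.Full ∧ Φ.Faithful) ∧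
      (ObjectProperty.lift (fun M => ∃ n, M = schwartzRep k (RTuple n)) Φ
        (fun X => ⟨X.n, hΦ X.n⟩)).IsEquivalence ∧
      (∃ E : Mat_ (PathCat k h) ⥤ Perm k, E.Additive ∧ E.IsEquivalence ∧
        Nonempty (Mat_.embedding (PathCat k h) ⋙ E ⋙ permToRep k ≅ Φ)) ∧
      (∃ F : Karoubi (Mat_ (PathCat k h)) ⥤ RepFin k, F.Additive ∧ F.IsEquivalence ∧
        Nonempty (Mat_.embedding (PathCat k h) ⋙ toKaroubi _ ⋙ F ⋙ (IsFiniteLengthRep k).ι ≅ Φ)) := by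
  refine ⟨fun n m l p₁ p₂ p₃ q q' hq hq' => hq.unique hq', ⟨pathCompAssoc k, pathCompUnital k⟩, ?_⟩
  set h : PathCompAssoc k ∧ PathCompUnital k := ⟨pathCompAssoc k, pathCompUnital k⟩
  let Φ : PathCat k h ⥤ SmoothRep k := pathToPerm h ⋙ permToRep k
  have hfull : Φ.Full := inferInstanceAs (pathToPerm h ⋙ permToRep k).Full
  have hfaithful : Φ.Faithful := inferInstanceAs (pathToPerm h ⋙ permToRep k).Faithful
  refine ⟨Φ, fun n => rfl, ⟨inferInstanceAs (pathToPerm h ⋙ permToRep k).Additive,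
    inferInstanceAs ((pathToPerm h ⋙ permToRep k).Linear k), fun n m p => ?_⟩,
    ⟨hfull, hfaithful⟩, ?_, ⟨matLift (pathToPerm h), inferInstance, inferInstance,
      ⟨Functor.isoWhiskerRight (embeddingMatLiftIso (pathToPerm h)) (permToRep k)⟩⟩,
    karoubiToRepFin h, inferInstance, inferInstance, ⟨karoubiToRepFinIso h⟩⟩
  -- The object equalities hold by definition here, so both transport morphisms are identities and
  -- only the matrices of the two operators have to agree.
  · refine Eq.trans ?_ ((Category.id_comp _).trans (Category.comp_id _)).symm
    exact congrArg (permToRep k).map (pathToPerm_ofPath h p)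
  · exact
      { faithful := inferInstance
        full := inferInstance
        essSurj := ⟨fun M => by
          obtain ⟨n, hn⟩ := M.property
          exact ⟨⟨n⟩, ⟨ObjectProperty.isoMk _ (eqToIso hn.symm)⟩⟩⟩ }
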